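/- **Proposition 3.1.** Let $X$ be a smooth projective variety over $\mathbb{C}$ of dimension $n\ge 1$ with tangent bundle $T_X$, and let $A$ be an ample divisor on $X$. Let $\pi:\mathbb{P}(T_X)=\operatorname{Proj}(\operatorname{Sym} T_X)\to X$ be the projectivized tangent bundle in the sense of Grothendieck (an integral scheme, with $\pi$ dominant), and let $\xi=c_1(\mathcal{O}_{\mathbb{P}(T_X)}(1))$. An $\mathbb{R}$-divisor class, i.e. an element of $\operatorname{Pic}(\mathbb{P}(T_X))\otimes_{\mathbb{Z}}\mathbb{R}$, is called effective if it is a finite linear combination, with nonnegative real coefficients, of classes of effective divisors. Put $$\Delta(X,A)=\sup\{\varepsilon\in\mathbb{R}\;:\;\xi-\varepsilon\,\pi^*A \text{ is effective}\}.$$ Then the set on the right is nonempty and bounded above, so that $\Delta(X,A)$ is a real number, and $$\Delta(X,A)=\sup\Big\{\tfrac dr\;:\;d\in\mathbb{Z},\ r\in\mathbb{Z}_{\ge1},\ H^0\big(X,\operatorname{Sym}^rT_X\otimes\mathcal{O}_X(-dA)\big)\neq0\Big\},$$ where this set is also nonempty and bounded above. Moreover, $T_X$ is big if and only if $\Delta(X,A)>0$.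 Here a line bundle $L$ on a complex projective variety $Y$ is big if for some $m>0$ one has $H^0(Y,L^{\otimes m})\ne0$ and the rational map $Y\dashrightarrow\mathbb{P}(H^0(Y,L^{\otimes m}))$ is birational onto its image, and $T_X$ is big if the line bundle $\mathcal{O}_{\mathbb{P}(T_X)}(1)$ is big. -/

import Mathlib

open CategoryTheory AlgebraicGeometry TopologicalSpace

set_option linter.unusedSectionVars false

noncomputable section

namespace TangentBig

section Divisors

variable (X : Scheme.{0}) [IsIntegral X]

/-- The field of rational functions on an integral scheme, i.e. the local ring at the generic
point. -/
def RatFun : Type := X.functionField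

instance : Field (RatFun X) := inferInstanceAs (Field X.functionField)

/-- The inclusion of the local ring at `x` into the function field. -/
def stalkToRat (x : X) : X.presheaf.stalk x →+* RatFun X :=
  algebraMap (X.presheaf.stalk x) X.functionField

/-- The unit group of the local ring at `x`, inside the unit group of the function field. -/
def stalkUnits (x : X) : Subgroup (RatFun X)ˣ :=
  (Units.map (stalkToRat X x).toMonoidHom).range

/-- The stalk at `x` of the sheaf `K^* / O^*`, written additively. -/
def DivisorGerm (x : X) : Type := Additive ((RatFun X)ˣ ⧸ stalkUnits X x)

instance (x : X) : AddCommGroup (DivisorGerm X x) :=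
  inferInstanceAs (AddCommGroup (Additive ((RatFun X)ˣ ⧸ stalkUnits X x)))

/-- The class in `K^* / O^*` at `x` of a nonzero rational function. -/
def divisorGerm (x : X) : Additive (RatFun X)ˣ →+ DivisorGerm X x :=
  (QuotientGroup.mk' (stalkUnits X x)).toAdditive

/-- The group of global sections of the sheaf `K^* / O^*`. -/
def cartierDivisors : AddSubgroup (∀ x : X, DivisorGerm X x) where
  carrier := {D | ∀ x : X, ∃ U : X.Opens, x ∈ U ∧ ∃ f : Additive (RatFun X)ˣ,
    ∀ y ∈ U, D y = divisorGerm X y f}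
  zero_mem' := fun _ => ⟨⊤, trivial, 0, fun _ _ => (map_zero _).symm⟩
  add_mem' := by
    intro D E hD hE x
    obtain ⟨U, hU, f, hf⟩ := hD x
    obtain ⟨V, hV, g, hg⟩ := hE x
    exact ⟨U ⊓ V, ⟨hU, hV⟩, f + g, fun y hy => by
      rw [Pi.add_apply, hf y hy.1, hg y hy.2, map_add]⟩
  neg_mem' := by
    intro D hD x
    obtain ⟨U, hU, f, hf⟩ := hD x
    exact ⟨U, hU, -f, fun y hy => by rw [Pi.neg_apply, hf y hy, map_neg]⟩

/-- Cartier divisors on an integral scheme (additively written). -/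
abbrev CartierDivisor : Type := cartierDivisors X

variable {X}

/-- `f` is a local equation of the Cartier divisor `D` at `x`. -/
def CartierDivisor.IsEquationAt (D : CartierDivisor X) (x : X) (f : (RatFun X)ˣ) : Prop :=
  D.1 x = divisorGerm X x (Additive.ofMul f)

/-- A Cartier divisor is effective if its local equations are regular. -/
def CartierDivisor.IsEffective (D : CartierDivisor X) : Prop :=
  ∀ (x : X) (f : (RatFun X)ˣ), D.IsEquationAt x f → (f : RatFun X) ∈ (stalkToRat X x).range

/-- `s` is a global section of `O_X(D)`, regarded as a subsheaf of the constant sheaf of rational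
functions: `O_X(D)` is generated at `x` by the inverse of a local equation of `D`. -/
def CartierDivisor.IsSection (D : CartierDivisor X) (s : RatFun X) : Prop :=
  ∀ (x : X) (f : (RatFun X)ˣ), D.IsEquationAt x f → s * f ∈ (stalkToRat X x).range

/-- The rational function `s` is a generator of the stalk of `O_X(D)` at `x`. -/
def CartierDivisor.IsGeneratorAt (D : CartierDivisor X) (s : RatFun X) (x : X) : Prop :=
  ∃ f : (RatFun X)ˣ, D.IsEquationAt x f ∧ s * f = 1

/-- A Cartier divisor `A` (on a quasi-compact scheme) is ample if every point lies in an affine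
open set of the form `X_s = {y | s generates O(mA) at y}` with `m > 0` and `s ∈ H⁰(X, O(mA))`. -/
def CartierDivisor.IsAmple (A : CartierDivisor X) : Prop :=
  ∀ x : X, ∃ m : ℕ, 0 < m ∧ ∃ s : RatFun X, (m • A).IsSection s ∧
    ∃ U : X.Opens, IsAffineOpen U ∧ x ∈ U ∧ ∀ y : X, y ∈ U ↔ (m • A).IsGeneratorAt s y

variable (X)

/-- The divisor of a nonzero rational function. -/
def principalDivisor : Additive (RatFun X)ˣ →+ CartierDivisor X where
  toFun f := ⟨fun x => divisorGerm X x f, fun _ => ⟨⊤, trivial, f, fun _ _ => rfl⟩⟩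
  map_zero' := Subtype.ext (funext fun _ => map_zero _)
  map_add' _ _ := Subtype.ext (funext fun _ => map_add _ _ _)

/-- The group of Cartier divisors modulo linear equivalence. -/
abbrev PicGroup : Type := CartierDivisor X ⧸ (principalDivisor X).range

/-- Classes of `ℝ`-divisors modulo `ℝ`-linear equivalence. -/
abbrev RealPic : Type := TensorProduct ℤ ℝ (PicGroup X)

variable {X} in
/-- The class of a Cartier divisor, i.e. the first Chern class of `O_X(D)`. -/
def CartierDivisor.cls (D : CartierDivisor X) : RealPic X :=
  TensorProduct.tmul ℤ (1 : ℝ) (QuotientAddGroup.mk D : PicGroup X)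

/-- The cone of effective classes: finite combinations with nonnegative real coefficients of
classes of effective divisors. -/
def effectiveCone : Submodule NNReal (RealPic X) :=
  Submodule.span NNReal {c | ∃ D : CartierDivisor X, D.IsEffective ∧ D.cls = c}

end Divisors

section Pullback

variable {X Y : Scheme.{0}} [IsIntegral X] [IsIntegral Y] (g : Y ⟶ X) [IsDominant g]

lemma genericPoint_specializes_of_isDominant : g (genericPoint Y) ⤳ genericPoint X := by
  rw [specializes_iff_mem_closure, ← Set.image_singleton]
  have h := closure_mono (image_closure_subset_closure_image g.continuous (s := {genericPoint Y}))
  rw [closure_closure] at h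
  apply h
  rw [genericPoint_closure, Set.image_univ, g.denseRange.closure_range]
  trivial

/-- Pullback of rational functions along a dominant morphism of integral schemes. -/
def pullbackFunction : RatFun X →+* RatFun Y :=
  (X.presheaf.stalkSpecializes (genericPoint_specializes_of_isDominant g) ≫
    g.stalkMap (genericPoint Y)).hom

lemma pullbackFunction_stalkToRat (y : Y) (a : X.presheaf.stalk (g y)) :
    pullbackFunction g (stalkToRat X (g y) a) = stalkToRat Y y (g.stalkMap y a) := by
  change (X.presheaf.stalkSpecializes _ ≫ X.presheaf.stalkSpecializes _ ≫
      g.stalkMap (genericPoint Y)).hom a = (g.stalkMap y ≫ Y.presheaf.stalkSpecializes _).hom a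
  rw [TopCat.Presheaf.stalkSpecializes_comp_assoc]
  erw [← Scheme.Hom.stalkSpecializes_stalkMap g _ _ (genericPoint_specializes y)]

lemma stalkUnits_le_comap (y : Y) : stalkUnits X (g y) ≤
    (stalkUnits Y y).comap (Units.map (pullbackFunction g).toMonoidHom) := by
  rintro _ ⟨u, rfl⟩
  exact ⟨Units.map (g.stalkMap y).hom.toMonoidHom u,
    Units.ext (pullbackFunction_stalkToRat g y u).symm⟩

/-- Pullback of Cartier divisors along a dominant morphism of integral schemes: pull back the
local equations. -/
def CartierDivisor.pullback (D : CartierDivisor X) : CartierDivisor Y :=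
  ⟨fun y => (QuotientGroup.map _ _ _ (stalkUnits_le_comap g y)).toAdditive (D.1 (g y)), by
    intro y
    obtain ⟨U, hU, f, hf⟩ := D.2 (g y)
    exact ⟨g ⁻¹ᵁ U, hU, (Units.map (pullbackFunction g).toMonoidHom).toAdditive f, fun z hz => by
      dsimp only; rw [hf (g z) hz]; rfl⟩⟩

end Pullback

section SymmetricAlgebra

open scoped DirectSum

variable (R M : Type) [CommRing R] [AddCommGroup M] [Module R M]

/-- The `r`-th symmetric power of `M`, as the degree `r` part of the symmetric algebra. -/
def symPow (r : ℕ) : Submodule R (SymmetricAlgebra R M) :=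
  LinearMap.range (SymmetricAlgebra.ι R M) ^ r

variable {M} in
lemma ι_mem_symPow (m : M) : SymmetricAlgebra.ι R M m ∈ symPow R M 1 := by
  simp [symPow]

instance : SetLike.GradedMonoid (symPow R M) where
  one_mem := by simp only [symPow, pow_zero]; exact Submodule.one_le.mp le_rfl
  mul_mem i j _ _ hx hy := by
    simp only [symPow, pow_add] at *
    exact Submodule.mul_mem_mul hx hy

/-- Auxiliary map for the grading of the symmetric algebra. -/
def gradedι : M →ₗ[R] ⨁ i : ℕ, ↥(symPow R M i) :=
  DirectSum.lof R ℕ (fun i => ↥(symPow R M i)) 1 ∘ₗ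
    (SymmetricAlgebra.ι R M).codRestrict _ (ι_mem_symPow R)

/-- The grading of the symmetric algebra by symmetric powers. -/
instance symGrading : GradedAlgebra (symPow R M) :=
  GradedAlgebra.ofAlgHom _ (SymmetricAlgebra.lift (gradedι R M))
    (by
      ext m
      simp [gradedι, DirectSum.lof_eq_of, DirectSum.coeAlgHom_of])
    fun i x => by
      obtain ⟨x, hx⟩ := x
      dsimp only [DirectSum.lof_eq_of]
      unfold symPow at hx
      induction hx using Submodule.pow_induction_on_left' with
      | algebraMap r =>
        rw [AlgHom.commutes, DirectSum.algebraMap_apply]; rfl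
      | add x y i hx hy ihx ihy =>
        rw [map_add, ihx, ihy, ← map_add]
        rfl
      | mem_mul m hm i x hx ih =>
        obtain ⟨_, rfl⟩ := hm
        rw [map_mul, ih, SymmetricAlgebra.lift_ι_apply]
        simp only [gradedι, LinearMap.comp_apply, DirectSum.lof_eq_of]
        erw [DirectSum.of_mul_of]
        exact DirectSum.of_eq_of_gradedMonoid_eq (Sigma.subtype_ext (add_comm _ _) rfl)

variable {R M} {S N : Type} [CommRing S] [AddCommGroup N] [Module S N] {ρ : R →+* S}

/-- The map on symmetric algebras induced by a semilinear map. -/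
def symMap (φ : M →ₛₗ[ρ] N) : SymmetricAlgebra R M →+* SymmetricAlgebra S N :=
  letI := ((algebraMap S (SymmetricAlgebra S N)).comp ρ).toAlgebra
  (SymmetricAlgebra.lift
    { toFun := fun m => SymmetricAlgebra.ι S N (φ m)
      map_add' := fun x y => by simp
      map_smul' := fun r x => by
        rw [map_smulₛₗ, map_smul, Algebra.smul_def, Algebra.smul_def]; rfl } :
    SymmetricAlgebra R M →ₐ[R] SymmetricAlgebra S N).toRingHom

@[simp]
lemma symMap_ι (φ : M →ₛₗ[ρ] N) (m : M) :
    symMap φ (SymmetricAlgebra.ι R M m) = SymmetricAlgebra.ι S N (φ m) := by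
  let _ := ((algebraMap S (SymmetricAlgebra S N)).comp ρ).toAlgebra
  exact SymmetricAlgebra.lift_ι_apply _ _

@[simp]
lemma symMap_algebraMap (φ : M →ₛₗ[ρ] N) (r : R) :
    symMap φ (algebraMap R _ r) = algebraMap S _ (ρ r) := by
  let _ := ((algebraMap S (SymmetricAlgebra S N)).comp ρ).toAlgebra
  exact AlgHom.commutes (SymmetricAlgebra.lift _ :
    SymmetricAlgebra R M →ₐ[R] SymmetricAlgebra S N) r

lemma symMap_smul (φ : M →ₛₗ[ρ] N) (r : R) (x : SymmetricAlgebra R M) :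
    symMap φ (r • x) = ρ r • symMap φ x := by
  rw [Algebra.smul_def, map_mul, symMap_algebraMap, ← Algebra.smul_def]

lemma symMap_mem (φ : M →ₛₗ[ρ] N) {r : ℕ} {x : SymmetricAlgebra R M} (hx : x ∈ symPow R M r) :
    symMap φ x ∈ symPow S N r := by
  unfold symPow at hx
  induction hx using Submodule.pow_induction_on_left' with
  | algebraMap a => rw [symMap_algebraMap]; exact SetLike.algebraMap_mem_graded (symPow S N) _
  | add x y i hx hy ihx ihy => rw [map_add]; exact add_mem ihx ihy
  | mem_mul m hm i x hx ih =>
    obtain ⟨m, rfl⟩ := hm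
    rw [map_mul, symMap_ι, Nat.succ_eq_add_one, add_comm]
    exact SetLike.mul_mem_graded (ι_mem_symPow S (φ m)) ih

lemma ringHom_symAlg_ext {T : Type} [CommRing T] {f g : SymmetricAlgebra R M →+* T}
    (h₁ : ∀ r, f (algebraMap R _ r) = g (algebraMap R _ r))
    (h₂ : ∀ m, f (SymmetricAlgebra.ι R M m) = g (SymmetricAlgebra.ι R M m)) : f = g := by
  refine RingHom.ext fun x => ?_
  induction x using SymmetricAlgebra.induction with
  | algebraMap r => exact h₁ r
  | ι m => exact h₂ m
  | mul a b ha hb => rw [map_mul, map_mul, ha, hb]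
  | add a b ha hb => rw [map_add, map_add, ha, hb]

/-- The graded version of `symMap`. -/
def symMapGraded (φ : M →ₛₗ[ρ] N) : symPow R M →+*ᵍ symPow S N where
  toRingHom := symMap φ
  map_mem := symMap_mem φ

lemma irrelevant_le_of_span (φ : M →ₛₗ[ρ] N) (h : Submodule.span S (Set.range φ) = ⊤) :
    (HomogeneousIdeal.irrelevant (symPow S N)) ≤
      (HomogeneousIdeal.irrelevant (symPow R M)).map (symMapGraded φ) := by
  rw [HomogeneousIdeal.irrelevant_le]
  have key : ∀ n : N, SymmetricAlgebra.ι S N n ∈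
      ((HomogeneousIdeal.irrelevant (symPow R M)).map (symMapGraded φ)).toIdeal := by
    intro n
    have hn : n ∈ Submodule.span S (Set.range φ) := h ▸ Submodule.mem_top
    induction hn using Submodule.span_induction with
    | mem x hx =>
      obtain ⟨m, rfl⟩ := hx
      rw [← symMap_ι φ m]
      exact Ideal.mem_map_of_mem _
        (HomogeneousIdeal.mem_irrelevant_of_mem _ zero_lt_one (ι_mem_symPow R m))
    | zero => rw [map_zero]; exact zero_mem _
    | add x y _ _ hx hy => rw [map_add]; exact add_mem hx hy
    | smul a x _ hx =>
      rw [map_smul, Algebra.smul_def]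
      exact Ideal.mul_mem_left _ _ hx
  intro i hi x hx
  obtain ⟨j, rfl⟩ : ∃ j, i = j + 1 := ⟨i - 1, by omega⟩
  change x ∈ LinearMap.range (SymmetricAlgebra.ι S N) ^ (j + 1) at hx
  rw [pow_succ] at hx
  induction hx using Submodule.mul_induction_on' with
  | mem_mul_mem a _ b hb =>
    obtain ⟨m, rfl⟩ := hb
    exact Ideal.mul_mem_left _ _ (key m)
  | add x _ y _ hx hy => exact add_mem hx hy

/-- If `S = R[1/g]` and `N = M[1/g]`, then `Sym_S N = (Sym_R M)[1/g]`. -/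
lemma symMap_localization (φ : M →ₛₗ[ρ] N) (g : R) (hu : IsUnit (ρ g))
    (hρ : ∀ s, ∃ (n : ℕ) (r : R), ρ g ^ n * s = ρ r)
    (hρ' : ∀ r, ρ r = 0 → ∃ n : ℕ, g ^ n * r = 0)
    (hφ : ∀ s, ∃ (n : ℕ) (r : M), ρ g ^ n • s = φ r)
    (hφ' : ∀ r, φ r = 0 → ∃ n : ℕ, g ^ n • r = 0) :
    (∀ z, ∃ (n : ℕ) (a : SymmetricAlgebra R M), algebraMap S _ (ρ g) ^ n * z = symMap φ a) ∧
    (∀ a, symMap φ a = 0 → ∃ n : ℕ, algebraMap R (SymmetricAlgebra R M) g ^ n * a = 0) := by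
  constructor
  · intro z
    induction z using SymmetricAlgebra.induction with
    | algebraMap s =>
      obtain ⟨n, r, h⟩ := hρ s
      exact ⟨n, algebraMap R _ r, by rw [symMap_algebraMap, ← h, map_mul, map_pow]⟩
    | ι x =>
      obtain ⟨n, r, h⟩ := hφ x
      exact ⟨n, SymmetricAlgebra.ι R M r, by
        rw [symMap_ι, ← h, map_smul, Algebra.smul_def, map_pow]⟩
    | mul a b ha hb =>
      obtain ⟨n, a', ha⟩ := ha
      obtain ⟨m, b', hb⟩ := hb
      exact ⟨n + m, a' * b', by rw [map_mul, ← ha, ← hb, pow_add]; ring⟩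
    | add a b ha hb =>
      obtain ⟨n, a', ha⟩ := ha
      obtain ⟨m, b', hb⟩ := hb
      exact ⟨n + m, algebraMap R _ g ^ m * a' + algebraMap R _ g ^ n * b', by
        simp only [map_add, map_mul, map_pow, symMap_algebraMap]
        rw [← ha, ← hb, pow_add]; ring⟩
  · let L := Localization.Away (algebraMap R (SymmetricAlgebra R M) g)
    let _ : Algebra R S := ρ.toAlgebra
    have hS : IsLocalization.Away g S :=
      { map_units := by
          rintro ⟨_, n, rfl⟩
          exact (map_pow ρ g n).symm ▸ hu.pow n
        surj := fun s => by
          obtain ⟨n, r, h⟩ := hρ s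
          exact ⟨(r, ⟨g ^ n, n, rfl⟩), by
            change s * ρ (g ^ n) = ρ r
            rw [← h, map_pow, mul_comm]⟩
        exists_of_eq := fun {x y} h => by
          obtain ⟨n, hn⟩ := hρ' (x - y) (by rw [map_sub]; exact sub_eq_zero.mpr h)
          exact ⟨⟨g ^ n, n, rfl⟩, by
            change g ^ n * x = g ^ n * y
            rwa [mul_sub, sub_eq_zero] at hn⟩ }
    let _ : Module R N := Module.compHom N ρ
    have : IsScalarTower R S N := ⟨fun r s n => by
      change (ρ r * s) • n = ρ r • s • n
      rw [mul_smul]⟩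
    let φ' : M →ₗ[R] N :=
      { toFun := φ, map_add' := map_add φ, map_smul' := fun r m => map_smulₛₗ φ r m }
    have hN : IsLocalizedModule (Submonoid.powers g) φ' :=
      { map_units := by
          rintro ⟨_, n, rfl⟩
          rw [Module.End.isUnit_iff]
          have h := (Module.End.isUnit_iff _).mp ((hu.pow n).map (algebraMap S (Module.End S N)))
          convert h using 1
          ext x
          change ρ (g ^ n) • x = (ρ g) ^ n • x
          rw [map_pow]
        surj := fun s => by
          obtain ⟨n, r, h⟩ := hφ s
          exact ⟨(r, ⟨g ^ n, n, rfl⟩), by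
            change ρ (g ^ n) • s = φ r
            rw [← h, map_pow]⟩
        exists_of_eq := fun {x y} h => by
          obtain ⟨n, hn⟩ := hφ' (x - y) (by rw [map_sub]; exact sub_eq_zero.mpr h)
          exact ⟨⟨g ^ n, n, rfl⟩, by
            change g ^ n • x = g ^ n • y
            rwa [smul_sub, sub_eq_zero] at hn⟩ }
    let j : SymmetricAlgebra R M →+* L := algebraMap _ L
    have hj : IsUnit ((j.comp (algebraMap R (SymmetricAlgebra R M))) g) :=
      IsLocalization.Away.algebraMap_isUnit (S := L) (algebraMap R (SymmetricAlgebra R M) g)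
    let σ : S →+* L := IsLocalization.Away.lift g hj
    have hσ : ∀ r, σ (ρ r) = j (algebraMap R _ r) := fun r => IsLocalization.Away.lift_eq g hj r
    let _ : Algebra S L := σ.toAlgebra
    have hRL : ∀ r, algebraMap R L r = j (algebraMap R _ r) := fun r =>
      IsScalarTower.algebraMap_apply R (SymmetricAlgebra R M) L r
    have : IsScalarTower R S L :=
      IsScalarTower.of_algebraMap_eq fun r => (hRL r).trans (hσ r).symm
    have hun : ∀ x : Submonoid.powers g, IsUnit (algebraMap R (Module.End R L) x) := by
      rintro ⟨_, n, rfl⟩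
      rw [Module.End.isUnit_iff]
      have h := (Module.End.isUnit_iff _).mp ((hj.pow n).map (algebraMap L (Module.End L L)))
      convert h using 1
      ext x
      change (g ^ n) • x = (j (algebraMap R _ g) ^ n) • x
      rw [Algebra.smul_def, hRL, map_pow, map_pow, smul_eq_mul]
    let τ₀ : M →ₗ[R] L :=
      { toFun := fun m => j (SymmetricAlgebra.ι R M m)
        map_add' := fun x y => by simp
        map_smul' := fun r x => by
          rw [map_smul, Algebra.smul_def, Algebra.smul_def, map_mul, hRL]; rfl }
    let τ : N →ₗ[S] L := (IsLocalizedModule.lift (Submonoid.powers g) φ' τ₀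
      hun).extendScalarsOfIsLocalization (Submonoid.powers g) S
    have hτ : ∀ m, τ (φ m) = j (SymmetricAlgebra.ι R M m) := fun m =>
      IsLocalizedModule.lift_apply (Submonoid.powers g) φ' τ₀ hun m
    have hT : (SymmetricAlgebra.lift τ).toRingHom.comp (symMap φ) = j := by
      refine ringHom_symAlg_ext (fun r => ?_) (fun m => ?_)
      · simp only [RingHom.comp_apply, symMap_algebraMap]
        exact ((SymmetricAlgebra.lift τ).commutes _).trans (hσ r)
      · simp only [RingHom.comp_apply, symMap_ι]
        exact (SymmetricAlgebra.lift_ι_apply _ _).trans (hτ m)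
    intro a ha
    have h0 : j a = 0 := by rw [← hT, RingHom.comp_apply, ha, map_zero]
    obtain ⟨⟨_, n, rfl⟩, hn⟩ := (IsLocalization.map_eq_zero_iff
      (Submonoid.powers (algebraMap R (SymmetricAlgebra R M) g)) L a).mp h0
    exact ⟨n, hn⟩

end SymmetricAlgebra

section GradedLocalization

open HomogeneousLocalization

variable {A B : Type} [CommRing A] [CommRing B] {σ τ : Type} [SetLike σ A] [SetLike τ B]
  [AddSubgroupClass σ A] [AddSubgroupClass τ B] {𝒜 : ℕ → σ} {ℬ : ℕ → τ} [GradedRing 𝒜]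
  [GradedRing ℬ] (f : 𝒜 →+*ᵍ ℬ)

lemma val_fromZero_pow_mul (g : 𝒜 0) (k : ℕ) {d : ℕ} {s : A} (hsd : s ∈ 𝒜 d) (n : ℕ) (x : A)
    (hx : x ∈ 𝒜 (n • d)) :
    (fromZeroRingHom 𝒜 (.powers s) g ^ k * Away.mk 𝒜 hsd n x hx).val =
      Localization.mk ((g : A) ^ k * x) (⟨s ^ n, n, rfl⟩ : Submonoid.powers s) := by
  change HomogeneousLocalization.val ((HomogeneousLocalization.mk _) ^ k * _) = _
  rw [HomogeneousLocalization.val_mul, HomogeneousLocalization.val_pow, Away.val_mk,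
    HomogeneousLocalization.val_mk, Localization.mk_pow, Localization.mk_mul]
  congr 1
  ext
  simp

lemma away_localization (g : 𝒜 0) (u : ℬ 0) (hu : IsUnit u) (hfu : f g = u)
    (hs : ∀ z, ∃ (n : ℕ) (a : A), f g ^ n * z = f a)
    (hk : ∀ a, f a = 0 → ∃ n : ℕ, (g : A) ^ n * a = 0) {d : ℕ} (s : A) (hsd : s ∈ 𝒜 d) :
    letI := (Away.map f s).toAlgebra
    IsLocalization ((Submonoid.powers g).map (fromZeroRingHom 𝒜 (.powers s)))
      (Away ℬ (f s)) := by
  let _ := (Away.map f s).toAlgebra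
  have hgu : Away.map f s (fromZeroRingHom 𝒜 _ g) = fromZeroRingHom ℬ _ u := by
    change HomogeneousLocalization.map f _ (HomogeneousLocalization.mk _) =
      HomogeneousLocalization.mk _
    rw [HomogeneousLocalization.map_mk]
    ext
    simp [hfu]
  refine ⟨?_, ?_, ?_⟩
  · rintro ⟨_, _, ⟨n, rfl⟩, rfl⟩
    change IsUnit (Away.map f s _)
    simp only [map_pow]
    rw [hgu]
    exact (hu.map _).pow n
  · intro z
    obtain ⟨n, b, hb, rfl⟩ := Away.mk_surjective ℬ (f.2 hsd) z
    obtain ⟨k, a, ha⟩ := hs b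
    have hmem : f g ^ k * b ∈ ℬ (n • d) := by
      have := SetLike.mul_mem_graded (SetLike.pow_mem_graded k u.2) hb
      rw [hfu]
      simpa using this
    have h' : f (DirectSum.decompose 𝒜 a (n • d)) = f g ^ k * b := by
      rw [GradedRingHom.map_directSumDecompose, ← ha, DirectSum.decompose_of_mem_same _ hmem]
    refine ⟨(Away.mk 𝒜 hsd n _ (DirectSum.decompose 𝒜 a (n • d)).2,
      ⟨_, g ^ k, ⟨k, rfl⟩, rfl⟩), ?_⟩
    suffices h : fromZeroRingHom ℬ (.powers (f s)) u ^ k * Away.mk ℬ (f.2 hsd) n b hb =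
        Away.map f s (Away.mk 𝒜 hsd n _ (DirectSum.decompose 𝒜 a (n • d)).2) by
      rw [mul_comm, ← hgu, ← map_pow, ← map_pow] at h
      exact h
    rw [Away.map_mk]
    ext
    rw [val_fromZero_pow_mul, Away.val_mk]
    congr 1
    rw [h', hfu]
  · intro x y hxy
    have key : ∀ a, Away.map f s a = 0 → ∃ n : ℕ, fromZeroRingHom 𝒜 (.powers s) g ^ n * a = 0 := by
      intro a ha
      obtain ⟨n, x, hx, rfl⟩ := Away.mk_surjective 𝒜 hsd a
      rw [Away.map_mk] at ha
      have h1 := congrArg HomogeneousLocalization.val ha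
      rw [Away.val_mk, HomogeneousLocalization.val_zero, Localization.mk_eq_mk',
        IsLocalization.mk'_eq_zero_iff] at h1
      obtain ⟨⟨_, m, rfl⟩, hm⟩ := h1
      obtain ⟨k, hk⟩ := hk (s ^ m * x) (by rw [map_mul, map_pow]; exact hm)
      refine ⟨k, ?_⟩
      ext
      rw [val_fromZero_pow_mul, HomogeneousLocalization.val_zero]
      rw [Localization.mk_eq_mk', IsLocalization.mk'_eq_zero_iff]
      exact ⟨⟨s ^ m, m, rfl⟩, by rw [← hk]; dsimp only; ring⟩
    obtain ⟨n, hn⟩ := key (x - y) (by rw [map_sub]; exact sub_eq_zero.mpr hxy)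
    refine ⟨⟨_, g ^ n, ⟨n, rfl⟩, rfl⟩, ?_⟩
    dsimp only
    rwa [map_pow, ← sub_eq_zero, ← mul_sub]

end GradedLocalization

section SymProj

open HomogeneousLocalization Limits

variable (R M : Type) [CommRing R] [AddCommGroup M] [Module R M]

/-- The ring map from the base ring to the degree zero part of the symmetric algebra. -/
def toSymZero : R →+* symPow R M 0 := algebraMap R (symPow R M 0)

lemma coe_toSymZero (r : R) : (toSymZero R M r : SymmetricAlgebra R M) = algebraMap R _ r := rfl

/-- `Proj (Sym_R M)`: Grothendieck's projectivization of the module `M`. -/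
abbrev symProj : Scheme.{0} := Proj (symPow R M)

/-- The structure morphism of `Proj (Sym_R M)`. -/
def symProjToSpec : symProj R M ⟶ Spec (.of R) :=
  Proj.toSpecZero (symPow R M) ≫ Spec.map (CommRingCat.ofHom (toSymZero R M))

variable {R M} {S N : Type} [CommRing S] [AddCommGroup N] [Module S N] {ρ : R →+* S}

/-- `N` is obtained from `M` by localizing at a power of an element. -/
structure IsAwayMap (φ : M →ₛₗ[ρ] N) (g : R) : Prop where
  isUnit : IsUnit (ρ g)
  surj : ∀ s, ∃ (n : ℕ) (r : R), ρ g ^ n * s = ρ r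
  inj : ∀ r, ρ r = 0 → ∃ n : ℕ, g ^ n * r = 0
  surj' : ∀ s, ∃ (n : ℕ) (r : M), ρ g ^ n • s = φ r
  inj' : ∀ r, φ r = 0 → ∃ n : ℕ, g ^ n • r = 0

lemma IsAwayMap.span {φ : M →ₛₗ[ρ] N} {g : R} (h : IsAwayMap φ g) :
    Submodule.span S (Set.range φ) = ⊤ := by
  rw [eq_top_iff]
  rintro s -
  obtain ⟨n, r, hr⟩ := h.surj' s
  obtain ⟨u, hu⟩ := h.isUnit.pow n
  have : s = (↑u⁻¹ : S) • φ r := by rw [← hr, ← hu, smul_smul, Units.inv_mul, one_smul]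
  rw [this]
  exact Submodule.smul_mem _ _ (Submodule.subset_span ⟨r, rfl⟩)

/-- The morphism on `Proj` induced by a surjective enough semilinear map. -/
abbrev symProjMap (φ : M →ₛₗ[ρ] N) (h : Submodule.span S (Set.range φ) = ⊤) :
    symProj S N ⟶ symProj R M :=
  Proj.map (symMapGraded φ) (irrelevant_le_of_span φ h)

lemma symProj_square (φ : M →ₛₗ[ρ] N) (g : R) (h : IsAwayMap φ g)
    {d : ℕ} (s : SymmetricAlgebra R M) (hs : s ∈ symPow R M d) :
    IsPullback (Spec.map (CommRingCat.ofHom (Away.map (symMapGraded φ) s)))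
      (Spec.map (CommRingCat.ofHom ((fromZeroRingHom (symPow S N) _).comp (toSymZero S N))))
      (Spec.map (CommRingCat.ofHom ((fromZeroRingHom (symPow R M) (.powers s)).comp
        (toSymZero R M))))
      (Spec.map (CommRingCat.ofHom ρ)) := by
  obtain ⟨h1, h2⟩ := symMap_localization φ g h.isUnit h.surj h.inj h.surj' h.inj'
  have hf : ∀ r, (symMapGraded φ) (algebraMap R _ r) = algebraMap S _ (ρ r) :=
    symMap_algebraMap φ
  let _ := (Away.map (symMapGraded φ) s).toAlgebra
  let _ := ρ.toAlgebra
  have hS : IsLocalization (Submonoid.powers g) S :=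
      { map_units := by
          rintro ⟨_, n, rfl⟩
          exact (map_pow ρ g n).symm ▸ h.isUnit.pow n
        surj := fun s => by
          obtain ⟨n, r, h⟩ := h.surj s
          exact ⟨(r, ⟨g ^ n, n, rfl⟩), by
            change s * ρ (g ^ n) = ρ r
            rw [← h, map_pow, mul_comm]⟩
        exists_of_eq := fun {x y} h' => by
          obtain ⟨n, hn⟩ := h.inj (x - y) (by rw [map_sub]; exact sub_eq_zero.mpr h')
          exact ⟨⟨g ^ n, n, rfl⟩, by
            change g ^ n * x = g ^ n * y
            rwa [mul_sub, sub_eq_zero] at hn⟩ }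
  have hL := away_localization (symMapGraded φ) (toSymZero R M g) (toSymZero S N (ρ g))
    (h.isUnit.map _) (hf g) (fun z => by
      obtain ⟨n, a, ha⟩ := h1 z
      exact ⟨n, a, by rw [coe_toSymZero, hf, ha]; rfl⟩) h2 s hs
  have hL' : IsLocalization (Submonoid.map ((fromZeroRingHom (symPow R M)
      (Submonoid.powers s)).comp (toSymZero R M)) (Submonoid.powers g))
      (Away (symPow S N) (symMapGraded φ s)) := by
    convert hL using 1
    rw [← Submonoid.map_powers]
    exact (Submonoid.map_map _ _ _).symm
  refine isPullback_SpecMap_of_isPushout _ _ _ _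
    (CommRingCat.isPushout_of_isLocalization _ _ ?_ (.powers g))
  ext r : 1
  change _ = Away.map (symMapGraded φ) s (HomogeneousLocalization.mk _)
  change HomogeneousLocalization.mk _ = HomogeneousLocalization.map _ _ _
  rw [HomogeneousLocalization.map_mk]
  ext
  simp only [HomogeneousLocalization.val_mk, coe_toSymZero, hf]
  congr 1
  ext
  simp

lemma awayι_symProjToSpec {d : ℕ} (hd : 0 < d) (s : SymmetricAlgebra R M)
    (hs : s ∈ symPow R M d) :
    Proj.awayι (symPow R M) s hs hd ≫ symProjToSpec R M =
      Spec.map (CommRingCat.ofHom ((fromZeroRingHom (symPow R M) _).comp (toSymZero R M))) := by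
  rw [symProjToSpec, Proj.awayι_toSpecZero_assoc, ← Spec.map_comp]
  rfl

lemma isPullback_symProjMap (φ : M →ₛₗ[ρ] N) (g : R) (h : IsAwayMap φ g) :
    IsPullback (symProjMap φ h.span) (symProjToSpec S N) (symProjToSpec R M)
      (Spec.map (CommRingCat.ofHom ρ)) := by
  refine Scheme.isPullback_of_openCover _ _ _ _ (Proj.affineOpenCover (symPow R M)).openCover ?_
  rintro ⟨⟨d, hd⟩, ⟨s, hs⟩⟩
  change s ∈ symPow R M d at hs
  have sq1 : IsPullback (Spec.map (CommRingCat.ofHom (Away.map (symMapGraded φ) s)))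
      (Proj.awayι (symPow S N) (symMapGraded φ s) ((symMapGraded φ).2 hs) hd)
      (Proj.awayι (symPow R M) s hs hd) (symProjMap φ h.span) :=
    IsOpenImmersion.isPullback _ _ _ _ (Proj.awayι_comp_map _ _ hd s hs) (by
      rw [Proj.opensRange_awayι, Proj.opensRange_awayι]
      exact Proj.map_preimage_basicOpen _ _ s)
  have sq2 := symProj_square φ g h s hs
  refine sq2.of_iso (sq1.flip.isoPullback) (Iso.refl _) (Iso.refl _) (Iso.refl _) ?_ ?_ ?_ ?_
  · exact (Category.comp_id _).trans (sq1.flip.isoPullback_hom_snd).symm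
  · refine (Category.comp_id _).trans ?_
    refine ((Category.assoc _ _ _).symm.trans
      ((congrArg (· ≫ _) sq1.flip.isoPullback_hom_fst).trans ?_)).symm
    exact awayι_symProjToSpec hd _ _
  · exact (Category.comp_id _).trans
      ((awayι_symProjToSpec hd s hs).symm.trans (Category.id_comp _).symm)
  · exact (Category.comp_id _).trans (Category.id_comp _).symm

end SymProj

section AffOpen

variable (X : Scheme.{0})

/-- Nonempty affine open subsets. -/
def AffOpen : Type := {U : X.Opens // IsAffineOpen U ∧ (U : Set X).Nonempty}

variable {X}

/-- The underlying open subset. -/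
abbrev AffOpen.toOpens (U : AffOpen X) : X.Opens := U.1

/-- `V ≤ U` means that `V` is a basic open subset `D(f)` of `U`. -/
instance : Preorder (AffOpen X) where
  le U V := ∃ f : Γ(X, V.toOpens), X.basicOpen f = U.toOpens
  le_refl U := ⟨1, Scheme.basicOpen_of_isUnit _ isUnit_one⟩
  le_trans := by
    rintro ⟨U, hU⟩ ⟨V, hV⟩ ⟨W, hW⟩ ⟨f, rfl⟩ ⟨g, rfl⟩
    exact hW.1.basicOpen_basicOpen_is_basicOpen g f

lemma AffOpen.toOpens_mono {V U : AffOpen X} (h : V ≤ U) : V.toOpens ≤ U.toOpens := by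
  obtain ⟨f, hf⟩ := h
  rw [← hf]
  exact X.basicOpen_le _

/-- Restriction of functions. -/
def AffOpen.res {V U : AffOpen X} (h : V ≤ U) : Γ(X, U.toOpens) →+* Γ(X, V.toOpens) :=
  (X.presheaf.map (homOfLE (AffOpen.toOpens_mono h)).op).hom

lemma AffOpen.res_self (U : AffOpen X) (a : Γ(X, U.toOpens)) : AffOpen.res (le_refl U) a = a := by
  change (X.presheaf.map (𝟙 _)).hom a = a
  rw [CategoryTheory.Functor.map_id]; rfl

lemma AffOpen.res_res {W V U : AffOpen X} (h : W ≤ V) (h' : V ≤ U) (a : Γ(X, U.toOpens)) :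
    AffOpen.res h (AffOpen.res h' a) = AffOpen.res (h.trans h') a := by
  change (X.presheaf.map _ ≫ X.presheaf.map _).hom a = _
  rw [← Functor.map_comp]; rfl

variable [IsIntegral X]

/-- Regular functions on an affine open subset, as rational functions. -/
def AffOpen.toRat (U : AffOpen X) : Γ(X, U.toOpens) →+* RatFun X :=
  (X.presheaf.germ U.toOpens (genericPoint X)
    (((genericPoint_spec X).mem_open_set_iff U.toOpens.isOpen).mpr (by simpa using U.2.2))).hom

lemma AffOpen.toRat_injective (U : AffOpen X) : Function.Injective U.toRat :=
  germ_injective_of_isIntegral _ _ _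

lemma AffOpen.toRat_res {V U : AffOpen X} (h : V ≤ U) (a : Γ(X, U.toOpens)) :
    V.toRat (AffOpen.res h a) = U.toRat a := by
  change (X.presheaf.map _ ≫ X.presheaf.germ _ _ _).hom a = _
  rw [TopCat.Presheaf.germ_res]; rfl

lemma AffOpen.stalkToRat_germ (U : AffOpen X) (x : X) (hx : x ∈ U.toOpens)
    (a : Γ(X, U.toOpens)) : stalkToRat X x (X.presheaf.germ _ x hx a) = U.toRat a := by
  change (X.presheaf.germ _ _ _ ≫ X.presheaf.stalkSpecializes _).hom a = _
  rw [X.presheaf.germ_stalkSpecializes]; rfl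

instance (U : AffOpen X) : IsDomain Γ(X, U.toOpens) :=
  U.toRat_injective.isDomain

/-- `Γ(D(f))` is the localization of `Γ(U)` at `f`. -/
lemma AffOpen.res_localization {V U : AffOpen X} (h : V ≤ U) {f : Γ(X, U.toOpens)}
    (hf : X.basicOpen f = V.toOpens) : IsUnit (AffOpen.res h f) ∧
      ∀ s, ∃ (n : ℕ) (r : Γ(X, U.toOpens)), AffOpen.res h f ^ n * s = AffOpen.res h r := by
  obtain ⟨V, hV⟩ := V
  dsimp only [AffOpen.toOpens] at hf
  subst hf
  have hl := U.2.1.isLocalization_basicOpen f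
  refine ⟨IsLocalization.Away.algebraMap_isUnit (S := Γ(X, X.basicOpen f)) f, fun s => ?_⟩
  obtain ⟨n, r, hr⟩ := IsLocalization.Away.surj f s
  exact ⟨n, r, by rw [mul_comm]; exact hr⟩

lemma AffOpen.res_injective {V U : AffOpen X} (h : V ≤ U) :
    Function.Injective (AffOpen.res h) := fun a b hab =>
  U.toRat_injective (by rw [← toRat_res h, hab, toRat_res])

variable (X) in
/-- The cover of an integral scheme by its nonempty affine open subsets. -/
abbrev affCover : X.OpenCover where
  I₀ := AffOpen X
  X U := Spec Γ(X, U.toOpens)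
  f U := U.2.1.fromSpec
  mem₀ := by
    rw [Scheme.presieve₀_mem_precoverage_iff]
    refine ⟨fun x => ?_, inferInstance⟩
    obtain ⟨_, ⟨U, hU, rfl⟩, hxU, -⟩ :=
      X.isBasis_affineOpens.exists_subset_of_mem_open (Set.mem_univ x) isOpen_univ
    rw [← hU.range_fromSpec] at hxU
    exact ⟨⟨U, hU, ⟨x, by rw [← hU.range_fromSpec]; exact hxU⟩⟩, hxU⟩

lemma AffOpen.mem_iff (U : AffOpen X) (x : X) :
    x ∈ U.toOpens ↔ x ∈ Set.range U.2.1.fromSpec := by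
  rw [U.2.1.range_fromSpec]; rfl

/-- The inclusion `V ⟶ U`, in terms of spectra. -/
def AffOpen.specRes {V U : AffOpen X} (h : V ≤ U) : Spec Γ(X, V.toOpens) ⟶ Spec Γ(X, U.toOpens) :=
  Spec.map (CommRingCat.ofHom (AffOpen.res h))

lemma AffOpen.specRes_fromSpec {V U : AffOpen X} (h : V ≤ U) :
    AffOpen.specRes h ≫ U.2.1.fromSpec = V.2.1.fromSpec :=
  U.2.1.map_fromSpec V.2.1 (homOfLE (AffOpen.toOpens_mono h)).op

instance {V U : AffOpen X} (h : V ≤ U) : IsOpenImmersion (AffOpen.specRes h) := by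
  have : IsOpenImmersion (AffOpen.specRes h ≫ U.2.1.fromSpec) := by
    rw [AffOpen.specRes_fromSpec]; infer_instance
  exact IsOpenImmersion.of_comp _ U.2.1.fromSpec

instance : (affCover X).LocallyDirected where
  trans {V U} h := AffOpen.specRes (leOfHom h)
  trans_id U := by
    rw [← cancel_mono U.2.1.fromSpec, AffOpen.specRes_fromSpec, Category.id_comp]
  trans_comp {W V U} h h' := by
    rw [← cancel_mono U.2.1.fromSpec, AffOpen.specRes_fromSpec, Category.assoc,
      AffOpen.specRes_fromSpec, AffOpen.specRes_fromSpec]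
  w h := AffOpen.specRes_fromSpec _
  property_trans h := by
    change IsOpenImmersion (AffOpen.specRes _)
    infer_instance
  directed {U V} x := by
    let q : Limits.pullback U.2.1.fromSpec V.2.1.fromSpec ⟶ X :=
      Limits.pullback.fst _ _ ≫ U.2.1.fromSpec
    have haU : q x ∈ U.toOpens := by
      refine (AffOpen.mem_iff U _).mpr ?_
      rw [Scheme.Hom.comp_apply]
      exact ⟨_, rfl⟩
    have haV : q x ∈ V.toOpens := by
      refine (AffOpen.mem_iff V _).mpr ?_
      dsimp only [q]
      rw [Limits.pullback.condition, Scheme.Hom.comp_apply]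
      exact ⟨_, rfl⟩
    obtain ⟨f, g, e, hxf⟩ := exists_basicOpen_le_affine_inter U.2.1 V.2.1 _ ⟨haU, haV⟩
    let W : AffOpen X := ⟨X.basicOpen f, U.2.1.basicOpen f, ⟨_, hxf⟩⟩
    have hWU : W ≤ U := ⟨f, rfl⟩
    have hWV : W ≤ V := ⟨g, e.symm⟩
    obtain ⟨y, hy⟩ := (AffOpen.mem_iff W (q x)).mp hxf
    refine ⟨W, homOfLE hWU, homOfLE hWV, y, ?_⟩
    have : IsOpenImmersion q := by dsimp only [q]; infer_instance
    apply q.isOpenEmbedding.injective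
    rw [← hy, ← Scheme.Hom.comp_apply]
    congr 2
    dsimp only [q]
    rw [Limits.pullback.lift_fst_assoc, AffOpen.specRes_fromSpec]

end AffOpen

section RatSheaf

/-- A sheaf of modules on an integral scheme (given by its sections over nonempty affine open
sets) that is a subsheaf of the constant sheaf associated to a vector space over the field of
rational functions. -/
structure RatSheaf (X : Scheme.{0}) [IsIntegral X] (W : Type) [AddCommGroup W]
    [Module (RatFun X) W] where
  /-- sections over an affine open set -/
  sec : AffOpen X → AddSubgroup W
  smul_mem : ∀ (U : AffOpen X) (a : Γ(X, U.toOpens)) (w : W), w ∈ sec U → U.toRat a • w ∈ sec U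
  mono : ∀ {V U : AffOpen X}, V ≤ U → sec U ≤ sec V

variable {X : Scheme.{0}} [IsIntegral X] {W : Type} [AddCommGroup W] [Module (RatFun X) W]
  (F : RatSheaf X W)

/-- The module of sections over `U`. -/
abbrev RatSheaf.Sec (U : AffOpen X) : Type := F.sec U

instance (U : AffOpen X) : Module Γ(X, U.toOpens) (F.Sec U) where
  smul a w := ⟨U.toRat a • w.1, F.smul_mem U a w.1 w.2⟩
  one_smul w := Subtype.ext (show U.toRat 1 • w.1 = w.1 by rw [map_one, one_smul])
  mul_smul a b w := Subtype.ext
    (show U.toRat (a * b) • w.1 = U.toRat a • U.toRat b • w.1 by rw [map_mul, mul_smul])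
  smul_zero a := Subtype.ext (smul_zero (U.toRat a))
  smul_add a v w := Subtype.ext (smul_add (U.toRat a) v.1 w.1)
  add_smul a b w := Subtype.ext
    (show U.toRat (a + b) • w.1 = U.toRat a • w.1 + U.toRat b • w.1 by rw [map_add, add_smul])
  zero_smul w := Subtype.ext (show U.toRat 0 • w.1 = 0 by rw [map_zero, zero_smul])

lemma RatSheaf.coe_smul {U : AffOpen X} (a : Γ(X, U.toOpens)) (w : F.Sec U) :
    ((a • w : F.Sec U) : W) = U.toRat a • (w : W) := rfl

/-- Restriction of sections. -/
def RatSheaf.res {V U : AffOpen X} (h : V ≤ U) : F.Sec U →ₛₗ[AffOpen.res h] F.Sec V where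
  toFun w := ⟨w.1, F.mono h w.2⟩
  map_add' _ _ := rfl
  map_smul' a w := Subtype.ext (by
    change U.toRat a • w.1 = V.toRat (AffOpen.res h a) • w.1
    rw [AffOpen.toRat_res])

lemma RatSheaf.coe_res {V U : AffOpen X} (h : V ≤ U) (w : F.Sec U) :
    (F.res h w : W) = (w : W) := rfl

/-- Quasi-coherence: a section over `D(f)` extends to `U` after multiplication by a power
of `f`. -/
class RatSheaf.IsQuasiCoherent : Prop where
  exists_pow : ∀ (V U : AffOpen X) (f : Γ(X, U.toOpens)), X.basicOpen f = V.toOpens →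
    ∀ w ∈ F.sec V, ∃ n : ℕ, U.toRat f ^ n • w ∈ F.sec U

lemma RatSheaf.isAwayMap [F.IsQuasiCoherent] {V U : AffOpen X} (h : V ≤ U) :
    ∃ f, IsAwayMap (F.res h) f := by
  obtain ⟨f, hf⟩ := id h
  obtain ⟨hf1, hf2⟩ := AffOpen.res_localization h hf
  refine ⟨f, hf1, hf2, fun r hr => ⟨0, ?_⟩, fun w => ?_, fun r hr => ⟨0, ?_⟩⟩
  · rw [pow_zero, one_mul]
    exact AffOpen.res_injective h (hr.trans (map_zero _).symm)
  · obtain ⟨n, hn⟩ := IsQuasiCoherent.exists_pow (F := F) V U f hf w.1 w.2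
    refine ⟨n, ⟨_, hn⟩, Subtype.ext ?_⟩
    rw [RatSheaf.coe_smul, map_pow, AffOpen.toRat_res]
    rfl
  · rw [pow_zero, one_smul]
    exact Subtype.ext ((F.coe_res h r).symm.trans (congrArg Subtype.val hr))

end RatSheaf

section Tangent

variable {X : Scheme.{0}} [IsIntegral X] (p : X ⟶ Spec (.of ℂ))

/-- The constant rational functions on a complex variety. -/
def constants : ℂ →+* RatFun X :=
  (stalkToRat X (genericPoint X)).comp ((X.presheaf.germ ⊤ (genericPoint X) (Opens.mem_top _)).hom.comp
    (p.appTop.hom.comp (Scheme.ΓSpecIso (.of ℂ)).inv.hom))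

/-- The tangent sheaf `T_X`: its sections over an affine open set `U` are the `ℂ`-linear
derivations of the coordinate ring of `U` (extended to the fraction field). -/
def tangentSheaf : RatSheaf X (Derivation ℤ (RatFun X) (RatFun X)) where
  sec U :=
    { carrier := {D | (∀ c, D (constants p c) = 0) ∧
        ∀ a : Γ(X, U.toOpens), D (U.toRat a) ∈ U.toRat.range}
      zero_mem' := ⟨fun _ => rfl, fun _ => zero_mem _⟩
      add_mem' := fun {D E} hD hE => ⟨fun c => by
        rw [Derivation.add_apply, hD.1, hE.1, add_zero], fun a => by
        rw [Derivation.add_apply]; exact add_mem (hD.2 a) (hE.2 a)⟩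
      neg_mem' := fun {D} hD => ⟨fun c => by
        rw [Derivation.neg_apply, hD.1, neg_zero], fun a => by
        rw [Derivation.neg_apply]; exact neg_mem (hD.2 a)⟩ }
  smul_mem U a D hD := ⟨fun c => by rw [Derivation.smul_apply, hD.1, smul_zero], fun b => by
    rw [Derivation.smul_apply]; exact mul_mem ⟨a, rfl⟩ (hD.2 b)⟩
  mono {V U} h D hD := ⟨hD.1, fun b => by
    obtain ⟨f, hf⟩ := id h
    obtain ⟨hf1, hf2⟩ := AffOpen.res_localization h hf
    obtain ⟨n, r, hr⟩ := hf2 b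
    obtain ⟨g, hg⟩ := hf1.exists_right_inv
    have hg' : U.toRat f * V.toRat g = 1 := by
      rw [← AffOpen.toRat_res h, ← map_mul, hg, map_one]
    have hr' : U.toRat f ^ n * V.toRat b = U.toRat r := by
      rw [← AffOpen.toRat_res h, ← AffOpen.toRat_res h, ← map_pow, ← map_mul, hr]
    have hle : U.toRat.range ≤ V.toRat.range := by
      rintro _ ⟨a, rfl⟩
      exact ⟨AffOpen.res h a, AffOpen.toRat_res h a⟩
    have hD' : U.toRat f ^ n * D (V.toRat b) =
        D (U.toRat r) - V.toRat b * D (U.toRat (f ^ n)) := by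
      rw [← hr', map_pow, Derivation.leibniz]
      simp only [smul_eq_mul]
      ring
    have : D (V.toRat b) = V.toRat g ^ n * (D (U.toRat r) - V.toRat b * D (U.toRat (f ^ n))) := by
      rw [← hD', ← mul_assoc, ← mul_pow, mul_comm (V.toRat g), hg', one_pow, one_mul]
    rw [this]
    exact mul_mem (pow_mem (RingHom.mem_range_self _ g) n) (sub_mem (hle (hD.2 r)) (mul_mem ⟨b, rfl⟩ (hle (hD.2 _))))⟩

lemma constants_eq (U : AffOpen X) (c : ℂ) : constants p c =
    U.toRat ((p.appLE ⊤ U.toOpens le_top).hom ((Scheme.ΓSpecIso (.of ℂ)).inv.hom c)) := by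
  change stalkToRat X (genericPoint X) ((X.presheaf.germ ⊤ (genericPoint X) (Opens.mem_top _)).hom
    (p.appTop.hom _)) = U.toRat ((X.presheaf.map _).hom (p.appTop.hom _))
  generalize p.appTop.hom ((Scheme.ΓSpecIso (.of ℂ)).inv.hom c) = t
  change (X.presheaf.germ ⊤ (genericPoint X) _ ≫ X.presheaf.stalkSpecializes _).hom t =
    (X.presheaf.map (homOfLE le_top).op ≫ X.presheaf.germ _ _ _).hom t
  rw [X.presheaf.germ_stalkSpecializes, X.presheaf.germ_res (homOfLE le_top)]

instance [LocallyOfFiniteType p] : (tangentSheaf p).IsQuasiCoherent where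
  exists_pow V U f hf D hD := by
    have h : V ≤ U := ⟨f, hf⟩
    obtain ⟨hf1, hf2⟩ := AffOpen.res_localization h hf
    have hft := p.finiteType_appLE (isAffineOpen_top _) U.2.1 le_top
    let _ := (p.appLE ⊤ U.toOpens le_top).hom.toAlgebra
    obtain ⟨S, hS⟩ : Algebra.FiniteType Γ(Spec (.of ℂ), ⊤) Γ(X, U.toOpens) := hft
    have key : ∀ a : Γ(X, U.toOpens), ∃ n : ℕ, U.toRat f ^ n * D (U.toRat a) ∈ U.toRat.range := by
      intro a
      obtain ⟨b, hb⟩ := hD.2 (AffOpen.res h a)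
      obtain ⟨n, r, hr⟩ := hf2 b
      refine ⟨n, r, ?_⟩
      rw [← AffOpen.toRat_res h a, ← hb, ← AffOpen.toRat_res h, ← AffOpen.toRat_res h, ← map_pow,
        ← map_mul, hr]
    choose N hN using key
    let M := ∑ s ∈ S, N s
    have hM : ∀ s ∈ S, U.toRat f ^ M * D (U.toRat s) ∈ U.toRat.range := by
      intro s hs
      have h1 : N s ≤ M := Finset.single_le_sum (fun _ _ => Nat.zero_le _) hs
      obtain ⟨k, hk⟩ := Nat.exists_eq_add_of_le h1
      rw [hk, add_comm, pow_add, mul_assoc]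
      exact mul_mem (pow_mem (RingHom.mem_range_self _ f) k) (hN s)
    refine ⟨M, fun c => ?_, fun a => ?_⟩
    · rw [Derivation.smul_apply, hD.1, smul_zero]
    · rw [Derivation.smul_apply, smul_eq_mul]
      have ha : a ∈ Algebra.adjoin Γ(Spec (.of ℂ), ⊤) (S : Set Γ(X, U.toOpens)) :=
        hS ▸ Algebra.mem_top
      induction ha using Algebra.adjoin_induction with
      | mem s hs => exact hM s hs
      | algebraMap c =>
        have hc := constants_eq p U ((Scheme.ΓSpecIso (.of ℂ)).hom.hom c)
        rw [CategoryTheory.Iso.hom_inv_id_apply (Scheme.ΓSpecIso (.of ℂ)) c] at hc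
        have h0 := hD.1 ((Scheme.ΓSpecIso (.of ℂ)).hom.hom c)
        rw [hc] at h0
        have h1 : D (U.toRat (algebraMap Γ(Spec (.of ℂ), ⊤) _ c)) = 0 := h0
        rw [h1, mul_zero]
        exact zero_mem _
      | add x y _ _ hx hy =>
        rw [map_add, map_add, mul_add]; exact add_mem hx hy
      | mul x y _ _ hx hy =>
        rw [map_mul, Derivation.leibniz, mul_add, smul_eq_mul, smul_eq_mul, mul_left_comm,
          mul_left_comm _ (U.toRat y)]
        exact add_mem (mul_mem ⟨x, rfl⟩ hy) (mul_mem ⟨y, rfl⟩ hx)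

end Tangent

section Projectivization

variable {X : Scheme.{0}} [IsIntegral X] {W : Type} [AddCommGroup W] [Module (RatFun X) W]
  (F : RatSheaf X W) [F.IsQuasiCoherent]

lemma RatSheaf.span_res {V U : AffOpen X} (h : V ≤ U) :
    Submodule.span Γ(X, V.toOpens) (Set.range (F.res h)) = ⊤ := by
  obtain ⟨f, hf⟩ := F.isAwayMap h
  exact hf.span

lemma projMap_congr {A B : Type} [CommRing A] [CommRing B] {σ τ : Type} [SetLike σ A]
    [SetLike τ B] [AddSubgroupClass σ A] [AddSubgroupClass τ B] {𝒜 : ℕ → σ} {ℬ : ℕ → τ}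
    [GradedRing 𝒜] [GradedRing ℬ] {f g : 𝒜 →+*ᵍ ℬ} (h : f = g)
    (hf : HomogeneousIdeal.irrelevant ℬ ≤ (HomogeneousIdeal.irrelevant 𝒜).map f)
    (hg : HomogeneousIdeal.irrelevant ℬ ≤ (HomogeneousIdeal.irrelevant 𝒜).map g) :
    Proj.map f hf = Proj.map g hg := by
  subst h; rfl

/-- The schemes `Proj (Sym F(U))` for affine open sets `U`. -/
def projFunctor : AffOpen X ⥤ Scheme.{0} where
  obj U := symProj Γ(X, U.toOpens) (F.Sec U)
  map h := symProjMap (F.res (leOfHom h)) (F.span_res _)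
  map_id U := by
    refine Eq.trans (projMap_congr (DFunLike.ext _ _ fun x => ?_) _ (by simp)) Proj.map_id
    refine DFunLike.congr_fun (ringHom_symAlg_ext (f := symMap (F.res (le_refl U)))
      (g := RingHom.id _) (fun r => ?_) (fun m => ?_)) x
    · rw [symMap_algebraMap, AffOpen.res_self]; rfl
    · rw [symMap_ι]; rfl
  map_comp {W V U} h h' := by
    refine Eq.trans (projMap_congr (DFunLike.ext _ _ fun x => ?_) _ _)
      (Proj.map_comp (symMapGraded (F.res (leOfHom h')))
        (symMapGraded (F.res (leOfHom h))) (irrelevant_le_of_span _ (F.span_res _))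
        (irrelevant_le_of_span _ (F.span_res _)))
    refine DFunLike.congr_fun (ringHom_symAlg_ext (f := symMap (F.res (leOfHom (h ≫ h'))))
      (g := (symMap (F.res (leOfHom h))).comp (symMap (F.res (leOfHom h'))))
      (fun r => ?_) (fun m => ?_)) x
    · rw [RingHom.comp_apply]
      iterate 3 rw [symMap_algebraMap]
      rw [AffOpen.res_res]
    · rw [RingHom.comp_apply]
      iterate 3 rw [symMap_ι]
      rfl

/-- The data for gluing the schemes `Proj (Sym F(U))` over `X`. -/
def projGluing : (affCover X).RelativeGluingData where
  functor := projFunctor F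
  natTrans :=
    { app := fun U => symProjToSpec Γ(X, U.toOpens) (F.Sec U)
      naturality := fun {V U} h => by
        obtain ⟨f, hf⟩ := F.isAwayMap (leOfHom h)
        exact (isPullback_symProjMap _ f hf).w }
  equifibered := fun {V U} h => by
    obtain ⟨f, hf⟩ := F.isAwayMap (leOfHom h)
    exact isPullback_symProjMap _ f hf

instance : Small.{0} (affCover X).I₀ := inferInstanceAs (Small.{0} (AffOpen X))

instance : Quiver.IsThin (affCover X).I₀ := inferInstanceAs (Quiver.IsThin (AffOpen X))

/-- The projectivization `P(F) = Proj (Sym F)` in the sense of Grothendieck. -/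
def projectivization : Scheme.{0} := (projGluing F).glued

/-- The projection `P(F) ⟶ X`. -/
def projectivizationMap : projectivization F ⟶ X := (projGluing F).toBase

/-- The open immersion `Proj (Sym F(U)) ⟶ P(F)`. -/
def projectivizationChart (U : AffOpen X) :
    symProj Γ(X, U.toOpens) (F.Sec U) ⟶ projectivization F :=
  (projGluing F).cover.f U

/-- The fraction `m' / m` as a function on the open subset `m ≠ 0` of `Proj (Sym_R M)`. -/
def symFraction {R M : Type} [CommRing R] [AddCommGroup M] [Module R M] (m' m : M) :
    Γ(symProj R M, Proj.basicOpen (symPow R M) (SymmetricAlgebra.ι R M m)) :=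
  (Proj.awayToSection (symPow R M) (SymmetricAlgebra.ι R M m)).hom
    (HomogeneousLocalization.Away.mk (symPow R M) (ι_mem_symPow R m) 1
      (SymmetricAlgebra.ι R M m') (by simpa using ι_mem_symPow R m'))

variable {F} in
/-- `ξ` is a divisor of the tautological quotient line bundle `O(1)` on `P(F)`: there is an
embedding `τ` of `O(1)` into the constant sheaf of rational functions on `P(F)` with image
`O(ξ)`. On the open subset `m ≠ 0` of `Proj (Sym F(U))`, the line bundle `O(1)` is freely generated
by `m`, and `m' = (m' / m) • m`. Hence `τ` has to respect the relation `m' = (m' / m) • m`, and the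
inverse of `τ m` has to be a local equation of `ξ`. -/
def IsTautological [IsIntegral (projectivization F)]
    (ξ : CartierDivisor (projectivization F)) : Prop :=
  ∃ τ : W → RatFun (projectivization F), ∀ (U : AffOpen X) (m : F.Sec U)
    (y : symProj Γ(X, U.toOpens) (F.Sec U))
    (hy : y ∈ Proj.basicOpen (symPow Γ(X, U.toOpens) (F.Sec U)) (SymmetricAlgebra.ι _ _ m)),
    (∃ f : (RatFun (projectivization F))ˣ, f * τ m = 1 ∧
      ξ.IsEquationAt (projectivizationChart F U y) f) ∧
    ∀ m' : F.Sec U, ∃ t : (projectivization F).presheaf.stalk (projectivizationChart F U y),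
      (projectivizationChart F U).stalkMap y t =
        (symProj Γ(X, U.toOpens) (F.Sec U)).presheaf.germ _ y hy (symFraction m' m) ∧
      τ m' = stalkToRat _ _ t * τ m

end Projectivization

section SymSections

open scoped TensorProduct

variable {X : Scheme.{0}} [IsIntegral X]

/-- The invertible sheaf `O_X(D)` of a Cartier divisor. -/
def CartierDivisor.sheaf (D : CartierDivisor X) : RatSheaf X (RatFun X) where
  sec U :=
    { carrier := {s | ∀ x ∈ U.toOpens, ∀ f : (RatFun X)ˣ, D.IsEquationAt x f →
        s * f ∈ (stalkToRat X x).range}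
      zero_mem' := fun x _ f _ => by rw [zero_mul]; exact zero_mem _
      add_mem' := fun {s t} hs ht x hx f hf => by
        rw [add_mul]; exact add_mem (hs x hx f hf) (ht x hx f hf)
      neg_mem' := fun {s} hs x hx f hf => by
        rw [neg_mul]; exact neg_mem (hs x hx f hf) }
  smul_mem U a s hs x hx f hf := by
    rw [smul_eq_mul, mul_assoc, ← U.stalkToRat_germ x hx a]
    exact mul_mem ⟨_, rfl⟩ (hs x hx f hf)
  mono h s hs x hx := hs x (AffOpen.toOpens_mono h hx)

variable {W : Type} [AddCommGroup W] [Module (RatFun X) W] (F : RatSheaf X W)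

/-- Restriction of sections of the symmetric power `Sym^r F`. -/
def symPowRes (r : ℕ) {V U : AffOpen X} (h : V ≤ U) :
    symPow Γ(X, U.toOpens) (F.Sec U) r →ₛₗ[AffOpen.res h] symPow Γ(X, V.toOpens) (F.Sec V) r where
  toFun x := ⟨symMap (F.res h) x.1, symMap_mem _ x.2⟩
  map_add' _ _ := Subtype.ext (map_add _ _ _)
  map_smul' _ _ := Subtype.ext (symMap_smul _ _ _)

/-- The sections of `Sym^r F ⊗ O_X(D)` over an affine open set. -/
abbrev SymTwist (r : ℕ) (D : CartierDivisor X) (U : AffOpen X) : Type :=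
  symPow Γ(X, U.toOpens) (F.Sec U) r ⊗[Γ(X, U.toOpens)] D.sheaf.Sec U

/-- The group `H⁰(X, Sym^r F ⊗ O_X(D))` of global sections: compatible families of sections over
the nonempty affine open sets. -/
def globalSymTwist (r : ℕ) (D : CartierDivisor X) : AddSubgroup (∀ U, SymTwist F r D U) where
  carrier := {s | ∀ (V U : AffOpen X) (h : V ≤ U),
    TensorProduct.map (symPowRes F r h) (D.sheaf.res h) (s U) = s V}
  zero_mem' := fun V U h => map_zero _
  add_mem' := fun {s t} hs ht V U h => by
    rw [Pi.add_apply, map_add, hs V U h, ht V U h]; rfl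
  neg_mem' := fun {s} hs V U h => by
    rw [Pi.neg_apply, map_neg, hs V U h]; rfl

end SymSections

section Main

/-- A complex scheme is projective if it is isomorphic to a closed subscheme of a projective
space. -/
def IsProjective {X : Scheme.{0}} (p : X ⟶ Spec (.of ℂ)) : Prop :=
  ∃ (N : ℕ) (i : X ⟶ symProj ℂ (Fin (N + 1) → ℂ)),
    IsClosedImmersion i ∧ i ≫ symProjToSpec ℂ (Fin (N + 1) → ℂ) = p

/-- A Cartier divisor `D` on a complex variety is big if for some `m > 0` one has
`H⁰(O(mD)) ≠ 0` and the rational map given by `H⁰(O(mD))` is birational onto its image, i.e. the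
quotients of sections of `O(mD)` generate the whole field of rational functions over `ℂ`. -/
def CartierDivisor.IsBig {Y : Scheme.{0}} [IsIntegral Y] (q : Y ⟶ Spec (.of ℂ))
    (D : CartierDivisor Y) : Prop :=
  ∃ m : ℕ, 0 < m ∧ (∃ s, s ≠ 0 ∧ (m • D).IsSection s) ∧
    Subfield.closure (Set.range (constants q) ∪
      {t | ∃ a b, (m • D).IsSection a ∧ (m • D).IsSection b ∧ b ≠ 0 ∧ t = a / b}) = ⊤

variable {X : Scheme.{0}} [IsIntegral X] (p : X ⟶ Spec (.of ℂ)) [LocallyOfFiniteType p]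

/-- The projectivized tangent bundle `P(T_X) = Proj (Sym T_X)`. -/
abbrev projTangent : Scheme.{0} := projectivization (tangentSheaf p)

/-- The projection `P(T_X) ⟶ X`. -/
abbrev projTangentMap : projTangent p ⟶ X := projectivizationMap (tangentSheaf p)

variable [IsIntegral (projTangent p)]

/-- The tangent bundle is big if the line bundle `O(1)` on `P(T_X)` is big. -/
def TangentIsBig : Prop :=
  ∃ ξ : CartierDivisor (projTangent p), IsTautological ξ ∧ ξ.IsBig (projTangentMap p ≫ p)

variable [IsDominant (projTangentMap p)] (A : CartierDivisor X)

/-- The set of real numbers `ε` such that the class `ξ - ε π^* A` is effective, where `ξ` is the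
first Chern class of `O(1)` on `P(T_X)`. -/
def effectiveThresholds : Set ℝ :=
  {ε | ∃ ξ : CartierDivisor (projTangent p), IsTautological ξ ∧
    ξ.cls - ε • (A.pullback (projTangentMap p)).cls ∈ effectiveCone (projTangent p)}

/-- The invariant `Δ(X, A)`. -/
def tangentThreshold : ℝ := sSup (effectiveThresholds p A)

end Main

end TangentBig

end

open TangentBig

/-! Everything takes place inside function fields. Let K = K(X), let π : P = P(T_X) → X be the
projection, and let τ be an embedding of O(1) into the constant sheaf K(P) with image O(ξ). A
section of a line bundle is a rational function that becomes regular after multiplication by local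
equations, and a symmetric tensor is read through its value under the map Sym(T_X) → K(P) induced by
τ. The bridge is `IsTautologicalFor.exists_globalSymTwist_iff`: Sym^r T_X ⊗ O(D) has a nonzero
global section exactly when O(rξ + π^*D) has one. It needs only a quasi-coherent, locally free sheaf
of positive rank: over a free affine chart a section of O(r) is a compatible family of fractions P_i
/ x_i^N, hence a form of degree r, because the coordinates x_i are primes of a polynomial ring
(`exists_eq_ι_pow_mul`).

Equality of the suprema. A section of Sym^r T_X(-dA) makes rξ - dπ^*A effective, so d/r is an
effective threshold. Conversely, let ξ - επ^*A be a nonnegative real combination of effective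
classes. A ℚ-linear map ℝ → ℚ that fixes 1 and is close to the identity on the finitely many
coefficients turns this into a rational relation; clearing denominators and torsion gives an
integral one with d/N > ε - δ (`exists_integral_decomposition`), and the bridge converts it into a
symmetric tensor.

Boundedness (`CartierDivisor.IsAmple.exists_bound`). For a rational function t, the rule D ↦ D t
extends to symmetric tensors. Choose m and sections s_j, s_0 of mA such that the quotients s_j / s_0
generate K over ℂ. Some constant combination t of these quotients gives a prescribed nonzero tensor
a nonzero value ψ, and the quotient rule bounds its poles by s_0^(2r); so s_0^(2r) ψ is a nonzero
section of (2rm - d)A, which forces d ≤ 2rm. Indeed a negative multiple of A has no nonzero section: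
if v is one of -lA, the functions s_j^l v^m are regular everywhere, hence constant, so each s_j /
s_0 has a constant l-th power and every ℂ-derivation of K vanishes, contrary to the positive rank of
T_X. The set is nonempty because a local vector field extends after multiplication by a power of
s_0.

Bigness. If O(1) is big, finitely many elements of K(P) have a common denominator Q among the
sections of some multiple kξ. Taking the fractions u_i / u_0 of sections generating aA, the function
Q / π^*u_0 is a section of kξ - aπ^*A, so Δ ≥ a/k > 0. Conversely, if rξ - dπ^*A has a section φ ≠ 0
with d > 0, a power of φ absorbs the twists that make local vector fields w_i global and leaves room
for every b in H⁰(mA): the functions ψ τ(w_i) π^*b are all sections of one multiple Mξ. Their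
quotients generate K, and then the τ(w_i) / τ(w_0), hence K(P).

Being an `IsLUB` in ℝ includes that the set is nonempty and bounded above. -/

noncomputable section

namespace TangentBig

/-! ### Regular functions and local rings inside the function field. -/

section RationalFunctions

variable {X : Scheme.{0}} [IsIntegral X]

lemma genericPoint_mem {O : X.Opens} {x : X} (hx : x ∈ O) : genericPoint X ∈ O :=
  ((genericPoint_spec X).mem_open_set_iff O.isOpen).mpr (by simpa using ⟨x, hx⟩)

/-- Regular functions on a nonempty open set, as rational functions. -/
def germRat (O : X.Opens) (h : genericPoint X ∈ O) : Γ(X, O) →+* RatFun X :=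
  (X.presheaf.germ O (genericPoint X) h).hom

lemma AffOpen.genericPoint_mem (U : AffOpen X) : genericPoint X ∈ U.toOpens :=
  TangentBig.genericPoint_mem U.2.2.choose_spec

lemma AffOpen.toRat_eq (U : AffOpen X) : U.toRat = germRat U.toOpens U.genericPoint_mem := rfl

lemma germRat_injective (O : X.Opens) (h : genericPoint X ∈ O) :
    Function.Injective (germRat O h) :=
  germ_injective_of_isIntegral _ _ _

lemma germRat_res {O O' : X.Opens} (i : O' ⟶ O) (h : genericPoint X ∈ O') (a : Γ(X, O)) :
    germRat O' h ((X.presheaf.map i.op).hom a) = germRat O (i.le h) a := by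
  change (X.presheaf.map _ ≫ X.presheaf.germ _ _ _).hom a = _
  rw [TopCat.Presheaf.germ_res]; rfl

lemma stalkToRat_germ (O : X.Opens) (x : X) (hx : x ∈ O) (a : Γ(X, O)) :
    stalkToRat X x (X.presheaf.germ O x hx a) = germRat O (genericPoint_mem hx) a := by
  change (X.presheaf.germ _ _ _ ≫ X.presheaf.stalkSpecializes _).hom a = _
  rw [X.presheaf.germ_stalkSpecializes]; rfl

variable (X) in
/-- The local ring at `x` as a subring of the field of rational functions. -/
def localRing (x : X) : Subring (RatFun X) := (stalkToRat X x).range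

lemma mem_localRing_iff {x : X} {φ : RatFun X} : φ ∈ localRing X x ↔
    ∃ (O : X.Opens) (hx : x ∈ O) (a : Γ(X, O)), germRat O (genericPoint_mem hx) a = φ := by
  constructor
  · rintro ⟨t, rfl⟩
    obtain ⟨O, hx, a, rfl⟩ := X.presheaf.exists_germ_eq t
    exact ⟨O, hx, a, (stalkToRat_germ O x hx a).symm⟩
  · rintro ⟨O, hx, a, rfl⟩
    exact ⟨_, stalkToRat_germ O x hx a⟩

lemma germRat_mem_localRing (O : X.Opens) (h : genericPoint X ∈ O) (a : Γ(X, O)) {x : X}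
    (hx : x ∈ O) : germRat O h a ∈ localRing X x :=
  mem_localRing_iff.mpr ⟨O, hx, a, rfl⟩

lemma AffOpen.toRat_mem_localRing (U : AffOpen X) (a : Γ(X, U.toOpens)) {x : X}
    (hx : x ∈ U.toOpens) : U.toRat a ∈ localRing X x :=
  germRat_mem_localRing _ _ a hx

/-- A rational function that is regular at every point of an open set `O` comes from a function
on `O`. -/
lemma mem_range_germRat (O : X.Opens) (h : genericPoint X ∈ O) {φ : RatFun X}
    (hφ : ∀ x ∈ O, φ ∈ localRing X x) : φ ∈ (germRat O h).range := by
  have key : ∀ x : O, ∃ (V : X.Opens) (_ : x.1 ∈ V) (hV : V ≤ O) (h' : genericPoint X ∈ V)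
      (a : Γ(X, V)), germRat V h' a = φ := by
    rintro ⟨x, hx⟩
    obtain ⟨V, hxV, a, rfl⟩ := mem_localRing_iff.mp (hφ x hx)
    have hxW : x ∈ V ⊓ O := ⟨hxV, hx⟩
    exact ⟨V ⊓ O, hxW, inf_le_right, genericPoint_mem hxW,
      (X.presheaf.map (homOfLE inf_le_left).op).hom a, germRat_res _ _ _⟩
  choose V hxV hVO hgen a ha using key
  -- The local representatives agree on overlaps because passing to the germ at the generic point is
  -- injective.
  obtain ⟨s, hs, -⟩ := X.sheaf.existsUnique_gluing' V O (fun x => homOfLE (hVO x))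
    (fun x hx => by
      simp only [TopologicalSpace.Opens.mem_iSup]
      exact ⟨⟨x, hx⟩, hxV _⟩) a
    (fun x y => by
      apply germRat_injective (V x ⊓ V y) ⟨hgen x, hgen y⟩
      erw [germRat_res, germRat_res]
      rw [ha, ha])
  obtain ⟨x, hx⟩ : ∃ x, x ∈ O := ⟨_, h⟩
  refine ⟨s, ?_⟩
  rw [← ha ⟨x, hx⟩, ← hs ⟨x, hx⟩]
  exact (germRat_res _ _ _).symm

lemma AffOpen.mem_range_toRat (U : AffOpen X) {φ : RatFun X}
    (hφ : ∀ x ∈ U.toOpens, φ ∈ localRing X x) : φ ∈ U.toRat.range :=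
  mem_range_germRat _ _ hφ

/-- A function that is regular at `x` is regular in a neighbourhood. -/
lemma exists_opens_localRing {x : X} {φ : RatFun X} (h : φ ∈ localRing X x) :
    ∃ O : X.Opens, x ∈ O ∧ ∀ y ∈ O, φ ∈ localRing X y := by
  obtain ⟨O, hx, a, rfl⟩ := mem_localRing_iff.mp h
  exact ⟨O, hx, fun y hy => germRat_mem_localRing _ _ _ hy⟩

lemma exists_affOpen_le (U : AffOpen X) (O : X.Opens) (x : X) (hx : x ∈ U.toOpens) (hO : x ∈ O) :
    ∃ V : AffOpen X, V ≤ U ∧ x ∈ V.toOpens ∧ V.toOpens ≤ O := by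
  obtain ⟨f, hf, hxf⟩ := U.2.1.exists_basicOpen_le ⟨x, hO⟩ hx
  exact ⟨⟨X.basicOpen f, U.2.1.basicOpen f, ⟨x, hxf⟩⟩, ⟨f, rfl⟩, hxf, hf⟩

lemma exists_affOpen_le_le (U V : AffOpen X) (x : X) (hx : x ∈ U.toOpens) (hx' : x ∈ V.toOpens) :
    ∃ W : AffOpen X, W ≤ U ∧ W ≤ V ∧ x ∈ W.toOpens := by
  obtain ⟨f, g, e, hxf⟩ := exists_basicOpen_le_affine_inter U.2.1 V.2.1 x ⟨hx, hx'⟩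
  exact ⟨⟨X.basicOpen f, U.2.1.basicOpen f, ⟨_, hxf⟩⟩, ⟨f, rfl⟩, ⟨g, e.symm⟩, hxf⟩

lemma exists_affOpen_mem (O : X.Opens) (x : X) (hx : x ∈ O) :
    ∃ U : AffOpen X, x ∈ U.toOpens ∧ U.toOpens ≤ O := by
  obtain ⟨_, ⟨U, hU, rfl⟩, hxU, h⟩ :=
      X.isBasis_affineOpens.exists_subset_of_mem_open hx O.isOpen
  exact ⟨⟨U, hU, ⟨x, hxU⟩⟩, hxU, h⟩

/-- An ideal of functions on an affine open set without common zeros contains `1`. -/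
lemma AffOpen.one_mem_of_forall_exists (U : AffOpen X) (I : Ideal Γ(X, U.toOpens))
    (h : ∀ x ∈ U.toOpens, ∃ f ∈ I, x ∈ X.basicOpen f) : (1 : Γ(X, U.toOpens)) ∈ I := by
  rw [← Ideal.eq_top_iff_one]
  have h2 := (U.2.1.self_le_iSup_basicOpen_iff (s := (I : Set Γ(X, U.toOpens)))).mp (by
    intro x hx
    obtain ⟨f, hf, hxf⟩ := h x hx
    simp only [TopologicalSpace.Opens.mem_iSup]
    exact ⟨⟨f, hf⟩, hxf⟩)
  rwa [Ideal.span_eq] at h2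

end RationalFunctions

/-! ### Calculus of local equations and of sections of O(D). -/

section Divisors

variable {X : Scheme.{0}} [IsIntegral X]

lemma mem_stalkUnits_iff {x : X} {f : (RatFun X)ˣ} :
    f ∈ stalkUnits X x ↔ (f : RatFun X) ∈ localRing X x ∧ ((f⁻¹ : (RatFun X)ˣ) : RatFun X) ∈ localRing X x := by
  constructor
  · rintro ⟨u, rfl⟩
    exact ⟨⟨u, rfl⟩, ⟨(u⁻¹ : _ˣ), by rw [← map_inv]; rfl⟩⟩
  · rintro ⟨⟨a, ha⟩, ⟨b, hb⟩⟩
    have hinj : Function.Injective (stalkToRat X x) := IsFractionRing.injective _ X.functionField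
    refine ⟨⟨a, b, hinj ?_, hinj ?_⟩, Units.ext ha⟩
    · rw [map_mul, ha, hb, map_one, Units.mul_inv]
    · rw [map_mul, ha, hb, map_one, Units.inv_mul]

lemma divisorGerm_eq_zero_iff {x : X} {f : (RatFun X)ˣ} :
    divisorGerm X x (Additive.ofMul f) = 0 ↔ f ∈ stalkUnits X x :=
  QuotientGroup.eq_one_iff f

namespace CartierDivisor

variable {D E : CartierDivisor X} {x : X} {f g : (RatFun X)ˣ}

variable (D x) in
lemma exists_isEquationAt : ∃ f, D.IsEquationAt x f := by
  obtain ⟨U, hU, f, hf⟩ := D.2 x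
  exact ⟨f.toMul, hf x hU⟩

/-- Near x the divisor has a single equation g; f / g is a unit at x, and f / g and g / f both
remain regular in a neighbourhood. -/
lemma IsEquationAt.exists_opens (h : D.IsEquationAt x f) :
    ∃ O : X.Opens, x ∈ O ∧ ∀ y ∈ O, D.IsEquationAt y f := by
  obtain ⟨U, hU, g, hg⟩ := D.2 x
  have h0 : divisorGerm X x (Additive.ofMul (f / g.toMul)) = 0 := by
    change divisorGerm X x (Additive.ofMul f - g) = 0
    rw [map_sub, ← hg x hU, ← h, sub_self]
  rw [divisorGerm_eq_zero_iff, mem_stalkUnits_iff] at h0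
  obtain ⟨O₁, h₁, h₁'⟩ := exists_opens_localRing h0.1
  obtain ⟨O₂, h₂, h₂'⟩ := exists_opens_localRing h0.2
  refine ⟨U ⊓ (O₁ ⊓ O₂), ⟨hU, h₁, h₂⟩, fun y hy => ?_⟩
  have h3 : divisorGerm X y (Additive.ofMul (f / g.toMul)) = 0 := by
    rw [divisorGerm_eq_zero_iff, mem_stalkUnits_iff]
    exact ⟨h₁' y hy.2.1, h₂' y hy.2.2⟩
  change divisorGerm X y (Additive.ofMul f - g) = 0 at h3
  rw [map_sub, sub_eq_zero] at h3
  exact (hg y hy.1).trans h3.symm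

variable (D x) in
lemma exists_opens_isEquationAt :
    ∃ (f : (RatFun X)ˣ) (O : X.Opens), x ∈ O ∧ ∀ y ∈ O, D.IsEquationAt y f := by
  obtain ⟨f, hf⟩ := D.exists_isEquationAt x
  exact ⟨f, hf.exists_opens⟩

lemma IsEquationAt.div_mem (h : D.IsEquationAt x f) (h' : D.IsEquationAt x g) :
    (f / g : RatFun X) ∈ localRing X x := by
  have h0 : divisorGerm X x (Additive.ofMul (f / g)) = 0 := by
    change divisorGerm X x (Additive.ofMul f - Additive.ofMul g) = 0
    rw [map_sub, sub_eq_zero]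
    exact h.symm.trans h'
  rw [divisorGerm_eq_zero_iff, mem_stalkUnits_iff] at h0
  simpa using h0.1

lemma IsEquationAt.of_div_mem (h : D.IsEquationAt x f) (h₁ : (f / g : RatFun X) ∈ localRing X x)
    (h₂ : (g / f : RatFun X) ∈ localRing X x) : D.IsEquationAt x g := by
  have h0 : divisorGerm X x (Additive.ofMul (f / g)) = 0 := by
    rw [divisorGerm_eq_zero_iff, mem_stalkUnits_iff]
    exact ⟨by simpa using h₁, by simpa using h₂⟩
  change divisorGerm X x (Additive.ofMul f - Additive.ofMul g) = 0 at h0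
  rw [map_sub, sub_eq_zero] at h0
  exact Eq.trans h h0

lemma IsEquationAt.add (h : D.IsEquationAt x f) (h' : E.IsEquationAt x g) :
    (D + E).IsEquationAt x (f * g) :=
  (congrArg₂ (· + ·) h h').trans (map_add (divisorGerm X x) (Additive.ofMul f) (Additive.ofMul g)).symm

lemma IsEquationAt.neg (h : D.IsEquationAt x f) : (-D).IsEquationAt x f⁻¹ :=
  (congrArg Neg.neg h).trans (map_neg (divisorGerm X x) (Additive.ofMul f)).symm

lemma IsEquationAt.nsmul (h : D.IsEquationAt x f) (n : ℕ) : (n • D).IsEquationAt x (f ^ n) :=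
  (congrArg (n • ·) h).trans (map_nsmul (divisorGerm X x) n (Additive.ofMul f)).symm

lemma IsEquationAt.zsmul (h : D.IsEquationAt x f) (n : ℤ) : (n • D).IsEquationAt x (f ^ n) :=
  (congrArg (n • ·) h).trans (map_zsmul (divisorGerm X x) n (Additive.ofMul f)).symm

lemma isEquationAt_zero (x : X) : (0 : CartierDivisor X).IsEquationAt x 1 :=
  (map_zero (divisorGerm X x)).symm

lemma isEquationAt_principalDivisor (x : X) (f : (RatFun X)ˣ) :
    (principalDivisor X (Additive.ofMul f)).IsEquationAt x f := rfl

lemma ext_of_isEquationAt (h : ∀ x, ∃ f, D.IsEquationAt x f ∧ E.IsEquationAt x f) : D = E :=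
  Subtype.ext (funext fun x => by
    obtain ⟨f, h₁, h₂⟩ := h x
    exact Eq.trans h₁ (Eq.symm h₂))

/-- Two equations at x differ by a unit of the local ring, so being a section needs to be tested on
one equation per point only. -/
lemma IsEquationAt.mul_mem (h : D.IsEquationAt x f) (h' : D.IsEquationAt x g) {s : RatFun X}
    (hs : s * f ∈ localRing X x) : s * g ∈ localRing X x := by
  have := Subring.mul_mem _ hs (h'.div_mem h)
  convert this using 1
  field_simp

lemma IsSection.mem {s : RatFun X} (hs : D.IsSection s) (h : D.IsEquationAt x f) :
    s * f ∈ localRing X x := hs x f h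

lemma isSection_of_exists {s : RatFun X}
    (h : ∀ x, ∃ f, D.IsEquationAt x f ∧ s * f ∈ localRing X x) : D.IsSection s := by
  intro x g hg
  obtain ⟨f, hf, hs⟩ := h x
  exact hf.mul_mem hg hs

lemma isSection_zero : D.IsSection 0 := fun x f _ => by
  rw [zero_mul]; exact zero_mem (localRing X x)

lemma IsSection.add {s t : RatFun X} (hs : D.IsSection s) (ht : D.IsSection t) :
    D.IsSection (s + t) := fun x f hf => by
  rw [add_mul]; exact add_mem (hs.mem hf) (ht.mem hf)

lemma IsSection.neg {s : RatFun X} (hs : D.IsSection s) :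
    D.IsSection (-s) := fun x f hf => by
  rw [neg_mul]; exact neg_mem (hs.mem hf)

lemma IsSection.mul {s t : RatFun X} (hs : D.IsSection s) (ht : E.IsSection t) :
    (D + E).IsSection (s * t) := isSection_of_exists fun x => by
  obtain ⟨f, hf⟩ := D.exists_isEquationAt x
  obtain ⟨g, hg⟩ := E.exists_isEquationAt x
  refine ⟨_, hf.add hg, ?_⟩
  have := Subring.mul_mem _ (hs.mem hf) (ht.mem hg)
  convert this using 1
  push_cast; ring

lemma IsSection.one : (0 : CartierDivisor X).IsSection 1 := isSection_of_exists fun x =>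
  ⟨1, isEquationAt_zero x, by rw [one_mul]; exact one_mem _⟩

lemma isSection_zero_iff {s : RatFun X} :
    (0 : CartierDivisor X).IsSection s ↔ ∀ x, s ∈ localRing X x := by
  constructor
  · intro h x
    simpa using h.mem (isEquationAt_zero x)
  · intro h
    exact isSection_of_exists fun x => ⟨1, isEquationAt_zero x, by simpa using h x⟩

lemma IsSection.pow {s : RatFun X} (hs : D.IsSection s) (n : ℕ) : (n • D).IsSection (s ^ n) := by
  induction n with
  | zero => rw [zero_smul, pow_zero]; exact IsSection.one
  | succ n ih => rw [succ_nsmul, pow_succ]; exact ih.mul hs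

/-- If `s` is a nonzero section of `O(D)`, then `D + div(s)` is effective. -/
lemma IsSection.isEffective (s : (RatFun X)ˣ) (hs : D.IsSection s) :
    (D + principalDivisor X (Additive.ofMul s)).IsEffective := by
  intro x g hg
  obtain ⟨f, hf⟩ := D.exists_isEquationAt x
  have h := (hf.add (isEquationAt_principalDivisor x s)).mul_mem hg (s := 1) (by
    have := hs.mem hf
    rw [one_mul, Units.val_mul, mul_comm]
    exact this)
  rw [one_mul] at h
  exact h

lemma IsEffective.isSection (h : D.IsEffective) : D.IsSection 1 := fun x f hf => by
  rw [one_mul]; exact h x f hf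

lemma IsEffective.add (hD : D.IsEffective) (hE : E.IsEffective) : (D + E).IsEffective := by
  intro x f hf
  have := (hD.isSection.mul hE.isSection).mem hf
  rwa [one_mul, one_mul] at this

lemma isEffective_zero : (0 : CartierDivisor X).IsEffective := by
  intro x f hf
  have := (IsSection.one (X := X)).mem hf
  rwa [one_mul] at this

end CartierDivisor

end Divisors

/-! ### Functoriality of rational functions, divisors and sections under dominant maps. -/

section Pullback

variable {X Y Z : Scheme.{0}} [IsIntegral X] [IsIntegral Y] [IsIntegral Z]

lemma pullbackFunction_germRat (g : Y ⟶ X) [IsDominant g] (O : X.Opens) (h : genericPoint X ∈ O)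
    (h' : genericPoint Y ∈ g ⁻¹ᵁ O) (a : Γ(X, O)) :
    pullbackFunction g (germRat O h a) = germRat (g ⁻¹ᵁ O) h' ((g.app O).hom a) := by
  change (X.presheaf.germ O _ h ≫ X.presheaf.stalkSpecializes _ ≫
    g.stalkMap (genericPoint Y)).hom a = (g.app O ≫ Y.presheaf.germ _ _ _).hom a
  rw [X.presheaf.germ_stalkSpecializes_assoc, Scheme.Hom.germ_stalkMap]

lemma genericPoint_mem_preimage (g : Y ⟶ X) [IsDominant g] {O : X.Opens}
    (h : genericPoint X ∈ O) : genericPoint Y ∈ g ⁻¹ᵁ O :=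
  (genericPoint_specializes_of_isDominant g).mem_open O.isOpen h

lemma exists_germRat (φ : RatFun X) : ∃ (O : X.Opens) (h : genericPoint X ∈ O) (a : Γ(X, O)),
    germRat O h a = φ :=
  TopCat.Presheaf.exists_germ_eq (F := X.presheaf) (x := genericPoint X) φ

lemma pullbackFunction_comp (f : Z ⟶ Y) (g : Y ⟶ X) [IsDominant f] [IsDominant g]
    [IsDominant (f ≫ g)] (φ : RatFun X) :
    pullbackFunction (f ≫ g) φ = pullbackFunction f (pullbackFunction g φ) := by
  obtain ⟨O, h, a, rfl⟩ := exists_germRat φ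
  have h1 := genericPoint_mem_preimage g h
  have h2 := genericPoint_mem_preimage f h1
  rw [pullbackFunction_germRat g O h h1, pullbackFunction_germRat f _ h1 h2,
    pullbackFunction_germRat (f ≫ g) O h h2, Scheme.Hom.comp_app]
  rfl

lemma pullbackFunction_congr {f g : Y ⟶ X} [IsDominant f] [IsDominant g] (h : f = g)
    (φ : RatFun X) : pullbackFunction f φ = pullbackFunction g φ := by
  subst h; rfl

lemma pullbackFunction_mem (g : Y ⟶ X) [IsDominant g] {y : Y} {φ : RatFun X}
    (h : φ ∈ localRing X (g y)) : pullbackFunction g φ ∈ localRing Y y := by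
  obtain ⟨t, rfl⟩ := h
  exact ⟨_, (pullbackFunction_stalkToRat g y t).symm⟩

lemma pullbackFunction_bijective (j : Y ⟶ X) [IsOpenImmersion j] [IsDominant j] :
    Function.Bijective (pullbackFunction j) := by
  refine ⟨(pullbackFunction j).injective, fun ψ => ?_⟩
  obtain ⟨O, h, a, rfl⟩ := exists_germRat ψ
  have hO : genericPoint Y ∈ j ⁻¹ᵁ (j ''ᵁ O) := by
    rw [Scheme.Hom.preimage_image_eq]; exact h
  refine ⟨germRat (j ''ᵁ O) (genericPoint_mem hO) ((j.appIso O).inv.hom a), ?_⟩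
  rw [pullbackFunction_germRat j _ _ hO]
  have := Scheme.Hom.appIso_inv_app j O
  have h2 : (j.app (j ''ᵁ O)).hom ((j.appIso O).inv.hom a) =
    (Y.presheaf.map (eqToHom (Scheme.Hom.preimage_image_eq j O)).op).hom a := by
    rw [← this]; rfl
  rw [h2]
  exact germRat_res (eqToHom (Scheme.Hom.preimage_image_eq j O)) hO a

/-- The local rings of an open subscheme. -/
lemma pullbackFunction_mem_iff (j : Y ⟶ X) [IsOpenImmersion j] [IsDominant j] {y : Y}
    {φ : RatFun X} : pullbackFunction j φ ∈ localRing Y y ↔ φ ∈ localRing X (j y) := by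
  refine ⟨?_, pullbackFunction_mem j⟩
  rintro ⟨t, ht⟩
  obtain ⟨s, rfl⟩ := (ConcreteCategory.bijective_of_isIso (j.stalkMap y)).2 t
  refine ⟨s, (pullbackFunction_bijective j).1 ?_⟩
  rw [pullbackFunction_stalkToRat]
  exact ht

namespace CartierDivisor

variable (g : Y ⟶ X) [IsDominant g] {D E : CartierDivisor X}

lemma IsEquationAt.pullback {y : Y} {f : (RatFun X)ˣ} (h : D.IsEquationAt (g y) f) :
    (D.pullback g).IsEquationAt y (Units.map (pullbackFunction g).toMonoidHom f) := by
  change (QuotientGroup.map _ _ _ (stalkUnits_le_comap g y)).toAdditive (D.1 (g y)) = _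
  rw [h]
  rfl

variable (D) in
lemma pullback_zsmul (n : ℤ) : (n • D).pullback g = n • D.pullback g :=
  ext_of_isEquationAt fun y => by
    obtain ⟨f, hf⟩ := D.exists_isEquationAt (g y)
    refine ⟨_, (hf.zsmul n).pullback g, ?_⟩
    rw [map_zpow]
    exact (hf.pullback g).zsmul n

variable (D) in
lemma pullback_nsmul (n : ℕ) : (n • D).pullback g = n • D.pullback g := by
  rw [← natCast_zsmul, pullback_zsmul, natCast_zsmul]

lemma IsSection.pullback {s : RatFun X} (h : D.IsSection s) :
    (D.pullback g).IsSection (pullbackFunction g s) := isSection_of_exists fun y => by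
  obtain ⟨f, hf⟩ := D.exists_isEquationAt (g y)
  refine ⟨_, hf.pullback g, ?_⟩
  have := pullbackFunction_mem g (h.mem hf)
  rw [map_mul] at this
  exact this

end CartierDivisor

end Pullback

/-! ### Quasi-coherent and locally free subsheaves of a constant sheaf. -/

section QuasiCoherent

variable {X : Scheme.{0}} [IsIntegral X] {W : Type} [AddCommGroup W] [Module (RatFun X) W]
  (F : RatSheaf X W)

/-- A section of a quasi-coherent sheaf over an affine open set may be constructed locally. -/
lemma RatSheaf.mem_sec_of_local [F.IsQuasiCoherent] (U : AffOpen X) (w : W)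
    (h : ∀ x ∈ U.toOpens, ∃ V : AffOpen X, x ∈ V.toOpens ∧ w ∈ F.sec V) : w ∈ F.sec U := by
  -- The multipliers that carry w into F(U) form an ideal. Quasi-coherence puts into it, for each
  -- point of U, a function not vanishing there, so it contains 1.
  let I : Ideal Γ(X, U.toOpens) :=
    { carrier := {a | U.toRat a • w ∈ F.sec U}
      zero_mem' := by simp
      add_mem' := fun {a b} ha hb => by
        simp only [Set.mem_ofPred_eq, map_add, add_smul] at *
        exact add_mem ha hb
      smul_mem' := fun c a ha => by
        simp only [Set.mem_ofPred_eq, smul_eq_mul, map_mul, mul_smul] at *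
        exact F.smul_mem U c _ ha }
  have h1 := U.one_mem_of_forall_exists I fun x hx => by
    obtain ⟨V, hxV, hw⟩ := h x hx
    obtain ⟨V', hU, hV, hx'⟩ := exists_affOpen_le_le U V x hx hxV
    obtain ⟨f, hf⟩ := id hU
    obtain ⟨n, hn⟩ := RatSheaf.IsQuasiCoherent.exists_pow (F := F) V' U f hf w (F.mono hV hw)
    -- The exponent n + 1 is positive even for n = 0, as needed for D(f^(n+1)) = D(f).
    refine ⟨f ^ (n + 1), ?_, ?_⟩
    · change U.toRat (f ^ (n + 1)) • w ∈ F.sec U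
      rw [pow_succ', map_mul, mul_smul, map_pow]
      exact F.smul_mem _ _ _ hn
    · rw [Scheme.basicOpen_pow _ _ n.succ_pos, hf]
      exact hx'
  have h2 : U.toRat 1 • w ∈ F.sec U := h1
  rwa [map_one, one_smul] at h2

lemma RatSheaf.sec_mono [F.IsQuasiCoherent] {V U : AffOpen X} (h : V.toOpens ≤ U.toOpens) :
    F.sec U ≤ F.sec V := fun w hw =>
  F.mem_sec_of_local V w fun _ hx => ⟨U, h hx, hw⟩

/-- `e` is a basis of `F` over the affine open set `V`. -/
structure RatSheaf.IsFreeOn (V : AffOpen X) {n : ℕ} (e : Fin n → W) : Prop where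
  mem : ∀ i, e i ∈ F.sec V
  indep : LinearIndependent (RatFun X) e
  surj : ∀ w ∈ F.sec V, ∃ a : Fin n → Γ(X, V.toOpens), w = ∑ i, V.toRat (a i) • e i

variable {F}

lemma RatSheaf.IsFreeOn.mono [F.IsQuasiCoherent] {V U : AffOpen X} (h : V ≤ U) {n : ℕ}
    {e : Fin n → W} (he : F.IsFreeOn U e) : F.IsFreeOn V e where
  mem i := F.mono h (he.mem i)
  indep := he.indep
  surj w hw := by
    obtain ⟨f, hf⟩ := id h
    obtain ⟨n, hn⟩ := RatSheaf.IsQuasiCoherent.exists_pow (F := F) V U f hf w hw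
    obtain ⟨a, ha⟩ := he.surj _ hn
    obtain ⟨⟨u, hu⟩, -⟩ := AffOpen.res_localization h hf
    refine ⟨fun i => ((u⁻¹ : _ˣ) : Γ(X, V.toOpens)) ^ n * AffOpen.res h (a i), ?_⟩
    have h1 : V.toRat (u⁻¹ : _ˣ) * U.toRat f = 1 := by
      rw [← AffOpen.toRat_res h, ← map_mul, ← hu, Units.inv_mul, map_one]
    simp only [map_mul, map_pow, AffOpen.toRat_res, mul_smul, ← Finset.smul_sum]
    rw [← ha, smul_smul, ← mul_pow, h1, one_pow, one_smul]

/-- The basis of the module of sections. -/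
def RatSheaf.IsFreeOn.basis {V : AffOpen X} {n : ℕ} {e : Fin n → W} (he : F.IsFreeOn V e) :
    Module.Basis (Fin n) Γ(X, V.toOpens) (F.Sec V) :=
  Module.Basis.mk (v := fun i => (⟨e i, he.mem i⟩ : F.Sec V))
    (by
      rw [Fintype.linearIndependent_iff]
      intro g hg i
      have h := congrArg Subtype.val hg
      rw [AddSubgroup.val_finsetSum] at h
      have := Fintype.linearIndependent_iff.mp he.indep (fun i => V.toRat (g i)) h i
      exact V.toRat_injective (this.trans (map_zero _).symm))
    (by
      rintro ⟨w, hw⟩ -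
      obtain ⟨a, ha⟩ := he.surj w hw
      have : (⟨w, hw⟩ : F.Sec V) = ∑ i, a i • (⟨e i, he.mem i⟩ : F.Sec V) :=
        Subtype.ext (by rw [AddSubgroup.val_finsetSum]; exact ha)
      rw [this]
      exact Submodule.sum_mem _ fun i _ => Submodule.smul_mem _ _ (Submodule.subset_span ⟨i, rfl⟩))

lemma RatSheaf.IsFreeOn.coe_basis {V : AffOpen X} {n : ℕ} {e : Fin n → W} (he : F.IsFreeOn V e)
    (i : Fin n) : (he.basis i : W) = e i := by
  simp [basis]

variable (F) in
/-- Locally free sheaves of positive rank. -/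
class RatSheaf.IsLocallyFree : Prop where
  exists_free : ∀ x : X, ∃ (V : AffOpen X) (n : ℕ) (_ : 0 < n) (e : Fin n → W),
    x ∈ V.toOpens ∧ F.IsFreeOn V e

variable (F) in
lemma RatSheaf.exists_free [F.IsQuasiCoherent] [F.IsLocallyFree] (U : AffOpen X) {x : X}
    (hx : x ∈ U.toOpens) : ∃ (V : AffOpen X) (n : ℕ) (_ : 0 < n) (e : Fin n → W),
    V ≤ U ∧ x ∈ V.toOpens ∧ F.IsFreeOn V e := by
  obtain ⟨V, n, hn, e, hxV, he⟩ := IsLocallyFree.exists_free (F := F) x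
  obtain ⟨V', hU, hV, hx'⟩ := exists_affOpen_le_le U V x hx hxV
  exact ⟨V', n, hn, e, hU, hx', he.mono hV⟩

end QuasiCoherent

/-! ### Quasi-coherence of O(D). -/

section DivisorSheaf

variable {X : Scheme.{0}} [IsIntegral X] (D : CartierDivisor X)

lemma CartierDivisor.mem_sheaf_iff {U : AffOpen X} {s : RatFun X} : s ∈ D.sheaf.sec U ↔
    ∀ x ∈ U.toOpens, ∃ f : (RatFun X)ˣ, D.IsEquationAt x f ∧ s * f ∈ localRing X x := by
  constructor
  · intro h x hx
    obtain ⟨f, hf⟩ := D.exists_isEquationAt x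
    exact ⟨f, hf, h x hx f hf⟩
  · intro h x hx g hg
    obtain ⟨f, hf, hs⟩ := h x hx
    exact hf.mul_mem hg hs

lemma CartierDivisor.IsSection.mem_sheaf {D : CartierDivisor X} {s : RatFun X} (h : D.IsSection s)
    (U : AffOpen X) : s ∈ D.sheaf.sec U := fun x _ f hf => h x f hf

lemma exists_affOpen_isEquationAt (U : AffOpen X) {x : X} (hx : x ∈ U.toOpens) :
    ∃ (V : AffOpen X) (f : (RatFun X)ˣ), V ≤ U ∧ x ∈ V.toOpens ∧
      ∀ y ∈ V.toOpens, D.IsEquationAt y f := by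
  obtain ⟨f, O, hxO, hO⟩ := D.exists_opens_isEquationAt x
  obtain ⟨V, hV, hxV, hVO⟩ := exists_affOpen_le U O x hx hxO
  exact ⟨V, f, hV, hxV, fun y hy => hO y (hVO hy)⟩

lemma mem_sheaf_iff_of_isEquationAt {V : AffOpen X} {f : (RatFun X)ˣ}
    (hf : ∀ y ∈ V.toOpens, D.IsEquationAt y f) {s : RatFun X} :
    s ∈ D.sheaf.sec V ↔ s * f ∈ V.toRat.range := by
  rw [D.mem_sheaf_iff]
  constructor
  · intro h
    refine V.mem_range_toRat fun x hx => ?_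
    obtain ⟨g, hg, hs⟩ := h x hx
    exact hg.mul_mem (hf x hx) hs
  · rintro ⟨a, ha⟩ x hx
    exact ⟨f, hf x hx, ha ▸ V.toRat_mem_localRing a hx⟩

/-- A function on `D(f)` becomes regular on `U` after multiplication by a power of `f`. -/
lemma AffOpen.exists_pow_mul_mem {V U : AffOpen X} {f : Γ(X, U.toOpens)}
    (hf : X.basicOpen f = V.toOpens) {φ : RatFun X} (hφ : φ ∈ V.toRat.range) :
    ∃ n : ℕ, U.toRat f ^ n * φ ∈ U.toRat.range := by
  have h : V ≤ U := ⟨f, hf⟩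
  obtain ⟨b, rfl⟩ := hφ
  obtain ⟨n, r, hr⟩ := (AffOpen.res_localization h hf).2 b
  refine ⟨n, r, ?_⟩
  rw [← AffOpen.toRat_res h, ← AffOpen.toRat_res h, ← hr, map_mul, map_pow]

instance : D.sheaf.IsQuasiCoherent where
  exists_pow V U f hf w hw := by
    have key : ∀ x : U.toOpens, ∃ (V' : AffOpen X) (n : ℕ), x.1 ∈ V'.toOpens ∧
        ∀ m, n ≤ m → U.toRat f ^ m * w ∈ D.sheaf.sec V' := by
      rintro ⟨x, hx⟩
      obtain ⟨V', g, hV', hxV', hg⟩ := exists_affOpen_isEquationAt D U hx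
      -- An `AffOpen` is nonempty by definition, so the case of an empty D(f) in V' is split off.
      by_cases hne : ((X.basicOpen (AffOpen.res hV' f) : X.Opens) : Set X).Nonempty
      · let V'' : AffOpen X := ⟨X.basicOpen (AffOpen.res hV' f), V'.2.1.basicOpen _, hne⟩
        have hle : V''.toOpens ≤ V.toOpens := by
          rw [← hf]
          change X.basicOpen ((X.presheaf.map _).hom f) ≤ _
          rw [Scheme.basicOpen_res]
          exact inf_le_right
        have hle' : V''.toOpens ≤ V'.toOpens := X.basicOpen_le _
        have h1 : w * g ∈ V''.toRat.range :=
          (mem_sheaf_iff_of_isEquationAt D fun y hy => hg y (hle' hy)).mp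
            fun y hy => hw y (hle hy)
        obtain ⟨n, a, ha⟩ := AffOpen.exists_pow_mul_mem (V := V'') (U := V') rfl h1
        refine ⟨V', n, hxV', fun m hm => ?_⟩
        obtain ⟨k, rfl⟩ := Nat.exists_eq_add_of_le hm
        rw [mem_sheaf_iff_of_isEquationAt D hg]
        refine ⟨AffOpen.res hV' f ^ k * a, ?_⟩
        rw [map_mul, ha, map_pow, AffOpen.toRat_res]
        ring
      · refine ⟨V', 1, hxV', fun m hm => ?_⟩
        have h0 : AffOpen.res hV' f = 0 := by
          rw [Set.not_nonempty_iff_eq_empty] at hne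
          rw [← basicOpen_eq_bot_iff]
          exact TopologicalSpace.Opens.ext hne
        rw [← AffOpen.toRat_res hV', h0, map_zero, zero_pow (by omega), zero_mul]
        exact zero_mem _
    choose N n hN hn using key
    obtain ⟨t, ht⟩ := U.2.1.isCompact.elim_finite_subcover (fun x => ((N x).toOpens : Set X))
      (fun x => (N x).toOpens.isOpen) fun x hx => Set.mem_iUnion.mpr ⟨⟨x, hx⟩, hN _⟩
    -- The sum dominates every exponent of the finite subcover, and `key` allows any larger
    -- exponent.
    refine ⟨∑ x ∈ t, n x, fun y hy => ?_⟩
    obtain ⟨x, hxt, hyx⟩ := Set.mem_iUnion₂.mp (ht hy)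
    exact hn x _ (Finset.single_le_sum (fun _ _ => Nat.zero_le _) hxt) y hyx

end DivisorSheaf

/-! ### Divisibility by coordinates in the symmetric algebra of a free module. -/

section SymmetricAlgebra

variable {R M : Type} [CommRing R] [AddCommGroup M] [Module R M]

lemma algebraMap_mul_mem_symPow {r : ℕ} (a : R) {P : SymmetricAlgebra R M}
    (hP : P ∈ symPow R M r) : algebraMap R _ a * P ∈ symPow R M r := by
  rw [← Algebra.smul_def]; exact Submodule.smul_mem _ _ hP

/-- The evaluation of elements of the symmetric algebra at an additive functional. -/
def symEval {E : Type} [CommRing E] (ρ : R →+* E) (τ : M → E)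
    (h_add : ∀ v w, τ (v + w) = τ v + τ w) (h_smul : ∀ a w, τ (a • w) = ρ a * τ w) :
    SymmetricAlgebra R M →+* E :=
  letI := ρ.toAlgebra
  (SymmetricAlgebra.lift
    { toFun := τ
      map_add' := h_add
      map_smul' := fun a w => by rw [Algebra.smul_def]; exact h_smul a w } :
    SymmetricAlgebra R M →ₐ[R] E).toRingHom

section

variable {E : Type} [CommRing E] (ρ : R →+* E) (τ : M → E)
    (h_add : ∀ v w, τ (v + w) = τ v + τ w) (h_smul : ∀ a w, τ (a • w) = ρ a * τ w)

@[simp]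
lemma symEval_ι (m : M) : symEval ρ τ h_add h_smul (SymmetricAlgebra.ι R M m) = τ m := by
  let _ := ρ.toAlgebra
  exact SymmetricAlgebra.lift_ι_apply _ _

@[simp]
lemma symEval_algebraMap (a : R) :
    symEval ρ τ h_add h_smul (algebraMap R _ a) = ρ a := by
  let _ := ρ.toAlgebra
  exact AlgHom.commutes (SymmetricAlgebra.lift _ : SymmetricAlgebra R M →ₐ[R] E) a

end

lemma ι_basis_ne_zero [IsDomain R] {κ : Type} (b : Module.Basis κ R M) (i : κ) :
    SymmetricAlgebra.ι R M (b i) ≠ 0 := by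
  intro h
  have := congrArg (SymmetricAlgebra.equivMvPolynomial b) h
  rw [SymmetricAlgebra.equivMvPolynomial_ι_apply, map_zero] at this
  exact MvPolynomial.X_ne_zero i this

lemma prime_ι_basis [IsDomain R] {κ : Type} (b : Module.Basis κ R M) (i : κ) :
    Prime (SymmetricAlgebra.ι R M (b i)) := by
  rw [← MulEquiv.prime_iff (SymmetricAlgebra.equivMvPolynomial b).toMulEquiv]
  change Prime (SymmetricAlgebra.equivMvPolynomial b (SymmetricAlgebra.ι R M (b i)))
  rw [SymmetricAlgebra.equivMvPolynomial_ι_apply]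
  exact MvPolynomial.X_prime

lemma not_ι_basis_dvd [IsDomain R] {κ : Type} (b : Module.Basis κ R M) {i j : κ} (hij : i ≠ j) :
    ¬ SymmetricAlgebra.ι R M (b i) ∣ SymmetricAlgebra.ι R M (b j) := by
  intro h
  have := map_dvd (SymmetricAlgebra.equivMvPolynomial b) h
  rw [SymmetricAlgebra.equivMvPolynomial_ι_apply, SymmetricAlgebra.equivMvPolynomial_ι_apply,
    MvPolynomial.X_dvd_X] at this
  exact hij this

lemma ι_pow_mem (m : M) (N : ℕ) : SymmetricAlgebra.ι R M m ^ N ∈ symPow R M N := by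
  have := SetLike.pow_mem_graded N (ι_mem_symPow R m)
  rwa [nsmul_eq_mul, mul_one] at this

/-- The quotient can be replaced by its component of degree r, because the divisor is homogeneous of
degree N. -/
lemma exists_of_ι_pow_dvd [IsDomain R] {κ : Type} (b : Module.Basis κ R M) (i : κ) {N r : ℕ}
    {P : SymmetricAlgebra R M} (hP : P ∈ symPow R M (N + r))
    (h : SymmetricAlgebra.ι R M (b i) ^ N ∣ P) :
    ∃ Q ∈ symPow R M r, P = SymmetricAlgebra.ι R M (b i) ^ N * Q := by
  obtain ⟨Q, rfl⟩ := h
  refine ⟨_, (DirectSum.decompose (symPow R M) Q r).2, ?_⟩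
  rw [← DirectSum.coe_decompose_mul_add_of_left_mem (symPow R M) (ι_pow_mem (b i) N),
    DirectSum.decompose_of_mem_same _ hP]

/-- Serves the case of rank one, where no second coordinate is available for the divisibility
argument. -/
lemma exists_smul_ι_pow {m : M} (hm : ∀ w : M, ∃ c : R, w = c • m) {r : ℕ}
    {P : SymmetricAlgebra R M} (hP : P ∈ symPow R M r) :
    ∃ c : R, P = c • SymmetricAlgebra.ι R M m ^ r := by
  unfold symPow at hP
  induction hP using Submodule.pow_induction_on_left' with
  | algebraMap a => exact ⟨a, by rw [pow_zero, Algebra.algebraMap_eq_smul_one]⟩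
  | add x y i hx hy ihx ihy =>
    obtain ⟨c, rfl⟩ := ihx
    obtain ⟨d, rfl⟩ := ihy
    exact ⟨c + d, (add_smul _ _ _).symm⟩
  | mem_mul w hw i x hx ih =>
    obtain ⟨w, rfl⟩ := hw
    obtain ⟨c, rfl⟩ := hm w
    obtain ⟨d, rfl⟩ := ih
    exact ⟨c * d, by rw [map_smul, smul_mul_smul_comm, Nat.succ_eq_add_one, pow_succ']⟩

/-- Sections of `O(r)` on the projectivization of a free module: if the fractions `P i / x i ^ N`,
where the `x i` are a basis, coincide, then they are a polynomial. -/
lemma exists_eq_ι_pow_mul [IsDomain R] {n : ℕ} (hn : 0 < n) (b : Module.Basis (Fin n) R M)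
    {N r : ℕ} (P : Fin n → SymmetricAlgebra R M) (hP : ∀ i, P i ∈ symPow R M (N + r))
    (h : ∀ i j, SymmetricAlgebra.ι R M (b j) ^ N * P i = SymmetricAlgebra.ι R M (b i) ^ N * P j) :
    ∃ Q ∈ symPow R M r, ∀ i, P i = SymmetricAlgebra.ι R M (b i) ^ N * Q := by
  have : Module.Free R M := .of_basis b
  let i₀ : Fin n := ⟨0, hn⟩
  have key : SymmetricAlgebra.ι R M (b i₀) ^ N ∣ P i₀ := by
    by_cases h1 : n = 1
    · subst h1
      obtain ⟨c, hc⟩ := exists_smul_ι_pow (m := b i₀) (fun w => ⟨b.repr w i₀, by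
        conv_lhs => rw [← b.sum_repr w]
        rw [Fin.sum_univ_one]; rfl⟩) (hP i₀)
      rw [hc, pow_add]
      rw [Algebra.smul_def, mul_left_comm]
      exact dvd_mul_right _ _
    · let i₁ : Fin n := ⟨1, by omega⟩
      have h01 : i₀ ≠ i₁ := by simp [i₀, i₁, Fin.ext_iff]
      -- The hypothesis reads x₁^N P₀ = x₀^N P₁, and the prime x₀ does not divide x₁.
      refine (prime_ι_basis b i₀).pow_dvd_of_dvd_mul_left N (a := SymmetricAlgebra.ι R M (b i₁) ^ N)
        (fun hd => not_ι_basis_dvd b h01 ((prime_ι_basis b i₀).dvd_of_dvd_pow hd)) ?_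
      exact ⟨_, h i₀ i₁⟩
  obtain ⟨Q, hQ, hPQ⟩ := exists_of_ι_pow_dvd b i₀ (hP i₀) key
  refine ⟨Q, hQ, fun i => ?_⟩
  have h2 := h i i₀
  rw [hPQ, mul_left_comm] at h2
  exact mul_left_cancel₀ (pow_ne_zero N (ι_basis_ne_zero b i₀)) h2

variable {S N : Type} [CommRing S] [AddCommGroup N] [Module S N] {ρ : R →+* S}

/-- A numerator a priori need not be homogeneous; its component of degree r has the same image,
since g has degree 0 and z has degree r. -/
lemma IsAwayMap.exists_symMap_eq {φ : M →ₛₗ[ρ] N} {g : R} (h : IsAwayMap φ g) {r : ℕ}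
    {z : SymmetricAlgebra S N} (hz : z ∈ symPow S N r) :
    ∃ (n : ℕ) (a : SymmetricAlgebra R M), a ∈ symPow R M r ∧
      algebraMap S _ (ρ g) ^ n * z = symMap φ a := by
  obtain ⟨n, a, ha⟩ :=
    (symMap_localization φ g h.isUnit h.surj h.inj h.surj' h.inj').1 z
  refine ⟨n, _, (DirectSum.decompose (symPow R M) a r).2, ?_⟩
  change _ = symMapGraded φ (DirectSum.decompose (symPow R M) a r)
  rw [GradedRingHom.map_directSumDecompose]
  change _ = ((DirectSum.decompose (symPow S N) (symMap φ a) r : _) : SymmetricAlgebra S N)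
  rw [← ha, ← map_pow, DirectSum.decompose_of_mem_same _ (algebraMap_mul_mem_symPow _ hz)]

end SymmetricAlgebra

/-! ### Symmetric tensors evaluated in a field extension of K(X). -/

section Realization

open scoped TensorProduct

variable {X : Scheme.{0}} [IsIntegral X] {W : Type} [AddCommGroup W] [Module (RatFun X) W]

lemma RatSheaf.isAwayMap_of_basicOpen_eq (F : RatSheaf X W) [F.IsQuasiCoherent] {V U : AffOpen X}
    (h : V ≤ U) {g : Γ(X, U.toOpens)} (hg : X.basicOpen g = V.toOpens) :
    IsAwayMap (F.res h) g := by
  obtain ⟨h1, h2⟩ := AffOpen.res_localization h hg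
  refine ⟨h1, h2, fun r hr => ⟨0, ?_⟩, fun w => ?_, fun r hr => ⟨0, ?_⟩⟩
  · rw [pow_zero, one_mul]
    exact AffOpen.res_injective h (hr.trans (map_zero _).symm)
  · obtain ⟨n, hn⟩ := RatSheaf.IsQuasiCoherent.exists_pow (F := F) V U g hg w.1 w.2
    refine ⟨n, ⟨_, hn⟩, Subtype.ext ?_⟩
    rw [RatSheaf.coe_smul, map_pow, AffOpen.toRat_res]
    rfl
  · rw [pow_zero, one_smul]
    exact Subtype.ext ((F.coe_res h r).symm.trans (congrArg Subtype.val hr))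

/-- A realization of the sections of `F` in an extension of the field of rational functions. -/
structure RatSheaf.Realization (F : RatSheaf X W) (E : Type) [Field E] where
  /-- the extension of fields -/
  κ : RatFun X →+* E
  /-- the realization of sections -/
  τ : W → E
  map_add : ∀ (U : AffOpen X), ∀ v ∈ F.sec U, ∀ w ∈ F.sec U, τ (v + w) = τ v + τ w
  map_smul : ∀ (U : AffOpen X) (a : Γ(X, U.toOpens)), ∀ w ∈ F.sec U,
    τ (U.toRat a • w) = κ (U.toRat a) * τ w

namespace RatSheaf.Realization

variable {F : RatSheaf X W} {E : Type} [Field E] (ρ : F.Realization E)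

/-- The induced map on the symmetric algebra. -/
def eval (U : AffOpen X) : SymmetricAlgebra Γ(X, U.toOpens) (F.Sec U) →+* E :=
  symEval (ρ.κ.comp U.toRat) (fun w : F.Sec U => ρ.τ w.1)
    (fun v w => ρ.map_add U v.1 v.2 w.1 w.2) (fun a w => ρ.map_smul U a w.1 w.2)

@[simp]
lemma eval_ι (U : AffOpen X) (w : F.Sec U) :
    ρ.eval U (SymmetricAlgebra.ι _ _ w) = ρ.τ w.1 := symEval_ι _ _ _ _ w

@[simp]
lemma eval_algebraMap (U : AffOpen X) (a : Γ(X, U.toOpens)) :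
    ρ.eval U (algebraMap _ _ a) = ρ.κ (U.toRat a) := symEval_algebraMap _ _ _ _ a

lemma eval_smul (U : AffOpen X) (a : Γ(X, U.toOpens)) (P : SymmetricAlgebra _ (F.Sec U)) :
    ρ.eval U (a • P) = ρ.κ (U.toRat a) * ρ.eval U P := by
  rw [Algebra.smul_def, map_mul, eval_algebraMap]

lemma eval_symMap {V U : AffOpen X} (h : V ≤ U) (P : SymmetricAlgebra _ (F.Sec U)) :
    ρ.eval V (symMap (F.res h) P) = ρ.eval U P := by
  refine DFunLike.congr_fun (ringHom_symAlg_ext (f := (ρ.eval V).comp (symMap (F.res h)))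
    (g := ρ.eval U) (fun r => ?_) (fun m => ?_)) P
  · rw [RingHom.comp_apply, symMap_algebraMap, eval_algebraMap, eval_algebraMap, AffOpen.toRat_res]
  · rw [RingHom.comp_apply, symMap_ι, eval_ι, eval_ι]; rfl

/-- The realization is faithful if it is injective on the symmetric powers, where `F` is free. -/
class IsFaithful : Prop where
  eq_zero : ∀ (V : AffOpen X) (n : ℕ) (e : Fin n → W), F.IsFreeOn V e → ∀ (r : ℕ),
    ∀ P ∈ symPow Γ(X, V.toOpens) (F.Sec V) r, ρ.eval V P = 0 → P = 0

/-- The annihilator of P has no common zeros: each point has a neighbourhood D(g) on which F is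
free, there P restricts to 0 by faithfulness, and so a power of g kills P. -/
lemma eq_zero_of_eval_eq_zero [F.IsQuasiCoherent] [F.IsLocallyFree] [ρ.IsFaithful]
    (U : AffOpen X) {r : ℕ} {P} (hP : P ∈ symPow Γ(X, U.toOpens) (F.Sec U) r)
    (h : ρ.eval U P = 0) : P = 0 := by
  have h1 : (1 : Γ(X, U.toOpens)) ∈ Submodule.annihilator (Submodule.span Γ(X, U.toOpens) {P}) := by
    refine U.one_mem_of_forall_exists _ fun x hx => ?_
    obtain ⟨V, n, hn, e, hV, hxV, he⟩ := F.exists_free U hx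
    have h0 : symMap (F.res hV) P = 0 :=
      IsFaithful.eq_zero (ρ := ρ) V n e he r _ (symMap_mem _ hP) (by rw [eval_symMap, h])
    obtain ⟨g, hg⟩ := id hV
    have haw := F.isAwayMap_of_basicOpen_eq hV hg
    obtain ⟨k, hk⟩ :=
      (symMap_localization (F.res hV) g haw.isUnit haw.surj haw.inj haw.surj' haw.inj').2 P h0
    refine ⟨g ^ (k + 1), ?_, by rw [Scheme.basicOpen_pow _ _ k.succ_pos, hg]; exact hxV⟩
    rw [Submodule.mem_annihilator_span_singleton, Algebra.smul_def, pow_succ', map_mul, mul_assoc,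
      map_pow, hk, mul_zero]
  rwa [Submodule.mem_annihilator_span_singleton, one_smul] at h1

/-- The induced map on the sections of `Sym^r F ⊗ O(D)`. -/
def twistEval (r : ℕ) (D : CartierDivisor X) (U : AffOpen X) : SymTwist F r D U →+ E :=
  TensorProduct.liftAddHom
    (AddMonoidHom.mk' (fun P : symPow Γ(X, U.toOpens) (F.Sec U) r =>
      AddMonoidHom.mk' (fun s : D.sheaf.Sec U => ρ.eval U P.1 * ρ.κ s.1) (fun s t => by
        rw [AddSubgroup.coe_add, _root_.map_add, mul_add])) (fun P Q => by
        ext s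
        change ρ.eval U (P.1 + Q.1) * _ = ρ.eval U P.1 * ρ.κ s.1 + ρ.eval U Q.1 * ρ.κ s.1
        rw [_root_.map_add, add_mul]))
    (fun a P s => by
      change ρ.eval U (a • P.1) * _ = _ * ρ.κ (U.toRat a * s.1)
      rw [eval_smul, map_mul]; ring)

@[simp]
lemma twistEval_tmul (r : ℕ) (D : CartierDivisor X) (U : AffOpen X)
    (P : symPow Γ(X, U.toOpens) (F.Sec U) r) (s : D.sheaf.Sec U) :
    ρ.twistEval r D U (P ⊗ₜ s) = ρ.eval U P.1 * ρ.κ s.1 := rfl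

variable {r : ℕ} {D : CartierDivisor X}

lemma twistEval_smul (U : AffOpen X) (a : Γ(X, U.toOpens)) (z : SymTwist F r D U) :
    ρ.twistEval r D U (a • z) = ρ.κ (U.toRat a) * ρ.twistEval r D U z := by
  induction z using TensorProduct.induction_on with
  | zero => simp
  | add x y hx hy => rw [smul_add, _root_.map_add, hx, hy, _root_.map_add, mul_add]
  | tmul P s =>
    rw [TensorProduct.smul_tmul', twistEval_tmul, twistEval_tmul, Submodule.coe_smul, eval_smul,
      mul_assoc]

lemma twistEval_map {V U : AffOpen X} (h : V ≤ U) (z : SymTwist F r D U) :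
    ρ.twistEval r D V (TensorProduct.map (symPowRes F r h) (D.sheaf.res h) z) =
      ρ.twistEval r D U z := by
  induction z using TensorProduct.induction_on with
  | zero => simp
  | add x y hx hy => rw [_root_.map_add, _root_.map_add, hx, hy, _root_.map_add]
  | tmul P s =>
    rw [TensorProduct.map_tmul, twistEval_tmul, twistEval_tmul]
    exact congrArg (· * _) (ρ.eval_symMap h P.1)

/-- If `f` is a local equation of `D`, then `Sym^r F ⊗ O(D) = f⁻¹ Sym^r F`. -/
lemma exists_forall_eval_eq {U : AffOpen X} {f : (RatFun X)ˣ}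
    (hf : ∀ y ∈ U.toOpens, D.IsEquationAt y f) (z : SymTwist F r D U) :
    ∃ P ∈ symPow Γ(X, U.toOpens) (F.Sec U) r, ∀ (L : Type) [Field L] (ρ : F.Realization L),
      ρ.twistEval r D U z * ρ.κ f = ρ.eval U P := by
  induction z using TensorProduct.induction_on with
  | zero => exact ⟨0, zero_mem _, fun L _ ρ => by simp⟩
  | add x y hx hy =>
    obtain ⟨P, hP, h1⟩ := hx
    obtain ⟨Q, hQ, h2⟩ := hy
    exact ⟨P + Q, add_mem hP hQ, fun L _ ρ => by
      rw [_root_.map_add, add_mul, h1, h2, _root_.map_add]⟩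
  | tmul P s =>
    obtain ⟨a, ha⟩ := (mem_sheaf_iff_of_isEquationAt D hf).mp s.2
    refine ⟨a • P.1, Submodule.smul_mem _ _ P.2, fun L _ ρ => ?_⟩
    rw [twistEval_tmul, eval_smul, ha, map_mul]; ring

/-- In a neighbourhood of `x`, the sections of `Sym^r F ⊗ O(D)` are of the form `P ⊗ ν`. -/
lemma exists_pow_smul_eq_tmul {U V : AffOpen X} (hV : V ≤ U) {f : (RatFun X)ˣ}
    (hf : ∀ y ∈ V.toOpens, D.IsEquationAt y f) {g : Γ(X, U.toOpens)}
    (hg : X.basicOpen g = V.toOpens) :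
    ∃ (l : ℕ) (ν : D.sheaf.Sec U), ν.1 * f = U.toRat g ^ l ∧
      ∀ z : SymTwist F r D U, ∃ (k : ℕ) (P : symPow Γ(X, U.toOpens) (F.Sec U) r),
        g ^ k • z = P ⊗ₜ ν := by
  have h1 : (f⁻¹ : (RatFun X)ˣ).1 ∈ D.sheaf.sec V := by
    rw [mem_sheaf_iff_of_isEquationAt D hf, Units.inv_mul]
    exact one_mem _
  obtain ⟨l, hl⟩ := RatSheaf.IsQuasiCoherent.exists_pow (F := D.sheaf) V U g hg _ h1
  refine ⟨l, ⟨_, hl⟩, by simp, fun z => ?_⟩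
  induction z using TensorProduct.induction_on with
  | zero => exact ⟨0, 0, by simp⟩
  | add x y hx hy =>
    obtain ⟨k, P, hP⟩ := hx
    obtain ⟨k', Q, hQ⟩ := hy
    refine ⟨k + k', g ^ k' • P + g ^ k • Q, ?_⟩
    rw [smul_add, TensorProduct.add_tmul, ← TensorProduct.smul_tmul', ← TensorProduct.smul_tmul',
      ← hP, ← hQ, smul_smul, smul_smul, ← pow_add, ← pow_add, add_comm k']
  | tmul P s =>
    have h2 : s.1 * f ∈ V.toRat.range :=
      (mem_sheaf_iff_of_isEquationAt D hf).mp (D.sheaf.mono hV s.2)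
    -- The function s f is regular on D(g), so g^k s f = a on U; with ν = g^l f⁻¹ this gives g^(k+l)
    -- s = a ν.
    obtain ⟨k, a, ha⟩ := AffOpen.exists_pow_mul_mem hg h2
    refine ⟨k + l, a • P, ?_⟩
    rw [TensorProduct.smul_tmul, ← TensorProduct.tmul_smul]
    congr 1
    refine Subtype.ext ?_
    rw [RatSheaf.coe_smul, RatSheaf.coe_smul, ha, map_pow, pow_add]
    simp only [smul_eq_mul]
    calc _ = U.toRat g ^ k * U.toRat g ^ l * s.1 * (f.1 * (f⁻¹ : (RatFun X)ˣ).1) := by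
          rw [Units.mul_inv, mul_one]
      _ = _ := by ring

/-- After multiplication by a power of g the tensor becomes P ⊗ ν with ν ≠ 0, so injectivity on
Sym^r gives P = 0. The annihilator of z therefore has no common zeros. -/
lemma eq_zero_of_twistEval_eq_zero [F.IsQuasiCoherent] [F.IsLocallyFree] [ρ.IsFaithful]
    (U : AffOpen X) {z : SymTwist F r D U} (h : ρ.twistEval r D U z = 0) : z = 0 := by
  have h1 : (1 : Γ(X, U.toOpens)) ∈ Submodule.annihilator (Submodule.span Γ(X, U.toOpens) {z}) := by
    refine U.one_mem_of_forall_exists _ fun x hx => ?_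
    obtain ⟨V, f, hV, hxV, hf⟩ := exists_affOpen_isEquationAt D U hx
    obtain ⟨g, hg⟩ := id hV
    obtain ⟨l, ν, hν, hz⟩ := exists_pow_smul_eq_tmul (F := F) (r := r) hV hf hg
    obtain ⟨k, P, hP⟩ := hz z
    refine ⟨g ^ (k + 1), ?_, by rw [Scheme.basicOpen_pow _ _ k.succ_pos, hg]; exact hxV⟩
    have h2 : ρ.twistEval r D U (g ^ k • z) = 0 := by rw [twistEval_smul, h, mul_zero]
    rw [hP, twistEval_tmul, mul_eq_zero] at h2
    have hν0 : ρ.κ ν.1 ≠ 0 := by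
      rw [map_ne_zero]
      intro h0
      rw [h0, zero_mul] at hν
      have h4 : U.toRat g ≠ 0 := fun h4 => by
        rw [← map_zero U.toRat] at h4
        have h5 := hg
        rw [U.toRat_injective h4, Scheme.basicOpen_zero] at h5
        rw [← h5] at hxV
        exact hxV
      exact pow_ne_zero l h4 hν.symm
    have hP0 : P = 0 := Subtype.ext (ρ.eq_zero_of_eval_eq_zero U P.2 (h2.resolve_right hν0))
    rw [hP0, TensorProduct.zero_tmul] at hP
    rw [Submodule.mem_annihilator_span_singleton, pow_succ', mul_smul, hP, smul_zero]
  rwa [Submodule.mem_annihilator_span_singleton, one_smul] at h1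

/-- An element of `E` that is locally given by a section of `Sym^r F ⊗ O(D)` is given by a
section. -/
lemma exists_twistEval_eq [F.IsQuasiCoherent] (U : AffOpen X) (φ : E)
    (h : ∀ x ∈ U.toOpens, ∃ (V : AffOpen X) (f : (RatFun X)ˣ), x ∈ V.toOpens ∧
      (∀ y ∈ V.toOpens, D.IsEquationAt y f) ∧
      ∃ P ∈ symPow Γ(X, V.toOpens) (F.Sec V) r, φ * ρ.κ f = ρ.eval V P) :
    ∃ z, ρ.twistEval r D U z = φ := by
  -- The functions a for which aφ is the value of a section over U form an ideal; the local
  -- descriptions of φ show that it has no common zeros.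
  let I : Ideal Γ(X, U.toOpens) :=
    { carrier := {a | ∃ z, ρ.twistEval r D U z = ρ.κ (U.toRat a) * φ}
      zero_mem' := ⟨0, by simp⟩
      add_mem' := by
        rintro a b ⟨z, hz⟩ ⟨z', hz'⟩
        exact ⟨z + z', by rw [_root_.map_add, hz, hz', _root_.map_add, _root_.map_add, add_mul]⟩
      smul_mem' := by
        rintro c a ⟨z, hz⟩
        exact ⟨c • z, by rw [twistEval_smul, hz, smul_eq_mul, map_mul, map_mul, mul_assoc]⟩ }
  have h1 : (1 : Γ(X, U.toOpens)) ∈ I := U.one_mem_of_forall_exists I fun x hx => by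
    obtain ⟨V', f, hxV', hf', P', hP', hφ'⟩ := h x hx
    obtain ⟨V, hV, hV', hxV⟩ := exists_affOpen_le_le U V' x hx hxV'
    have hf : ∀ y ∈ V.toOpens, D.IsEquationAt y f := fun y hy => hf' y (AffOpen.toOpens_mono hV' hy)
    obtain ⟨g, hg⟩ := id hV
    have haw := F.isAwayMap_of_basicOpen_eq hV hg
    obtain ⟨n, Q, hQ, hPQ⟩ := haw.exists_symMap_eq (symMap_mem (F.res hV') hP')
    obtain ⟨l, ν, hν, -⟩ := exists_pow_smul_eq_tmul (F := F) (r := r) hV hf hg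
    -- Here n extends the polynomial from D(g) to U, l comes from ν f = g^l, and the last factor g
    -- keeps the exponent positive.
    refine ⟨g ^ (n + l + 1), ⟨g • ((⟨Q, hQ⟩ : symPow _ _ r) ⊗ₜ ν), ?_⟩, by
      rw [Scheme.basicOpen_pow _ _ (Nat.succ_pos _), hg]; exact hxV⟩
    rw [twistEval_smul, twistEval_tmul]
    dsimp only
    rw [← ρ.eval_symMap hV Q, ← hPQ, map_mul, eval_symMap, ← hφ', map_pow, eval_algebraMap,
      AffOpen.toRat_res, map_pow, map_pow, pow_succ', pow_add, ← map_pow ρ.κ (U.toRat g) l, ← hν,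
      map_mul]
    ring
  obtain ⟨z, hz⟩ := h1
  exact ⟨z, by rw [hz, map_one, map_one, one_mul]⟩

/-- The value of a global section. -/
lemma twistEval_eq_of_mem {s : ∀ U, SymTwist F r D U} (hs : s ∈ globalSymTwist F r D)
    (U V : AffOpen X) : ρ.twistEval r D U (s U) = ρ.twistEval r D V (s V) := by
  obtain ⟨V', hU, hV, -⟩ := exists_affOpen_le_le U V (genericPoint X) U.genericPoint_mem
    V.genericPoint_mem
  rw [← ρ.twistEval_map hU, ← ρ.twistEval_map hV, hs V' U hU, hs V' V hV]

/-- Sections with value φ exist over every affine open set; they are compatible because a section is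
determined by its value. -/
lemma exists_globalSymTwist [F.IsQuasiCoherent] [F.IsLocallyFree] [ρ.IsFaithful] (φ : E)
    (h : ∀ x : X, ∃ (V : AffOpen X) (f : (RatFun X)ˣ), x ∈ V.toOpens ∧
      (∀ y ∈ V.toOpens, D.IsEquationAt y f) ∧
      ∃ P ∈ symPow Γ(X, V.toOpens) (F.Sec V) r, φ * ρ.κ f = ρ.eval V P) :
    ∃ s ∈ globalSymTwist F r D, ∀ U, ρ.twistEval r D U (s U) = φ := by
  choose s hs using fun U : AffOpen X => ρ.exists_twistEval_eq U φ fun x _ => h x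
  refine ⟨s, fun V U hV => ?_, hs⟩
  rw [← sub_eq_zero]
  refine ρ.eq_zero_of_twistEval_eq_zero V ?_
  rw [map_sub, twistEval_map, hs, hs, sub_self]

end RatSheaf.Realization

end Realization

/-! ### Points of Proj(Sym M). -/

section ProjGeneral

variable {R M : Type} [CommRing R] [AddCommGroup M] [Module R M]

/-- `Proj (Sym_R M)` is covered by the open sets `m ≠ 0`, `m ∈ M`. -/
lemma exists_mem_basicOpen_ι (z : symProj R M) :
    ∃ m : M, z ∈ Proj.basicOpen (symPow R M) (SymmetricAlgebra.ι R M m) := by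
  by_contra! h
  refine z.not_irrelevant_le ?_
  rw [HomogeneousIdeal.irrelevant_le]
  intro i hi x hx
  obtain ⟨j, rfl⟩ : ∃ j, i = j + 1 := ⟨i - 1, by omega⟩
  change x ∈ LinearMap.range (SymmetricAlgebra.ι R M) ^ (j + 1) at hx
  rw [pow_succ] at hx
  induction hx using Submodule.mul_induction_on' with
  | mem_mul_mem a _ b hb =>
    obtain ⟨m, rfl⟩ := hb
    exact Ideal.mul_mem_left _ _ (not_not.mp ((Proj.mem_basicOpen _ _ _).not.mp (h m)))
  | add x _ y _ hx hy => exact add_mem hx hy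

lemma isDomain_away [IsDomain (SymmetricAlgebra R M)] {f : SymmetricAlgebra R M} (hf : f ≠ 0) :
    IsDomain (HomogeneousLocalization.Away (symPow R M) f) := by
  have : IsDomain (Localization (Submonoid.powers f)) :=
    IsLocalization.isDomain_localization (powers_le_nonZeroDivisors_of_noZeroDivisors hf)
  exact (HomogeneousLocalization.val_injective (𝒜 := symPow R M) (Submonoid.powers f)).isDomain
    (algebraMap (HomogeneousLocalization.Away (symPow R M) f) (Localization (Submonoid.powers f)))

lemma exists_mem_basicOpen [IsDomain (SymmetricAlgebra R M)] {f : SymmetricAlgebra R M}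
    (hf : f ≠ 0) {d : ℕ} (hd : 0 < d) (hfd : f ∈ symPow R M d) :
    ∃ z : symProj R M, z ∈ Proj.basicOpen (symPow R M) f := by
  have := isDomain_away hf
  have z : Spec (.of (HomogeneousLocalization.Away (symPow R M) f)) := genericPoint _
  refine ⟨Proj.awayι (symPow R M) f hfd hd z, ?_⟩
  rw [← Proj.opensRange_awayι (symPow R M) f hfd hd]
  exact ⟨z, rfl⟩

end ProjGeneral

/-! ### Charts of a relative gluing. -/

section Gluing

variable {S : Scheme.{0}} {𝒰 : S.OpenCover} [Category 𝒰.I₀] [𝒰.LocallyDirected]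
  (d : 𝒰.RelativeGluingData) [Small.{0} 𝒰.I₀] [Quiver.IsThin 𝒰.I₀]

lemma gluing_isOpenImmersion (i : 𝒰.I₀) : IsOpenImmersion (d.cover.f i) :=
  d.cover.map_prop i

lemma gluing_map_cover {i j : 𝒰.I₀} (h : i ⟶ j) :
    d.functor.map h ≫ d.cover.f j = d.cover.f i :=
  Limits.colimit.w d.functor h

lemma gluing_preimage (i : 𝒰.I₀) :
    d.toBase ⁻¹' (Set.range (𝒰.f i)) = Set.range (d.cover.f i) :=
  d.preimage_toBase_eq_range_ι i

end Gluing

/-! ### P(F) is integral and dominates X. -/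

section Projectivization

variable {X : Scheme.{0}} [IsIntegral X] {W : Type} [AddCommGroup W] [Module (RatFun X) W]
  (F : RatSheaf X W) [F.IsQuasiCoherent]

instance (U : AffOpen X) : IsOpenImmersion (projectivizationChart F U) :=
  gluing_isOpenImmersion (projGluing F) U

lemma projectivizationChart_map (U : AffOpen X) :
    projectivizationChart F U ≫ projectivizationMap F =
      symProjToSpec Γ(X, U.toOpens) (F.Sec U) ≫ U.2.1.fromSpec :=
  (projGluing F).ι_toBase U

lemma symProjMap_chart {V U : AffOpen X} (h : V ≤ U) :
    symProjMap (F.res h) (F.span_res h) ≫ projectivizationChart F U =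
      projectivizationChart F V :=
  gluing_map_cover (projGluing F) (homOfLE h)

variable {F}

lemma RatSheaf.res_ne_zero {V U : AffOpen X} (h : V ≤ U) {m : F.Sec U} (hm : m ≠ 0) :
    F.res h m ≠ 0 := fun h' =>
  hm (Subtype.ext ((F.coe_res h m).symm.trans (congrArg Subtype.val h')))

lemma projectivizationMap_chart_mem {U : AffOpen X} (z : symProj Γ(X, U.toOpens) (F.Sec U)) :
    projectivizationMap F (projectivizationChart F U z) ∈ U.toOpens := by
  rw [← Scheme.Hom.comp_apply, projectivizationChart_map, Scheme.Hom.comp_apply, U.mem_iff]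
  exact ⟨_, rfl⟩

lemma exists_chart_eq {U : AffOpen X} {y : projectivization F}
    (hy : projectivizationMap F y ∈ U.toOpens) : ∃ z, projectivizationChart F U z = y := by
  have h' : y ∈ (projGluing F).toBase ⁻¹' (Set.range ((affCover X).f U)) := (U.mem_iff _).mp hy
  rw [gluing_preimage] at h'
  exact h'

lemma exists_chart_basicOpen_eq {U : AffOpen X} {y : projectivization F}
    (hy : projectivizationMap F y ∈ U.toOpens) : ∃ (m : F.Sec U)
      (z : symProj Γ(X, U.toOpens) (F.Sec U)), projectivizationChart F U z = y ∧
      z ∈ Proj.basicOpen (symPow Γ(X, U.toOpens) (F.Sec U)) (SymmetricAlgebra.ι _ _ m) := by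
  obtain ⟨z, hz⟩ := exists_chart_eq hy
  obtain ⟨m, hm⟩ := exists_mem_basicOpen_ι z
  exact ⟨m, z, hz, hm⟩

lemma exists_affOpen_map_mem (y : projectivization F) :
    ∃ U : AffOpen X, projectivizationMap F y ∈ U.toOpens := by
  obtain ⟨U, hU, -⟩ := exists_affOpen_mem ⊤ (projectivizationMap F y) trivial
  exact ⟨U, hU⟩

lemma RatSheaf.IsFreeOn.isDomain {V : AffOpen X} {n : ℕ} {e : Fin n → W} (he : F.IsFreeOn V e) :
    IsDomain (SymmetricAlgebra Γ(X, V.toOpens) (F.Sec V)) :=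
  have : Module.Free Γ(X, V.toOpens) (F.Sec V) := .of_basis he.basis
  inferInstance

lemma ι_ne_zero {V : AffOpen X} {n : ℕ} {e : Fin n → W} (he : F.IsFreeOn V e) {m : F.Sec V}
    (hm : m ≠ 0) : SymmetricAlgebra.ι Γ(X, V.toOpens) (F.Sec V) m ≠ 0 := by
  intro h
  obtain ⟨i, hi⟩ : ∃ i, he.basis.repr m i ≠ 0 := by
    by_contra! h0
    exact hm (he.basis.repr.injective (by ext i; simpa using h0 i))
  have h1 : SymmetricAlgebra.equivMvPolynomial he.basis (SymmetricAlgebra.ι _ _ m) =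
      ∑ i, MvPolynomial.C (he.basis.repr m i) * MvPolynomial.X i := by
    conv_lhs => rw [← he.basis.sum_repr m]
    rw [map_sum, map_sum]
    refine Finset.sum_congr rfl fun i _ => ?_
    rw [map_smul, map_smul, SymmetricAlgebra.equivMvPolynomial_ι_apply, MvPolynomial.smul_eq_C_mul]
  rw [h, map_zero] at h1
  have h2 := congrArg (MvPolynomial.coeff (Finsupp.single i 1)) h1
  rw [MvPolynomial.coeff_zero, MvPolynomial.coeff_sum, Finset.sum_eq_single i] at h2
  · rw [MvPolynomial.coeff_C_mul, MvPolynomial.coeff_X, if_pos rfl, mul_one] at h2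
    exact hi h2.symm
  · intro j _ hj
    rw [MvPolynomial.coeff_C_mul, MvPolynomial.coeff_X, if_neg, mul_zero]
    exact fun h => hj (Finsupp.single_left_injective one_ne_zero h)
  · simp

/-- Over a free chart Sym is a domain, so the product of the two linear forms is a nonzero form of
degree 2 and is nonzero at some point. This is the irreducibility of P(F). -/
lemma exists_mem_basicOpen_inf {U : AffOpen X} [F.IsLocallyFree] {m m' : F.Sec U} (hm : m ≠ 0)
    (hm' : m' ≠ 0) : ∃ z : symProj Γ(X, U.toOpens) (F.Sec U),
      z ∈ Proj.basicOpen (symPow Γ(X, U.toOpens) (F.Sec U)) (SymmetricAlgebra.ι _ _ m) ∧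
      z ∈ Proj.basicOpen (symPow Γ(X, U.toOpens) (F.Sec U)) (SymmetricAlgebra.ι _ _ m') := by
  obtain ⟨V, n, hn, e, hV, -, he⟩ := F.exists_free U U.genericPoint_mem
  have := he.isDomain
  obtain ⟨z, hz⟩ := exists_mem_basicOpen
    (mul_ne_zero (ι_ne_zero he (RatSheaf.res_ne_zero hV hm)) (ι_ne_zero he (RatSheaf.res_ne_zero hV hm'))) two_pos
    (SetLike.mul_mem_graded (ι_mem_symPow _ (F.res hV m)) (ι_mem_symPow _ (F.res hV m')))
  rw [Proj.basicOpen_mul] at hz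
  rw [← symMap_ι, ← symMap_ι] at hz
  exact ⟨symProjMap (F.res hV) (F.span_res hV) z, hz.1, hz.2⟩

lemma exists_mem_basicOpen_of_ne_zero {U : AffOpen X} [F.IsLocallyFree] {m : F.Sec U}
    (hm : m ≠ 0) : ∃ z : symProj Γ(X, U.toOpens) (F.Sec U),
      z ∈ Proj.basicOpen (symPow Γ(X, U.toOpens) (F.Sec U)) (SymmetricAlgebra.ι _ _ m) := by
  obtain ⟨z, hz, -⟩ := exists_mem_basicOpen_inf hm hm
  exact ⟨z, hz⟩

lemma ne_zero_of_mem_basicOpen {U : AffOpen X} {m : F.Sec U}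
    {z : symProj Γ(X, U.toOpens) (F.Sec U)}
    (hz : z ∈ Proj.basicOpen (symPow Γ(X, U.toOpens) (F.Sec U)) (SymmetricAlgebra.ι _ _ m)) :
    m ≠ 0 := by
  rintro rfl
  rw [map_zero, Proj.basicOpen_zero] at hz
  exact hz

variable (F) in
-- A basis vector over a smaller D(g), multiplied by a power of g, extends to U. Positivity of the
-- rank is what provides the basis vector.
lemma exists_sec_ne_zero [F.IsLocallyFree] (U : AffOpen X) : ∃ m : F.Sec U, m ≠ 0 := by
  obtain ⟨V, n, hn, e, hV, -, he⟩ := F.exists_free U U.genericPoint_mem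
  obtain ⟨g, hg⟩ := id hV
  obtain ⟨k, hk⟩ := RatSheaf.IsQuasiCoherent.exists_pow (F := F) V U g hg _ (he.mem ⟨0, hn⟩)
  refine ⟨⟨_, hk⟩, fun h => ?_⟩
  have h0 := (smul_eq_zero.mp (congrArg Subtype.val h)).resolve_right (he.indep.ne_zero _)
  have h4 : U.toRat g = 0 := eq_zero_of_pow_eq_zero h0
  rw [← map_zero U.toRat] at h4
  rw [U.toRat_injective h4, Scheme.basicOpen_zero] at hg
  have := V.genericPoint_mem
  rw [← hg] at this
  exact this

/-- The chart `m ≠ 0` of `P(F)`. -/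
def affineChart {U : AffOpen X} (m : F.Sec U) :
    Spec (.of (HomogeneousLocalization.Away (symPow Γ(X, U.toOpens) (F.Sec U))
      (SymmetricAlgebra.ι _ _ m))) ⟶ projectivization F :=
  Proj.awayι _ _ (ι_mem_symPow _ m) one_pos ≫ projectivizationChart F U

instance {U : AffOpen X} (m : F.Sec U) : IsOpenImmersion (affineChart m) := by
  unfold affineChart; infer_instance

lemma mem_opensRange_affineChart {U : AffOpen X} {m : F.Sec U} {y : projectivization F} :
    y ∈ (affineChart m).opensRange ↔ ∃ z, projectivizationChart F U z = y ∧
      z ∈ Proj.basicOpen (symPow Γ(X, U.toOpens) (F.Sec U)) (SymmetricAlgebra.ι _ _ m) := by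
  rw [← Proj.opensRange_awayι _ _ (ι_mem_symPow _ m) one_pos]
  constructor
  · rintro ⟨w, rfl⟩
    exact ⟨_, (Scheme.Hom.comp_apply ..).symm, w, rfl⟩
  · rintro ⟨_, rfl, w, rfl⟩
    exact ⟨w, Scheme.Hom.comp_apply ..⟩

/-- The indices of the charts that are spectra of domains. -/
structure GoodChart (F : RatSheaf X W) where
  /-- the open set -/
  U : AffOpen X
  /-- the section -/
  m : F.Sec U
  ne_zero : m ≠ 0
  isDomain : IsDomain (HomogeneousLocalization.Away (symPow Γ(X, U.toOpens) (F.Sec U))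
      (SymmetricAlgebra.ι _ _ m))

lemma exists_goodChart [F.IsLocallyFree] (y : projectivization F) :
    ∃ c : GoodChart F, y ∈ (affineChart c.m).opensRange := by
  obtain ⟨U, hU⟩ := exists_affOpen_map_mem y
  obtain ⟨V, n, hn, e, hV, hxV, he⟩ := F.exists_free U hU
  obtain ⟨m, z, hz, hzm⟩ := exists_chart_basicOpen_eq hxV
  have := he.isDomain
  have hm := ne_zero_of_mem_basicOpen hzm
  exact ⟨⟨V, m, hm, isDomain_away (ι_ne_zero he hm)⟩, mem_opensRange_affineChart.mpr ⟨z, hz, hzm⟩⟩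

lemma nonempty_projectivization [F.IsLocallyFree] (U : AffOpen X) :
    Nonempty (symProj Γ(X, U.toOpens) (F.Sec U)) := by
  obtain ⟨m, hm⟩ := exists_sec_ne_zero F U
  exact ⟨(exists_mem_basicOpen_of_ne_zero hm).choose⟩

/-- Charts that are spectra of domains cover P(F), so its stalks are reduced. Any two of them meet:
over a common smaller affine set their linear forms stay nonzero, and `exists_mem_basicOpen_inf`
gives a common point. -/
instance [F.IsLocallyFree] : IsIntegral (projectivization F) := by
  have hred : IsReduced (projectivization F) := by
    have (y : projectivization F) :
        _root_.IsReduced ((projectivization F).presheaf.stalk y) := by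
      obtain ⟨c, w, rfl⟩ := exists_goodChart y
      have := c.isDomain
      have : IsReduced (Spec (.of (HomogeneousLocalization.Away
        (symPow Γ(X, c.U.toOpens) (F.Sec c.U)) (SymmetricAlgebra.ι _ _ c.m)))) := inferInstance
      exact isReduced_of_injective ((affineChart c.m).stalkMap w).hom
        (ConcreteCategory.bijective_of_isIso ((affineChart c.m).stalkMap w)).1
    exact isReduced_of_isReduced_stalk _
  have hpre : PreirreducibleSpace (projectivization F) := by
    refine PreirreducibleSpace.of_isOpenCover
      (U := fun c : GoodChart F => (affineChart c.m).opensRange) ?_ ?_ ?_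
    · intro c c' _ hd
      obtain ⟨V, hV, hV', -⟩ := exists_affOpen_le_le c.U c'.U (genericPoint X)
        c.U.genericPoint_mem c'.U.genericPoint_mem
      obtain ⟨z, hz, hz'⟩ := exists_mem_basicOpen_inf
        (RatSheaf.res_ne_zero hV c.ne_zero) (RatSheaf.res_ne_zero hV' c'.ne_zero)
      rw [← symMap_ι] at hz hz'
      have h2 : projectivizationChart F V z ∈ (affineChart c.m).opensRange ⊓
          (affineChart c'.m).opensRange := by
        refine ⟨mem_opensRange_affineChart.mpr ⟨symProjMap (F.res hV) (F.span_res hV) z, ?_, hz⟩,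
          mem_opensRange_affineChart.mpr ⟨symProjMap (F.res hV') (F.span_res hV') z, ?_, hz'⟩⟩
        · rw [← Scheme.Hom.comp_apply, symProjMap_chart]
        · rw [← Scheme.Hom.comp_apply, symProjMap_chart]
      rw [disjoint_iff.mp hd] at h2
      exact h2
    · rw [IsOpenCover, eq_top_iff]
      intro y _
      rw [TopologicalSpace.Opens.mem_iSup]
      exact exists_goodChart y
    · intro c
      have := c.isDomain
      have h : IsPreirreducible (Set.range (affineChart c.m)) := by
        rw [← Set.image_univ]
        exact (PreirreducibleSpace.isPreirreducible_univ).image _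
          (affineChart c.m).continuous.continuousOn
      exact Subtype.preirreducibleSpace h
  have : Nonempty (projectivization F) := by
    obtain ⟨U, hU, -⟩ := exists_affOpen_mem ⊤ (genericPoint X) trivial
    exact ⟨projectivizationChart F U (nonempty_projectivization U).some⟩
  have : IrreducibleSpace (projectivization F) := ⟨inferInstance⟩
  exact isIntegral_of_irreducibleSpace_of_isReduced _

instance [F.IsLocallyFree] : IsDominant (projectivizationMap F) := by
  refine ⟨?_⟩
  intro x
  rw [mem_closure_iff]
  intro O hO hx
  obtain ⟨U, hU, hUO⟩ := exists_affOpen_mem ⟨O, hO⟩ x hx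
  exact ⟨_, hUO (projectivizationMap_chart_mem (nonempty_projectivization (F := F) U).some), _, rfl⟩

instance [F.IsLocallyFree] (U : AffOpen X) :
    IsIntegral (symProj Γ(X, U.toOpens) (F.Sec U)) :=
  have := nonempty_projectivization (F := F) U
  isIntegral_of_isOpenImmersion (projectivizationChart F U)

instance [F.IsLocallyFree] (U : AffOpen X) : IsDominant (projectivizationChart F U) := by
  have := nonempty_projectivization (F := F) U
  exact ⟨(projectivizationChart F U).isOpenEmbedding.isOpen_range.dense (Set.range_nonempty _)⟩

end Projectivization

/-! ### Rational functions on Proj(Sym M) as functions on the affine cone. -/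

section ProjFunctions

variable {R M : Type} [CommRing R] [AddCommGroup M] [Module R M]

lemma symProj_fromSpec_eq {d : ℕ} (hd : 0 < d) {f : SymmetricAlgebra R M}
    (hf : f ∈ symPow R M d) :
    (Proj.isAffineOpen_basicOpen (symPow R M) f hf hd).fromSpec =
      Spec.map (Proj.awayToSection (symPow R M) f) ≫ Proj.awayι (symPow R M) f hf hd := by
  rw [← cancel_epi (Proj.isAffineOpen_basicOpen (symPow R M) f hf hd).isoSpec.hom,
    IsAffineOpen.isoSpec_hom_fromSpec, IsAffineOpen.isoSpec_hom]
  rw [← Category.assoc]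
  change _ = Proj.basicOpenToSpec (symPow R M) f ≫ _
  rw [← Proj.basicOpenIsoSpec_hom (symPow R M) f hf hd, ← Proj.basicOpenIsoSpec_inv_ι,
    Iso.hom_inv_id_assoc]

variable [IsIntegral (symProj R M)]

variable (R M) in
/-- The generic point of `Proj (Sym_R M)`. -/
abbrev symProjGeneric : ProjectiveSpectrum (symPow R M) := genericPoint (symProj R M)

variable (R M) in
/-- The local ring of the affine cone at the generic point of `Proj (Sym_R M)`. -/
abbrev ConeRing : Type :=
  Localization (symProjGeneric R M).asHomogeneousIdeal.toIdeal.primeCompl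

/-- Rational functions on `Proj (Sym_R M)`, as functions on the affine cone. -/
def valRat : RatFun (symProj R M) →+* ConeRing R M :=
  (algebraMap (HomogeneousLocalization.AtPrime (symPow R M)
    (symProjGeneric R M).asHomogeneousIdeal.toIdeal) (ConeRing R M)).comp
      (Proj.stalkIso' (symPow R M) (genericPoint (symProj R M))).toRingHom

lemma valRat_injective : Function.Injective (valRat (R := R) (M := M)) :=
  (HomogeneousLocalization.val_injective _).comp (RingEquiv.injective _)

/-- The map from the symmetric algebra to the ring of functions on the affine cone. -/
abbrev coneMap : SymmetricAlgebra R M →+* ConeRing R M := algebraMap _ _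

lemma isUnit_coneMap {f : SymmetricAlgebra R M}
    (h : genericPoint (symProj R M) ∈ Proj.basicOpen (symPow R M) f) : IsUnit (coneMap f) :=
  IsLocalization.map_units (ConeRing R M) (⟨f, h⟩ : (symProjGeneric R M).asHomogeneousIdeal.toIdeal.primeCompl)

lemma coneMap_injective [IsDomain (SymmetricAlgebra R M)] :
    Function.Injective (coneMap (R := R) (M := M)) :=
  IsLocalization.injective _ (Ideal.primeCompl_le_nonZeroDivisors
    (symProjGeneric R M).asHomogeneousIdeal.toIdeal)

/-- In the cone ring f itself is invertible, although it is not a function on Proj. Identities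
between fractions on Proj thus become equations between polynomials. -/
lemma valRat_away {d : ℕ} {f : SymmetricAlgebra R M} (hf : f ∈ symPow R M d)
    (h : genericPoint (symProj R M) ∈ Proj.basicOpen (symPow R M) f) (k : ℕ)
    (P : SymmetricAlgebra R M) (hP : P ∈ symPow R M (k • d)) :
    valRat (germRat _ h ((Proj.awayToSection (symPow R M) f).hom
      (HomogeneousLocalization.Away.mk (symPow R M) hf k P hP))) * coneMap f ^ k =
      coneMap P := by
  have h1 : valRat (germRat _ h ((Proj.awayToSection (symPow R M) f).hom
      (HomogeneousLocalization.Away.mk (symPow R M) hf k P hP))) =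
      HomogeneousLocalization.val (((Proj.awayToSection (symPow R M) f).hom
        (HomogeneousLocalization.Away.mk (symPow R M) hf k P hP)).1 ⟨_, h⟩) :=
    congrArg HomogeneousLocalization.val (Proj.stalkIso'_germ (symPow R M) _ _ h _)
  rw [h1]
  have h2 := ProjectiveSpectrum.Proj.awayToSection_apply (symPow R M) f
    (HomogeneousLocalization.Away.mk (symPow R M) hf k P hP) ⟨_, h⟩
  refine (congrArg (· * _) h2).trans ?_
  rw [HomogeneousLocalization.Away.val_mk, Localization.mk_eq_mk', IsLocalization.map_mk',
    RingHom.id_apply, ← map_pow]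
  exact IsLocalization.mk'_spec _ _ _

lemma valRat_symFraction {m' m : M} (h : genericPoint (symProj R M) ∈
    Proj.basicOpen (symPow R M) (SymmetricAlgebra.ι R M m)) :
    valRat (germRat _ h (symFraction m' m)) * coneMap (SymmetricAlgebra.ι R M m) =
      coneMap (SymmetricAlgebra.ι R M m') := by
  have := valRat_away (ι_mem_symPow R m) h 1 (SymmetricAlgebra.ι R M m')
    (by simpa using ι_mem_symPow R m')
  rwa [pow_one] at this

/-- Functions on the open set `f ≠ 0` are quotients `P / f ^ k`. -/
lemma exists_valRat_mul_eq {d : ℕ} (hd : 0 < d) {f : SymmetricAlgebra R M}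
    (hf : f ∈ symPow R M d) (h : genericPoint (symProj R M) ∈ Proj.basicOpen (symPow R M) f)
    {φ : RatFun (symProj R M)}
    (hφ : ∀ z ∈ Proj.basicOpen (symPow R M) f, φ ∈ localRing (symProj R M) z) :
    ∃ (k : ℕ) (P : SymmetricAlgebra R M), P ∈ symPow R M (k • d) ∧
      valRat φ * coneMap f ^ k = coneMap P := by
  obtain ⟨s, rfl⟩ := mem_range_germRat _ h hφ
  have : IsIso (Proj.awayToSection (symPow R M) f) := by
    rw [← Proj.basicOpenIsoAway_hom (symPow R M) f hf hd]; infer_instance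
  obtain ⟨a, rfl⟩ := (ConcreteCategory.bijective_of_isIso (Proj.awayToSection (symPow R M) f)).2 s
  obtain ⟨k, P, hP, rfl⟩ := HomogeneousLocalization.Away.mk_surjective (symPow R M) hf a
  exact ⟨k, P, hP, valRat_away hf h k P hP⟩

lemma mem_localRing_of_valRat {d : ℕ} {f : SymmetricAlgebra R M}
    (hf : f ∈ symPow R M d) {z : symProj R M} (hz : z ∈ Proj.basicOpen (symPow R M) f)
    {φ : RatFun (symProj R M)} {k : ℕ} {P : SymmetricAlgebra R M} (hP : P ∈ symPow R M (k • d))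
    (h : valRat φ * coneMap f ^ k = coneMap P) : φ ∈ localRing (symProj R M) z := by
  have hg := genericPoint_mem hz
  have h1 := valRat_away hf hg k P hP
  rw [← h] at h1
  rw [← valRat_injective ((isUnit_coneMap hg).pow k |>.mul_right_cancel h1)]
  exact germRat_mem_localRing _ _ _ hz

variable {X : Scheme.{0}} [IsIntegral X]

lemma germRat_appLE {Y : Scheme.{0}} [IsIntegral Y] (g : Y ⟶ X) [IsDominant g] (O : X.Opens)
    (h : genericPoint X ∈ O) (O' : Y.Opens) (h' : genericPoint Y ∈ O') (e : O' ≤ g ⁻¹ᵁ O)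
    (a : Γ(X, O)) :
    pullbackFunction g (germRat O h a) = germRat O' h' ((g.appLE O O' e).hom a) := by
  rw [pullbackFunction_germRat g O h (e h')]
  exact (germRat_res (homOfLE e) h' _).symm

lemma fromZero_toSymZero {f : SymmetricAlgebra R M} (hf : f ∈ symPow R M 1) (a : R) :
    ((HomogeneousLocalization.fromZeroRingHom (symPow R M) (.powers f)).comp (toSymZero R M)) a =
      HomogeneousLocalization.Away.mk (symPow R M) hf 0 (algebraMap _ _ a)
        (by rw [zero_smul]; exact (toSymZero R M a).2) := by
  apply HomogeneousLocalization.val_injective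
  rw [HomogeneousLocalization.Away.val_mk]
  change HomogeneousLocalization.val (HomogeneousLocalization.mk _) = _
  rw [HomogeneousLocalization.val_mk]
  congr 1
  ext
  simp

lemma symProjToSpec_preimage (U : AffOpen X) (N : Type) [AddCommGroup N] [Module Γ(X, U.toOpens) N]
    (O : (symProj Γ(X, U.toOpens) N).Opens) :
    O ≤ (symProjToSpec Γ(X, U.toOpens) N ≫ U.2.1.fromSpec) ⁻¹ᵁ U.toOpens := by
  intro z _
  change (symProjToSpec Γ(X, U.toOpens) N ≫ U.2.1.fromSpec) z ∈ U.toOpens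
  rw [Scheme.Hom.comp_apply, U.mem_iff]
  exact ⟨_, rfl⟩

lemma symProjToSpec_appLE (U : AffOpen X) {N : Type} [AddCommGroup N] [Module Γ(X, U.toOpens) N]
    {f : SymmetricAlgebra Γ(X, U.toOpens) N} (hf : f ∈ symPow Γ(X, U.toOpens) N 1) :
    (symProjToSpec Γ(X, U.toOpens) N ≫ U.2.1.fromSpec).appLE U.toOpens
      (Proj.basicOpen (symPow Γ(X, U.toOpens) N) f) (symProjToSpec_preimage U N _) =
      CommRingCat.ofHom ((HomogeneousLocalization.fromZeroRingHom
        (symPow Γ(X, U.toOpens) N) _).comp (toSymZero Γ(X, U.toOpens) N)) ≫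
        Proj.awayToSection (symPow Γ(X, U.toOpens) N) f := by
  apply Spec.map_injective
  rw [← cancel_mono U.2.1.fromSpec, IsAffineOpen.SpecMap_appLE_fromSpec _ U.2.1
    (Proj.isAffineOpen_basicOpen _ _ hf one_pos), Spec.map_comp,
    symProj_fromSpec_eq one_pos hf, Category.assoc, Category.assoc]
  congr 1
  rw [← Category.assoc, awayι_symProjToSpec one_pos]

lemma valRat_fromZero {f : SymmetricAlgebra R M} (hf : f ∈ symPow R M 1)
    (h : genericPoint (symProj R M) ∈ Proj.basicOpen (symPow R M) f) (a : R) :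
    valRat (germRat _ h ((Proj.awayToSection (symPow R M) f).hom
      (((HomogeneousLocalization.fromZeroRingHom (symPow R M) (.powers f)).comp
        (toSymZero R M)) a))) = coneMap (algebraMap _ _ a) := by
  have h2 := valRat_away hf h 0 (algebraMap R (SymmetricAlgebra R M) a)
    (by rw [zero_smul]; exact (toSymZero R M a).2)
  rw [pow_zero, mul_one, ← fromZero_toSymZero] at h2
  exact h2

/-- It suffices to look at one chart m ≠ 0, where the projection corresponds to the inclusion of
Γ(U) as fractions of degree 0 with denominator 1. -/
lemma valRat_pullback (U : AffOpen X) {N : Type} [AddCommGroup N] [Module Γ(X, U.toOpens) N]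
    [IsIntegral (symProj Γ(X, U.toOpens) N)]
    [IsDominant (symProjToSpec Γ(X, U.toOpens) N ≫ U.2.1.fromSpec)] (a : Γ(X, U.toOpens)) :
    valRat (pullbackFunction (symProjToSpec Γ(X, U.toOpens) N ≫ U.2.1.fromSpec) (U.toRat a)) =
      coneMap (algebraMap _ _ a) := by
  obtain ⟨m, hm⟩ := exists_mem_basicOpen_ι (genericPoint (symProj Γ(X, U.toOpens) N))
  rw [AffOpen.toRat_eq, germRat_appLE _ _ _ _ hm (symProjToSpec_preimage U N _),
    symProjToSpec_appLE U (ι_mem_symPow _ m)]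
  exact valRat_fromZero (ι_mem_symPow _ m) hm a

/-- A germ is determined by its image in the cone ring, since the local ring embeds in the function
field and that embeds in the cone ring. This removes stalks from the condition in `IsTautological`.
-/
lemma eq_germ_symFraction_iff {m m' : M} {z : symProj R M}
    (hz : z ∈ Proj.basicOpen (symPow R M) (SymmetricAlgebra.ι R M m))
    (t : (symProj R M).presheaf.stalk z) :
    t = (symProj R M).presheaf.germ _ z hz (symFraction m' m) ↔
      valRat (stalkToRat _ z t) * coneMap (SymmetricAlgebra.ι R M m) =
        coneMap (SymmetricAlgebra.ι R M m') := by
  constructor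
  · rintro rfl
    rw [stalkToRat_germ, valRat_symFraction]
  · intro h
    have h2 := valRat_symFraction (m' := m') (genericPoint_mem hz)
    rw [← h, ← stalkToRat_germ _ z hz] at h2
    have hinj : Function.Injective (stalkToRat (symProj R M) z) :=
      IsFractionRing.injective _ (symProj R M).functionField
    exact (hinj (valRat_injective ((isUnit_coneMap (genericPoint_mem hz)).mul_right_cancel h2))).symm

lemma valRat_pullback_symFraction {S N : Type} [CommRing S] [AddCommGroup N] [Module S N]
    {ρ : R →+* S} (φ : M →ₛₗ[ρ] N) (hφ : Submodule.span S (Set.range φ) = ⊤)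
    [IsIntegral (symProj S N)] [IsDominant (symProjMap φ hφ)] {m m' : M}
    (h : genericPoint (symProj R M) ∈ Proj.basicOpen (symPow R M) (SymmetricAlgebra.ι R M m)) :
    valRat (pullbackFunction (symProjMap φ hφ) (germRat _ h (symFraction m' m))) *
      coneMap (SymmetricAlgebra.ι S N (φ m)) = coneMap (SymmetricAlgebra.ι S N (φ m')) := by
  have h0 : genericPoint (symProj S N) ∈ Proj.basicOpen (symPow S N)
      (symMapGraded φ (SymmetricAlgebra.ι R M m)) := genericPoint_mem_preimage (symProjMap φ hφ) h
  rw [germRat_appLE (symProjMap φ hφ) _ h _ h0 le_rfl]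
  have h3 := congrArg (fun f => f.hom (HomogeneousLocalization.Away.mk
      (symPow R M) (ι_mem_symPow _ m) 1
      (SymmetricAlgebra.ι _ _ m') (by simpa using ι_mem_symPow _ m')))
    (Proj.awayToSection_comp_appLE (symMapGraded φ) (irrelevant_le_of_span _ hφ)
      (ι_mem_symPow _ m))
  change (Scheme.Hom.appLE _ _ _ _).hom (symFraction m' m) =
    (Proj.awayToSection _ _).hom (HomogeneousLocalization.Away.map _ _ _) at h3
  rw [HomogeneousLocalization.Away.map_mk] at h3
  rw [h3]
  have h4 := valRat_away (symMap_mem φ (ι_mem_symPow _ m)) h0 1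
    (symMap φ (SymmetricAlgebra.ι _ _ m'))
    (symMap_mem φ (by simpa using ι_mem_symPow _ m'))
  rw [pow_one] at h4
  rw [← symMap_ι, ← symMap_ι]
  exact h4

end ProjFunctions

/-! ### Rational functions on P(F) seen in a chart. -/

section ChartFunctions

variable {X : Scheme.{0}} [IsIntegral X] {W : Type} [AddCommGroup W] [Module (RatFun X) W]
  (F : RatSheaf X W) [F.IsQuasiCoherent] [F.IsLocallyFree]

/-- Rational functions on `P(F)`, as functions on the affine cone. -/
def chartVal (U : AffOpen X) :
    RatFun (projectivization F) →+* ConeRing Γ(X, U.toOpens) (F.Sec U) :=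
  valRat.comp (pullbackFunction (projectivizationChart F U))

variable {F}

lemma chartVal_injective (U : AffOpen X) : Function.Injective (chartVal F U) :=
  RingHom.injective _

instance (U : AffOpen X) :
    IsDominant (symProjToSpec Γ(X, U.toOpens) (F.Sec U) ≫ U.2.1.fromSpec) := by
  rw [← projectivizationChart_map]
  infer_instance

lemma chartVal_pullback (U : AffOpen X) (a : Γ(X, U.toOpens)) :
    chartVal F U (pullbackFunction (projectivizationMap F) (U.toRat a)) =
      coneMap (algebraMap _ _ a) := by
  rw [← valRat_pullback U a, chartVal, RingHom.comp_apply, ← pullbackFunction_comp]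
  congr 1
  exact pullbackFunction_congr (projectivizationChart_map F U) _

lemma exists_chartVal_mul_eq {U : AffOpen X} {m : F.Sec U} (hm : m ≠ 0)
    {φ : RatFun (projectivization F)}
    (hφ : ∀ z ∈ Proj.basicOpen (symPow Γ(X, U.toOpens) (F.Sec U)) (SymmetricAlgebra.ι _ _ m),
      φ ∈ localRing _ (projectivizationChart F U z)) :
    ∃ (k : ℕ) (P : SymmetricAlgebra Γ(X, U.toOpens) (F.Sec U)), P ∈ symPow _ _ k ∧
      chartVal F U φ * coneMap (SymmetricAlgebra.ι _ _ m) ^ k = coneMap P := by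
  obtain ⟨z, hz⟩ := exists_mem_basicOpen_of_ne_zero hm
  obtain ⟨k, P, hP, h⟩ := exists_valRat_mul_eq one_pos (ι_mem_symPow _ m) (genericPoint_mem hz)
    (φ := pullbackFunction (projectivizationChart F U) φ)
    fun z hz => pullbackFunction_mem _ (hφ z hz)
  exact ⟨k, P, by simpa using hP, h⟩

lemma mem_localRing_of_chartVal {U : AffOpen X} {m : F.Sec U}
    {z : symProj Γ(X, U.toOpens) (F.Sec U)}
    (hz : z ∈ Proj.basicOpen (symPow Γ(X, U.toOpens) (F.Sec U)) (SymmetricAlgebra.ι _ _ m))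
    {φ : RatFun (projectivization F)} {k : ℕ} {P : SymmetricAlgebra Γ(X, U.toOpens) (F.Sec U)}
    (hP : P ∈ symPow Γ(X, U.toOpens) (F.Sec U) k)
    (h : chartVal F U φ * coneMap (SymmetricAlgebra.ι _ _ m) ^ k = coneMap P) :
    φ ∈ localRing _ (projectivizationChart F U z) :=
  (pullbackFunction_mem_iff _).mp
    (mem_localRing_of_valRat (ι_mem_symPow _ m) hz (k := k) (P := P) (by simpa using hP) h)

lemma isUnit_coneMap_ι {U : AffOpen X} {m : F.Sec U} (hm : m ≠ 0) :
    IsUnit (coneMap (SymmetricAlgebra.ι Γ(X, U.toOpens) (F.Sec U) m)) := by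
  obtain ⟨z, hz⟩ := exists_mem_basicOpen_of_ne_zero hm
  exact isUnit_coneMap (genericPoint_mem hz)

/-- The rational function `m' / m` on `P(F)`. -/
lemma exists_fraction {U : AffOpen X} (m' : F.Sec U) {m : F.Sec U} (hm : m ≠ 0) :
    ∃ φ : RatFun (projectivization F), chartVal F U φ * coneMap (SymmetricAlgebra.ι _ _ m) =
      coneMap (SymmetricAlgebra.ι _ _ m') := by
  obtain ⟨z, hz⟩ := exists_mem_basicOpen_of_ne_zero hm
  obtain ⟨φ, hφ⟩ := (pullbackFunction_bijective (projectivizationChart F U)).2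
    (germRat _ (genericPoint_mem hz) (symFraction m' m))
  refine ⟨φ, ?_⟩
  rw [chartVal, RingHom.comp_apply, hφ, valRat_symFraction]

/-- Fractions do not depend on the chart. -/
lemma chartVal_res {V U : AffOpen X} (h : V ≤ U) {m' m : F.Sec U} (hm : m ≠ 0)
    {φ : RatFun (projectivization F)}
    (hφ : chartVal F U φ * coneMap (SymmetricAlgebra.ι _ _ m) =
      coneMap (SymmetricAlgebra.ι _ _ m')) :
    chartVal F V φ * coneMap (SymmetricAlgebra.ι _ _ (F.res h m)) =
      coneMap (SymmetricAlgebra.ι _ _ (F.res h m')) := by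
  obtain ⟨z, hz⟩ := exists_mem_basicOpen_of_ne_zero (RatSheaf.res_ne_zero h hm)
  have hz' : symProjMap (F.res h) (F.span_res h) z ∈
      Proj.basicOpen (symPow Γ(X, U.toOpens) (F.Sec U)) (SymmetricAlgebra.ι _ _ m) := by
    rw [← symMap_ι] at hz
    exact hz
  have h1 : pullbackFunction (projectivizationChart F U) φ =
      germRat _ (genericPoint_mem hz') (symFraction m' m) := by
    apply valRat_injective
    apply (isUnit_coneMap (genericPoint_mem hz')).mul_right_cancel
    rw [valRat_symFraction]
    exact hφ
  have hdom : IsDominant (symProjMap (F.res h) (F.span_res h)) := by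
    have : IsOpenImmersion (symProjMap (F.res h) (F.span_res h)) := by
      have : IsOpenImmersion (symProjMap (F.res h) (F.span_res h) ≫
        projectivizationChart F U) := by rw [symProjMap_chart]; infer_instance
      exact IsOpenImmersion.of_comp _ (projectivizationChart F U)
    have := nonempty_projectivization (F := F) V
    exact ⟨(symProjMap (F.res h) (F.span_res h)).isOpenEmbedding.isOpen_range.dense
      (Set.range_nonempty _)⟩
  have : IsDominant (symProjMap (F.res h) (F.span_res h) ≫ projectivizationChart F U) := by
    rw [symProjMap_chart]; infer_instance
  have h2 : pullbackFunction (projectivizationChart F V) φ =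
      pullbackFunction (symProjMap (F.res h) (F.span_res h))
        (pullbackFunction (projectivizationChart F U) φ) := by
    rw [← pullbackFunction_comp]
    exact pullbackFunction_congr (symProjMap_chart F h).symm _
  rw [chartVal, RingHom.comp_apply, h2, h1]
  exact valRat_pullback_symFraction (F.res h) (F.span_res h) (genericPoint_mem hz')

lemma stalkMap_eq_germ_iff {U : AffOpen X} {m m' : F.Sec U}
    {z : symProj Γ(X, U.toOpens) (F.Sec U)}
    (hz : z ∈ Proj.basicOpen (symPow Γ(X, U.toOpens) (F.Sec U)) (SymmetricAlgebra.ι _ _ m))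
    (t : (projectivization F).presheaf.stalk (projectivizationChart F U z)) :
    (projectivizationChart F U).stalkMap z t =
        (symProj Γ(X, U.toOpens) (F.Sec U)).presheaf.germ _ z hz (symFraction m' m) ↔
      chartVal F U (stalkToRat _ _ t) * coneMap (SymmetricAlgebra.ι _ _ m) =
      coneMap (SymmetricAlgebra.ι _ _ m') := by
  rw [eq_germ_symFraction_iff, chartVal, RingHom.comp_apply, pullbackFunction_stalkToRat]

end ChartFunctions

/-! ### The tautological divisor, and sections of O(rξ + π^*D) as forms of degree r. -/

section Tautological

variable {X : Scheme.{0}} [IsIntegral X] {W : Type} [AddCommGroup W] [Module (RatFun X) W]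
  {F : RatSheaf X W} [F.IsQuasiCoherent] [F.IsLocallyFree]

/-- `τ` is an embedding of `O(1)` into the constant sheaf of rational functions with image
`O(ξ)`. -/
structure IsTautologicalFor (ξ : CartierDivisor (projectivization F))
    (τ : W → RatFun (projectivization F)) : Prop where
  ne_zero : ∀ (U : AffOpen X) (m : F.Sec U), m ≠ 0 → τ m ≠ 0
  isEquationAt : ∀ (U : AffOpen X) (m : F.Sec U) (z : symProj Γ(X, U.toOpens) (F.Sec U)),
    z ∈ Proj.basicOpen (symPow Γ(X, U.toOpens) (F.Sec U)) (SymmetricAlgebra.ι _ _ m) →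
    ∀ f : (RatFun (projectivization F))ˣ, f * τ m = 1 →
      ξ.IsEquationAt (projectivizationChart F U z) f
  chartVal : ∀ (U : AffOpen X) (m' m : F.Sec U), m ≠ 0 →
    chartVal F U (τ m') * coneMap (SymmetricAlgebra.ι _ _ m) =
      coneMap (SymmetricAlgebra.ι _ _ m') * chartVal F U (τ m)

lemma IsTautological.exists_for {ξ : CartierDivisor (projectivization F)} (h : IsTautological ξ) :
    ∃ τ, IsTautologicalFor ξ τ := by
  obtain ⟨τ, hτ⟩ := h
  refine ⟨τ, fun U m hm => ?_, fun U m z hz f hf => ?_, fun U m' m hm => ?_⟩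
  · obtain ⟨z, hz⟩ := exists_mem_basicOpen_of_ne_zero hm
    obtain ⟨⟨f, hf, -⟩, -⟩ := hτ U m z hz
    exact right_ne_zero_of_mul (hf ▸ one_ne_zero)
  · obtain ⟨⟨f', hf', h⟩, -⟩ := hτ U m z hz
    have : f = f' := Units.ext (mul_right_cancel₀ (right_ne_zero_of_mul (hf ▸ one_ne_zero))
      (hf.trans hf'.symm))
    rwa [this]
  · obtain ⟨z, hz⟩ := exists_mem_basicOpen_of_ne_zero hm
    obtain ⟨-, h⟩ := hτ U m z hz
    obtain ⟨t, ht, h⟩ := h m'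
    rw [stalkMap_eq_germ_iff] at ht
    rw [h, map_mul, mul_right_comm, ht]

/-- The quotient τ m' / τ m corresponds to m' / m in the chart, so it is regular at z, and its germ
is the required t. -/
lemma exists_stalk_of_chartVal {τ : W → RatFun (projectivization F)} {U : AffOpen X}
    {m' m : F.Sec U} {z : symProj Γ(X, U.toOpens) (F.Sec U)}
    (hz : z ∈ Proj.basicOpen (symPow Γ(X, U.toOpens) (F.Sec U)) (SymmetricAlgebra.ι _ _ m))
    (h0 : τ m ≠ 0)
    (h : chartVal F U (τ m') * coneMap (SymmetricAlgebra.ι _ _ m) =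
      coneMap (SymmetricAlgebra.ι _ _ m') * chartVal F U (τ m)) :
    ∃ t : (projectivization F).presheaf.stalk (projectivizationChart F U z),
      (projectivizationChart F U).stalkMap z t =
        (symProj Γ(X, U.toOpens) (F.Sec U)).presheaf.germ _ z hz (symFraction m' m) ∧
      τ m' = stalkToRat _ _ t * τ m := by
  have h1 : chartVal F U (τ m' / τ m) * coneMap (SymmetricAlgebra.ι _ _ m) =
      coneMap (SymmetricAlgebra.ι _ _ m') := by
    have hu : IsUnit (chartVal F U (τ m)) := (IsUnit.mk0 _ h0).map _
    apply hu.mul_right_cancel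
    rw [← h, mul_right_comm, ← map_mul, div_mul_cancel₀ _ h0]
  obtain ⟨t, ht⟩ := mem_localRing_of_chartVal hz (k := 1) (ι_mem_symPow _ m') (by rwa [pow_one])
  refine ⟨t, (stalkMap_eq_germ_iff hz t).mpr (by rwa [ht]), ?_⟩
  rw [ht, div_mul_cancel₀ _ h0]

lemma IsTautologicalFor.isTautological {ξ : CartierDivisor (projectivization F)}
    {τ : W → RatFun (projectivization F)} (h : IsTautologicalFor ξ τ) : IsTautological ξ := by
  refine ⟨τ, fun U m z hz => ?_⟩
  have hm := ne_zero_of_mem_basicOpen hz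
  have h0 := h.ne_zero U m hm
  refine ⟨⟨(Units.mk0 _ h0)⁻¹, ?_, ?_⟩, fun m' => ?_⟩
  · rw [Units.val_inv_eq_inv_val, Units.val_mk0, inv_mul_cancel₀ h0]
  · refine h.isEquationAt U m z hz _ ?_
    rw [Units.val_inv_eq_inv_val, Units.val_mk0, inv_mul_cancel₀ h0]
  · exact exists_stalk_of_chartVal hz h0 (h.chartVal U m' m hm)

/-- Compatibility of numerators on two charts. Here x and y are linear forms, t and s their images
under τ, and ψ is written relative to O(r) with denominators x^(N+r) and y^(N+r). The relation (s
x)^r = (y t)^r lets t and s be eliminated. -/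
lemma pow_mul_eq_of_fractions {C : Type} [CommRing C] {ψ x y s t q q' : C} {N r : ℕ}
    (ht : IsUnit t) (hy : IsUnit y) (h : s * x = y * t) (hq : ψ * x ^ (N + r) = q * t ^ r)
    (hq' : ψ * y ^ (N + r) = q' * s ^ r) : y ^ N * q = x ^ N * q' := by
  apply (ht.pow r).mul_right_cancel
  apply (hy.pow r).mul_right_cancel
  have h2 : y ^ r * t ^ r = x ^ r * s ^ r := by rw [← mul_pow, ← mul_pow, ← h, mul_comm]
  rw [pow_add] at hq hq'
  calc y ^ N * q * t ^ r * y ^ r = y ^ N * y ^ r * (q * t ^ r) := by ring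
    _ = x ^ N * x ^ r * (q' * s ^ r) := by rw [← hq, ← hq']; ring
    _ = x ^ N * q' * (x ^ r * s ^ r) := by ring
    _ = x ^ N * q' * t ^ r * y ^ r := by rw [← h2]; ring

namespace IsTautologicalFor

variable {ξ : CartierDivisor (projectivization F)} {τ : W → RatFun (projectivization F)}
  (h : IsTautologicalFor ξ τ)

include h

/-- The realization of `F` in the field of rational functions of `P(F)`. -/
def realization : F.Realization (RatFun (projectivization F)) where
  κ := pullbackFunction (projectivizationMap F)
  τ := τ
  map_add U v hv w hw := by
    obtain ⟨m, hm⟩ := exists_sec_ne_zero F U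
    apply chartVal_injective U
    apply (isUnit_coneMap_ι hm).mul_right_cancel
    rw [map_add, add_mul]
    have h1 := h.chartVal U (⟨v, hv⟩ + ⟨w, hw⟩) m hm
    rw [map_add, map_add, add_mul, ← h.chartVal U _ m hm, ← h.chartVal U _ m hm] at h1
    exact h1
  map_smul U a w hw := by
    obtain ⟨m, hm⟩ := exists_sec_ne_zero F U
    apply chartVal_injective U
    apply (isUnit_coneMap_ι hm).mul_right_cancel
    have h1 := h.chartVal U (a • ⟨w, hw⟩) m hm
    rw [map_smul, Algebra.smul_def, map_mul, mul_assoc, ← h.chartVal U _ m hm] at h1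
    rw [map_mul, chartVal_pullback, mul_assoc]
    exact h1

/-- Both sides are multiplicative in P, and in degree one this is the relation defining τ. In other
words, the value of P is (P / m^k) τ(m)^k. -/
lemma chartVal_eval (U : AffOpen X) {m : F.Sec U} (hm : m ≠ 0) {k : ℕ}
    {P : SymmetricAlgebra Γ(X, U.toOpens) (F.Sec U)} (hP : P ∈ symPow _ (F.Sec U) k) :
    TangentBig.chartVal F U (h.realization.eval U P) * coneMap (SymmetricAlgebra.ι _ _ m) ^ k =
      coneMap P * TangentBig.chartVal F U (τ m) ^ k := by
  unfold symPow at hP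
  induction hP using Submodule.pow_induction_on_left' with
  | algebraMap a =>
    rw [pow_zero, pow_zero, mul_one, mul_one, RatSheaf.Realization.eval_algebraMap]
    exact chartVal_pullback U a
  | add x y i hx hy ihx ihy => rw [map_add, map_add, map_add, add_mul, ihx, ihy, add_mul]
  | mem_mul w hw i x hx ih =>
    obtain ⟨w, rfl⟩ := hw
    have h1 := h.chartVal U w m hm
    rw [map_mul, map_mul, map_mul, RatSheaf.Realization.eval_ι, Nat.succ_eq_add_one, pow_succ,
      pow_succ]
    change TangentBig.chartVal F U (τ w) * _ * _ = _
    calc _ = (TangentBig.chartVal F U (τ w) * coneMap (SymmetricAlgebra.ι _ _ m)) *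
          (TangentBig.chartVal F U (h.realization.eval U x) *
            coneMap (SymmetricAlgebra.ι _ _ m) ^ i) := by ring
      _ = _ := by rw [h1, ih]; ring

/-- By `chartVal_eval` the value of P is, up to units, P itself in the cone ring, and over a free
chart the cone ring contains Sym. -/
lemma isFaithful : h.realization.IsFaithful where
  eq_zero V n e he r P hP h0 := by
    have := he.isDomain
    obtain ⟨m, hm⟩ := exists_sec_ne_zero F V
    have h1 := h.chartVal_eval V hm hP
    rw [h0, map_zero, zero_mul] at h1
    have hu : IsUnit (TangentBig.chartVal F V (τ m) ^ r) :=
      ((IsUnit.mk0 _ (h.ne_zero V m hm)).map _).pow r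
    have h2 := hu.mul_left_eq_zero.mp h1.symm
    exact coneMap_injective (h2.trans (map_zero _).symm)

lemma isEquationAt_inv {U : AffOpen X} {m : F.Sec U} {z : symProj Γ(X, U.toOpens) (F.Sec U)}
    (hz : z ∈ Proj.basicOpen (symPow Γ(X, U.toOpens) (F.Sec U)) (SymmetricAlgebra.ι _ _ m)) :
    ξ.IsEquationAt (projectivizationChart F U z)
      (Units.mk0 _ (h.ne_zero U m (ne_zero_of_mem_basicOpen hz)))⁻¹ := by
  refine h.isEquationAt U m z hz _ ?_
  rw [Units.val_inv_eq_inv_val, Units.val_mk0,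
    inv_mul_cancel₀ (h.ne_zero U m (ne_zero_of_mem_basicOpen hz))]

/-- Sections of `O(r ξ + π^* D)` in terms of polynomials. -/
lemma isSection_of_exists {r : ℕ} {D : CartierDivisor X} {φ : RatFun (projectivization F)}
    (hφ : ∀ x : X, ∃ (V : AffOpen X) (f : (RatFun X)ˣ), x ∈ V.toOpens ∧
      (∀ y ∈ V.toOpens, D.IsEquationAt y f) ∧ ∃ P ∈ symPow Γ(X, V.toOpens) (F.Sec V) r,
        φ * pullbackFunction (projectivizationMap F) f = h.realization.eval V P) :
    (r • ξ + D.pullback (projectivizationMap F)).IsSection φ := by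
  refine CartierDivisor.isSection_of_exists fun y => ?_
  obtain ⟨V, f, hyV, hf, P, hP, hφP⟩ := hφ (projectivizationMap F y)
  obtain ⟨m, z, rfl, hz⟩ := exists_chart_basicOpen_eq hyV
  have hm := ne_zero_of_mem_basicOpen hz
  refine ⟨_, ((h.isEquationAt_inv hz).nsmul r).add ((hf _ hyV).pullback _), ?_⟩
  -- The local equation here is τ(m)^(-r) f, so the function to be tested is P / m^r.
  refine mem_localRing_of_chartVal hz hP ?_
  have h0 := h.ne_zero V m hm
  have hu : IsUnit (TangentBig.chartVal F V (τ m) ^ r) := ((IsUnit.mk0 _ h0).map _).pow r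
  apply hu.mul_right_cancel
  rw [← h.chartVal_eval V hm hP, ← hφP, mul_right_comm, ← map_pow, ← map_mul]
  congr 2
  rw [Units.val_mul, Units.val_pow_eq_pow_val, Units.val_inv_eq_inv_val, Units.val_mk0]
  have : (τ m)⁻¹ ^ r * τ m ^ r = 1 := by rw [← mul_pow, inv_mul_cancel₀ h0, one_pow]
  calc _ = φ * pullbackFunction (projectivizationMap F) f * ((τ m)⁻¹ ^ r * τ m ^ r) := by
        simp only [Units.coe_map]
        change φ * ((τ m)⁻¹ ^ r * pullbackFunction (projectivizationMap F) f) * _ = _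
        ring
    _ = _ := by rw [this, mul_one]

/-- On each chart x_i ≠ 0 the function ψ is τ(x_i)^r times a fraction with denominator a power of
x_i. After bringing the denominators to the exponent N + r the numerators are compatible, and
`exists_eq_ι_pow_mul` produces a single form. -/
lemma exists_eval_of_fractions {V : AffOpen X} {n : ℕ} (hn : 0 < n)
    [IsDomain (SymmetricAlgebra Γ(X, V.toOpens) (F.Sec V))]
    (b : Module.Basis (Fin n) Γ(X, V.toOpens) (F.Sec V)) {r : ℕ}
    {ψ : RatFun (projectivization F)}
    (key : ∀ i, ∃ (k : ℕ) (P : SymmetricAlgebra Γ(X, V.toOpens) (F.Sec V)),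
      P ∈ symPow _ (F.Sec V) k ∧
      TangentBig.chartVal F V ψ * coneMap (SymmetricAlgebra.ι _ _ (b i)) ^ k =
        coneMap P * TangentBig.chartVal F V (τ (b i)) ^ r) :
    ∃ P ∈ symPow Γ(X, V.toOpens) (F.Sec V) r, ψ = h.realization.eval V P := by
  have hb0 : ∀ i, b i ≠ 0 := fun i => b.ne_zero i
  have hτ0 : ∀ i, τ (b i) ≠ 0 := fun i => h.ne_zero V _ (hb0 i)
  choose k P hP hPk using key
  -- Any N with k i ≤ N + r for all i would do; the sum of the exponents is one.
  obtain ⟨N, hN⟩ : ∃ N, N = ∑ i, k i := ⟨_, rfl⟩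
  have hkN : ∀ i, k i ≤ N + r := fun i =>
    (Finset.single_le_sum (fun _ _ => Nat.zero_le _) (Finset.mem_univ i)).trans
      (hN ▸ Nat.le_add_right _ _)
  have hex : ∀ i, ∃ Q ∈ symPow Γ(X, V.toOpens) (F.Sec V) (N + r),
      TangentBig.chartVal F V ψ * coneMap (SymmetricAlgebra.ι _ _ (b i)) ^ (N + r) =
        coneMap Q * TangentBig.chartVal F V (τ (b i)) ^ r := by
    intro i
    refine ⟨SymmetricAlgebra.ι _ _ (b i) ^ (N + r - k i) * P i, ?_, ?_⟩
    · have := SetLike.mul_mem_graded (ι_pow_mem (R := Γ(X, V.toOpens)) (b i) (N + r - k i)) (hP i)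
      rwa [Nat.sub_add_cancel (hkN i)] at this
    · rw [map_mul, map_pow, mul_assoc, ← hPk, mul_left_comm, ← pow_add,
        Nat.sub_add_cancel (hkN i)]
  choose Q hQ hQk using hex
  have hcomp : ∀ i j, SymmetricAlgebra.ι _ _ (b j) ^ N * Q i =
      SymmetricAlgebra.ι _ _ (b i) ^ N * Q j := by
    intro i j
    apply coneMap_injective
    rw [map_mul, map_mul, map_pow, map_pow]
    exact pow_mul_eq_of_fractions (((IsUnit.mk0 _ (hτ0 i)).map _))
      (isUnit_coneMap_ι (hb0 j)) (h.chartVal V (b j) (b i) (hb0 i)) (hQk i) (hQk j)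
  obtain ⟨S, hS, hQS⟩ := exists_eq_ι_pow_mul hn b Q hQ hcomp
  refine ⟨S, hS, chartVal_injective V ?_⟩
  obtain ⟨i, -⟩ : ∃ i : Fin n, i = ⟨0, hn⟩ := ⟨_, rfl⟩
  apply ((isUnit_coneMap_ι (hb0 i)).pow (N + r)).mul_right_cancel
  rw [hQk i, hQS i, pow_add, map_mul, map_pow, mul_assoc, ← h.chartVal_eval V (hb0 i) hS]
  exact mul_left_comm _ _ _

/-- Over an affine set where F is free and D has equation f, the function φ π^*f / τ(m)^r is regular
where the basis vector m does not vanish, hence is a fraction P / m^k there. The charts of a basis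
then combine. -/
lemma exists_eval_of_isSection {r : ℕ} {D : CartierDivisor X} {φ : RatFun (projectivization F)}
    (hφ : (r • ξ + D.pullback (projectivizationMap F)).IsSection φ) (x : X) :
    ∃ (V : AffOpen X) (f : (RatFun X)ˣ), x ∈ V.toOpens ∧
      (∀ y ∈ V.toOpens, D.IsEquationAt y f) ∧ ∃ P ∈ symPow Γ(X, V.toOpens) (F.Sec V) r,
        φ * pullbackFunction (projectivizationMap F) f = h.realization.eval V P := by
  obtain ⟨U, hxU, -⟩ := exists_affOpen_mem ⊤ x trivial
  obtain ⟨V', n, hn, e, -, hxV', he'⟩ := F.exists_free U hxU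
  obtain ⟨V, f, hVV', hxV, hf⟩ := exists_affOpen_isEquationAt D V' hxV'
  have he := he'.mono hVV'
  refine ⟨V, f, hxV, hf, ?_⟩
  have := he.isDomain
  refine h.exists_eval_of_fractions hn he.basis fun i => ?_
  have hb0 : he.basis i ≠ 0 := he.basis.ne_zero i
  have hτ0 := h.ne_zero V _ hb0
  generalize he.basis i = m at *
  obtain ⟨ψ, hψ⟩ : ∃ ψ, ψ = φ * pullbackFunction (projectivizationMap F) f := ⟨_, rfl⟩
  rw [← hψ]
  obtain ⟨k, P, hP, h1⟩ := exists_chartVal_mul_eq hb0 (φ := ψ / τ m ^ r) (by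
    intro z hz
    have := hφ.mem (((h.isEquationAt_inv hz).nsmul r).add
      ((hf _ (projectivizationMap_chart_mem z)).pullback _))
    convert this using 1
    rw [Units.val_mul, Units.val_pow_eq_pow_val, Units.val_inv_eq_inv_val, Units.val_mk0,
      Units.coe_map, hψ]
    change φ * pullbackFunction (projectivizationMap F) f / τ m ^ r =
      φ * ((τ m)⁻¹ ^ r * pullbackFunction (projectivizationMap F) f)
    rw [inv_pow, div_eq_mul_inv, mul_assoc, mul_comm (pullbackFunction _ _)])
  refine ⟨k, P, hP, ?_⟩
  rw [← h1, mul_right_comm, ← map_pow (TangentBig.chartVal F V), ← map_mul,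
    div_mul_cancel₀ _ (pow_ne_zero r hτ0)]

end IsTautologicalFor

/-! ### Construction of a tautological divisor. -/

section Existence

/-- Dehomogenization: τ m is the fraction m / m₀. The same vector may be a section over several V,
and the fraction is the same by `chartVal_res`. -/
lemma exists_tau (U₀ : AffOpen X) {m₀ : F.Sec U₀} (hm₀ : m₀ ≠ 0) :
    ∃ τ : W → RatFun (projectivization F), ∀ (V : AffOpen X) (hV : V ≤ U₀) (m : F.Sec V),
      chartVal F V (τ m) * coneMap (SymmetricAlgebra.ι _ _ (F.res hV m₀)) =
        coneMap (SymmetricAlgebra.ι _ _ m) := by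
  have key : ∀ w : W, ∃ φ : RatFun (projectivization F), ∀ (V : AffOpen X) (hV : V ≤ U₀)
      (m : F.Sec V), m.1 = w →
      chartVal F V φ * coneMap (SymmetricAlgebra.ι _ _ (F.res hV m₀)) =
        coneMap (SymmetricAlgebra.ι _ _ m) := by
    intro w
    by_cases hw : ∃ V, V ≤ U₀ ∧ w ∈ F.sec V
    · obtain ⟨V, hV, hw⟩ := hw
      obtain ⟨φ, hφ⟩ := exists_fraction (⟨w, hw⟩ : F.Sec V) (RatSheaf.res_ne_zero hV hm₀)
      refine ⟨φ, fun V' hV' m hm => ?_⟩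
      obtain ⟨ψ, hψ⟩ := exists_fraction m (RatSheaf.res_ne_zero hV' hm₀)
      obtain ⟨V'', h, h', -⟩ := exists_affOpen_le_le V V' (genericPoint X) V.genericPoint_mem
        V'.genericPoint_mem
      have h1 := chartVal_res h (RatSheaf.res_ne_zero hV hm₀) hφ
      have h2 := chartVal_res h' (RatSheaf.res_ne_zero hV' hm₀) hψ
      have h3 : F.res h ⟨w, hw⟩ = F.res h' m := Subtype.ext hm.symm
      have h4 : F.res h (F.res hV m₀) = F.res h' (F.res hV' m₀) := rfl
      rw [h3, h4, ← h2] at h1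
      have h5 : φ = ψ := chartVal_injective V'' ((isUnit_coneMap_ι
        (RatSheaf.res_ne_zero h' (RatSheaf.res_ne_zero hV' hm₀))).mul_right_cancel h1)
      rw [h5, hψ]
    -- A vector that is a section over no V ≤ U₀ receives the default value 0, about which nothing
    -- is claimed.
    · refine ⟨0, fun V hV m hm => absurd ⟨V, hV, hm ▸ m.2⟩ hw⟩
  choose τ hτ using key
  exact ⟨τ, fun V hV m => hτ _ V hV m rfl⟩

variable (F) in
/-- The existence of the tautological divisor. -/
lemma exists_isTautologicalFor : ∃ (ξ : CartierDivisor (projectivization F)) (τ : _),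
    IsTautologicalFor ξ τ := by
  obtain ⟨U₀, -, -⟩ := exists_affOpen_mem ⊤ (genericPoint X) trivial
  obtain ⟨m₀, hm₀⟩ := exists_sec_ne_zero F U₀
  obtain ⟨τ, hτ⟩ := exists_tau U₀ hm₀
  -- The construction controls τ only over subsets of U₀; the fraction m' / m on U is compared with
  -- it over a common smaller V.
  have hfrac : ∀ (U : AffOpen X) (m' m : F.Sec U), m ≠ 0 →
      chartVal F U (τ m') * coneMap (SymmetricAlgebra.ι _ _ m) =
        coneMap (SymmetricAlgebra.ι _ _ m') * chartVal F U (τ m) := by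
    intro U m' m hm
    obtain ⟨φ, hφ⟩ := exists_fraction m' hm
    obtain ⟨V, hV, hV', -⟩ := exists_affOpen_le_le U U₀ (genericPoint X) U.genericPoint_mem
      U₀.genericPoint_mem
    have h1 := hτ V hV' (F.res hV m)
    have h2 := hτ V hV' (F.res hV m')
    have h3 := chartVal_res hV hm hφ
    have h4 : τ m' = φ * τ m := by
      apply chartVal_injective V
      apply (isUnit_coneMap_ι (RatSheaf.res_ne_zero hV' hm₀)).mul_right_cancel
      rw [map_mul, mul_assoc]
      refine h2.trans ?_
      rw [← h3]
      exact congrArg _ h1.symm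
    rw [h4, map_mul, mul_right_comm, hφ]
  have hne : ∀ (U : AffOpen X) (m : F.Sec U), m ≠ 0 → τ m ≠ 0 := by
    intro U m hm h0
    obtain ⟨V, hV, hV', -⟩ := exists_affOpen_le_le U U₀ (genericPoint X) U.genericPoint_mem
      U₀.genericPoint_mem
    have h1 : chartVal F V (τ m) * _ = _ := hτ V hV' (F.res hV m)
    rw [h0, map_zero, zero_mul] at h1
    have h2 := isUnit_coneMap_ι (RatSheaf.res_ne_zero hV hm)
    rw [← h1] at h2
    exact not_isUnit_zero h2
  -- Both forms are restricted to a common affine neighbourhood V of the image of the point; m'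
  -- stays nonzero at the point, so m / m' is regular there.
  have hdiv : ∀ (U U' : AffOpen X) (m : F.Sec U) (m' : F.Sec U')
      (z : symProj Γ(X, U.toOpens) (F.Sec U)) (z' : symProj Γ(X, U'.toOpens) (F.Sec U')),
      z' ∈ Proj.basicOpen (symPow Γ(X, U'.toOpens) (F.Sec U')) (SymmetricAlgebra.ι _ _ m') →
      projectivizationChart F U z = projectivizationChart F U' z' →
      τ m / τ m' ∈ localRing _ (projectivizationChart F U z) := by
    intro U U' m m' z z' hz' hzz'
    have hm' := ne_zero_of_mem_basicOpen hz'
    obtain ⟨V, hV, hV', hx⟩ := exists_affOpen_le_le U U' _ (projectivizationMap_chart_mem z)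
      (hzz' ▸ projectivizationMap_chart_mem z')
    obtain ⟨z'', h''⟩ := exists_chart_eq hx
    have h1 : symProjMap (F.res hV') (F.span_res hV') z'' = z' := by
      apply (projectivizationChart F U').injective
      rw [← Scheme.Hom.comp_apply, symProjMap_chart, h'', hzz']
    have h2 : z'' ∈ Proj.basicOpen (symPow Γ(X, V.toOpens) (F.Sec V))
        (SymmetricAlgebra.ι _ _ (F.res hV' m')) := by
      rw [← symMap_ι]
      rw [← h1] at hz'
      exact hz'
    have h3 := hfrac V (F.res hV m) (F.res hV' m') (RatSheaf.res_ne_zero hV' hm')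
    obtain ⟨t, -, ht⟩ := exists_stalk_of_chartVal h2 (hne _ _ (RatSheaf.res_ne_zero hV' hm')) h3
    rw [← h'']
    refine ⟨t, ?_⟩
    rw [eq_div_iff (hne _ _ hm')]
    exact ht.symm
  have hpt : ∀ y : projectivization F, ∃ (U : AffOpen X) (m : F.Sec U)
      (z : symProj Γ(X, U.toOpens) (F.Sec U)), projectivizationChart F U z = y ∧
      z ∈ Proj.basicOpen (symPow Γ(X, U.toOpens) (F.Sec U)) (SymmetricAlgebra.ι _ _ m) := by
    intro y
    obtain ⟨U, hU⟩ := exists_affOpen_map_mem y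
    exact ⟨U, exists_chart_basicOpen_eq hU⟩
  choose U m z hz hzm using hpt
  have hm : ∀ y, m y ≠ 0 := fun y => ne_zero_of_mem_basicOpen (hzm y)
  -- The equation at y is the inverse of τ of a chosen linear form not vanishing at y; `hD` shows
  -- that the choice does not matter.
  let D : ∀ y, DivisorGerm (projectivization F) y := fun y =>
    divisorGerm _ y (Additive.ofMul (Units.mk0 _ (hne _ _ (hm y)))⁻¹)
  have hD : ∀ (U' : AffOpen X) (m' : F.Sec U') (z' : symProj Γ(X, U'.toOpens) (F.Sec U')),
      z' ∈ Proj.basicOpen (symPow Γ(X, U'.toOpens) (F.Sec U')) (SymmetricAlgebra.ι _ _ m') →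
      ∀ f : (RatFun (projectivization F))ˣ, f * τ m' = 1 →
        D (projectivizationChart F U' z') =
          divisorGerm _ (projectivizationChart F U' z') (Additive.ofMul f) := by
    intro U' m' z' hz' f hf
    have h0' := hne _ _ (ne_zero_of_mem_basicOpen hz')
    have hf' : (f : RatFun (projectivization F)) = (τ m')⁻¹ := eq_inv_of_mul_eq_one_left hf
    rw [← sub_eq_zero]
    change divisorGerm _ _ _ - _ = _
    rw [← map_sub]
    change divisorGerm _ _ (Additive.ofMul (_ / f)) = 0
    rw [divisorGerm_eq_zero_iff, mem_stalkUnits_iff]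
    have hy := hz (projectivizationChart F U' z')
    constructor
    · have := hdiv U' _ m' (m _) z' _ (hzm (projectivizationChart F U' z')) hy.symm
      simpa [hf', div_eq_mul_inv, mul_comm] using this
    · have := hdiv _ U' (m _) m' (z (projectivizationChart F U' z')) z' hz' hy
      rw [hy] at this
      simpa [hf', div_eq_mul_inv, mul_comm] using this
  refine ⟨⟨D, fun y => ?_⟩, τ, hne, fun U' m' z' hz' f hf => hD U' m' z' hz' f hf, hfrac⟩
  refine ⟨projectivizationChart F (U y) ''ᵁ
    Proj.basicOpen (symPow Γ(X, (U y).toOpens) (F.Sec (U y))) (SymmetricAlgebra.ι _ _ (m y)),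
    ⟨z y, hzm y, hz y⟩, Additive.ofMul (Units.mk0 _ (hne _ _ (hm y)))⁻¹, ?_⟩
  rintro _ ⟨w, hw, rfl⟩
  refine hD _ _ w hw _ ?_
  rw [Units.val_inv_eq_inv_val, Units.val_mk0, inv_mul_cancel₀ (hne _ _ (hm y))]

end Existence

end Tautological

/-! ### The basis of derivations dual to a basis of differentials. -/

section Derivations

open KaehlerDifferential

/-- The basis of Ω over R localizes to one over K, and the e i are the dual derivations. They
preserve R because the coordinates of da lie in R. A derivation D preserving R maps all of Ω over R
into R, and its coefficients are the values on the b i. -/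
lemma exists_basis_derivation {C R K : Type} [CommRing C] [CommRing R] [Field K]
    [Algebra C R] [Algebra R K] [Algebra C K] [IsScalarTower C R K] [IsFractionRing R K] {n : ℕ}
    (b : Module.Basis (Fin n) R Ω[R⁄C]) : ∃ e : Fin n → Derivation C K K,
      (∀ i a, e i (algebraMap R K a) ∈ (algebraMap R K).range) ∧ LinearIndependent K e ∧
      ∀ D : Derivation C K K, (∀ a, D (algebraMap R K a) ∈ (algebraMap R K).range) →
        ∃ a : Fin n → R, D = ∑ i, algebraMap R K (a i) • e i := by
  let b' := b.ofIsLocalizedModule K (nonZeroDivisors R) (KaehlerDifferential.map C C R K)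
  have hb' : ∀ i, b' i = KaehlerDifferential.map C C R K (b i) := fun i =>
    Module.Basis.ofIsLocalizedModule_apply ..
  let Φ : (Ω[K⁄C] →ₗ[K] K) ≃ₗ[K] Derivation C K K :=
    KaehlerDifferential.linearMapEquivDerivation C K
  refine ⟨fun i => Φ (b'.coord i), fun i a => ?_, ?_, fun D hD => ?_⟩
  · refine ⟨b.repr (KaehlerDifferential.D C R a) i, ?_⟩
    change _ = b'.repr (KaehlerDifferential.D C K (algebraMap R K a)) i
    rw [← KaehlerDifferential.map_D C C R K a]
    exact (Module.Basis.ofIsLocalizedModule_repr_apply ..).symm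
  · have h := b'.dualBasis.linearIndependent
    rw [b'.coe_dualBasis] at h
    exact h.map' Φ.toLinearMap (LinearEquiv.ker Φ)
  · have hl : ∀ x, D.liftKaehlerDifferential (KaehlerDifferential.map C C R K x) ∈
        (algebraMap R K).range := by
      intro x
      have hx : x ∈ Submodule.span R (Set.range (KaehlerDifferential.D C R)) := by
        rw [KaehlerDifferential.span_range_derivation]; trivial
      induction hx using Submodule.span_induction with
      | mem x hx =>
        obtain ⟨a, rfl⟩ := hx
        rw [KaehlerDifferential.map_D, Derivation.liftKaehlerDifferential_comp_D]
        exact hD a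
      | zero => rw [map_zero, map_zero]; exact zero_mem _
      | add x y _ _ hx hy => rw [map_add, map_add]; exact add_mem hx hy
      | smul a x _ hx =>
        rw [map_smul, ← algebraMap_smul K, map_smul]
        exact mul_mem ⟨a, rfl⟩ hx
    choose a ha using fun i => hl (b i)
    refine ⟨a, Φ.symm.injective ?_⟩
    simp only [map_sum, map_smul, LinearEquiv.symm_apply_apply]
    refine b'.ext fun j => ?_
    rw [LinearMap.sum_apply, Finset.sum_eq_single j (fun i _ hij => by
      rw [LinearMap.smul_apply, b'.coord_apply, b'.repr_self, Finsupp.single_eq_of_ne hij,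
        smul_zero]) (by simp), LinearMap.smul_apply, b'.coord_apply, b'.repr_self,
      Finsupp.single_eq_same, ha, hb']
    exact (mul_one _).symm

end Derivations

/-! ### The tangent sheaf of a smooth variety is locally free. -/

section TangentSheaf

variable {X : Scheme.{0}} [IsIntegral X] (p : X ⟶ Spec (.of ℂ)) [LocallyOfFiniteType p]

lemma eq_top_of_mem_spec_field {k : Type} [Field k] {U : (Spec (.of k)).Opens}
    {x : Spec (.of k)} (hx : x ∈ U) : U = ⊤ := by
  rw [eq_top_iff]
  intro y _
  have : y = x := Subsingleton.elim (α := PrimeSpectrum k) y x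
  rwa [this]

lemma AffOpen.isFractionRing (U : AffOpen X) :
    @IsFractionRing Γ(X, U.toOpens) _ (RatFun X) _ U.toRat.toAlgebra := by
  have : Nonempty U.toOpens := U.2.2.to_subtype
  exact functionField_isFractionRing_of_isAffineOpen X U.toOpens U.2.1

/-- The tangent sheaf is free of rank `n` over an affine open set that is standard smooth of
relative dimension `n`. -/
lemma exists_isFreeOn_tangentSheaf (V : AffOpen X) (n : ℕ)
    (h : (p.appLE ⊤ V.toOpens le_top).hom.IsStandardSmoothOfRelativeDimension n) :
    ∃ e, (tangentSheaf p).IsFreeOn V (n := n) e := by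
  algebraize [(p.appLE ⊤ V.toOpens le_top).hom]
  let _ := V.toRat.toAlgebra
  let _ : Algebra Γ(Spec (.of ℂ), ⊤) (RatFun X) :=
    (V.toRat.comp (p.appLE ⊤ V.toOpens le_top).hom).toAlgebra
  have : IsScalarTower Γ(Spec (.of ℂ), ⊤) Γ(X, V.toOpens) (RatFun X) :=
    IsScalarTower.of_algebraMap_eq fun _ => rfl
  have := V.isFractionRing
  have := Algebra.IsStandardSmoothOfRelativeDimension.isStandardSmooth (R := Γ(Spec (.of ℂ), ⊤))
    (S := Γ(X, V.toOpens)) n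
  have hr := Algebra.IsStandardSmoothOfRelativeDimension.rank_kaehlerDifferential
    (R := Γ(Spec (.of ℂ), ⊤)) (S := Γ(X, V.toOpens)) n
  have hr' := Module.finrank_eq_of_rank_eq hr
  have b := (Module.finBasis Γ(X, V.toOpens) Ω[Γ(X, V.toOpens)⁄Γ(Spec (.of ℂ), ⊤)]).reindex
    (finCongr hr')
  obtain ⟨e, he1, he2, he3⟩ := exists_basis_derivation (K := RatFun X) b
  have hconst : ∀ c, constants p c =
      algebraMap Γ(Spec (.of ℂ), ⊤) (RatFun X) ((Scheme.ΓSpecIso (.of ℂ)).inv.hom c) :=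
    constants_eq p V
  let ρ : Derivation Γ(Spec (.of ℂ), ⊤) (RatFun X) (RatFun X) →ₗ[RatFun X]
      Derivation ℤ (RatFun X) (RatFun X) :=
    { toFun := fun D => D.restrictScalars ℤ
      map_add' := fun _ _ => rfl
      map_smul' := fun _ _ => rfl }
  refine ⟨fun i => ρ (e i), ⟨fun i => ⟨fun c => ?_, he1 i⟩, ?_, fun D hD => ?_⟩⟩
  · rw [hconst]
    exact (e i).map_algebraMap _
  · refine he2.map' ρ (LinearMap.ker_eq_bot.mpr fun D D' h => Derivation.ext fun x => ?_)
    exact DFunLike.congr_fun h x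
  · have h0 : ∀ c : Γ(Spec (.of ℂ), ⊤), D (algebraMap _ (RatFun X) c) = 0 := by
      intro c
      have := hD.1 ((Scheme.ΓSpecIso (.of ℂ)).hom.hom c)
      rwa [hconst, CategoryTheory.Iso.hom_inv_id_apply (Scheme.ΓSpecIso (.of ℂ)) c] at this
    -- A derivation over ℤ that kills the constants is automatically linear over them.
    let D' : Derivation Γ(Spec (.of ℂ), ⊤) (RatFun X) (RatFun X) :=
      { toFun := D
        map_add' := map_add D
        map_smul' := fun c x => by
          rw [Algebra.smul_def, Derivation.leibniz, h0, smul_zero, add_zero]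
          exact (Algebra.smul_def _ _).symm
        map_one_eq_zero' := D.map_one_eq_zero
        leibniz' := D.leibniz }
    obtain ⟨a, ha⟩ := he3 D' hD.2
    exact ⟨a, (congrArg ρ ha).trans (map_sum ρ _ _)⟩

/-- Every point has a standard smooth affine neighbourhood of relative dimension n; its base is all
of Spec ℂ, which has a single point. The rank is n, whence its positivity. -/
lemma isLocallyFree_tangentSheaf (n : ℕ) (hn : 0 < n) [SmoothOfRelativeDimension n p] :
    (tangentSheaf p).IsLocallyFree where
  exists_free x := by
    obtain ⟨U, hU, V, hV, hx, e, h⟩ :=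
      SmoothOfRelativeDimension.exists_isStandardSmoothOfRelativeDimension (n := n) (f := p) x
    obtain rfl := eq_top_of_mem_spec_field (e hx)
    obtain ⟨e, he⟩ := exists_isFreeOn_tangentSheaf p ⟨V, hV, ⟨x, hx⟩⟩ n h
    exact ⟨⟨V, hV, ⟨x, hx⟩⟩, n, hn, e, hx, he⟩

end TangentSheaf

/-! ### Where a section generates O(D). -/

section Generators

variable {X : Scheme.{0}} [IsIntegral X] {D E : CartierDivisor X} {s t : RatFun X} {x : X}
  {f : (RatFun X)ˣ}

namespace CartierDivisor

lemma IsGeneratorAt.ne_zero (h : D.IsGeneratorAt s x) : s ≠ 0 := by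
  obtain ⟨f, -, hf⟩ := h
  rintro rfl
  simp at hf

lemma IsGeneratorAt.of_inv_mem (hs : D.IsSection s) (h0 : s ≠ 0) (hf : D.IsEquationAt x f)
    (h : (s * f)⁻¹ ∈ localRing X x) : D.IsGeneratorAt s x := by
  refine ⟨(Units.mk0 s h0)⁻¹, hf.of_div_mem ?_ ?_, by simp [h0]⟩
  · convert hs.mem hf using 1
    simp [div_eq_mul_inv, mul_comm]
  · convert h using 1
    simp [div_eq_mul_inv, mul_comm]

lemma IsGeneratorAt.inv_mem (h : D.IsGeneratorAt s x) (hf : D.IsEquationAt x f) :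
    (s * f)⁻¹ ∈ localRing X x := by
  obtain ⟨g, hg, hs⟩ := h
  convert hg.div_mem hf using 1
  rw [eq_inv_of_mul_eq_one_left hs, mul_inv, inv_inv, div_eq_mul_inv]

lemma IsGeneratorAt.isEquationAt (h : D.IsGeneratorAt s x) :
    D.IsEquationAt x (Units.mk0 s h.ne_zero)⁻¹ := by
  obtain ⟨g, hg, hs⟩ := id h
  have : (Units.mk0 s h.ne_zero)⁻¹ = g := by
    rw [inv_eq_iff_mul_eq_one]
    exact Units.ext hs
  rwa [this]

/-- With f a local equation, s f is invertible as soon as its n-th power is: (s f)⁻¹ = (s f)^(-n) (s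
f)^(n-1). -/
lemma isGeneratorAt_pow_iff (hs : D.IsSection s) {n : ℕ} (hn : 0 < n) :
    (n • D).IsGeneratorAt (s ^ n) x ↔ D.IsGeneratorAt s x := by
  constructor
  · intro h
    obtain ⟨f, hf⟩ := D.exists_isEquationAt x
    have h0 : s ≠ 0 := fun h0 => h.ne_zero (by rw [h0, zero_pow hn.ne'])
    refine IsGeneratorAt.of_inv_mem hs h0 hf ?_
    have h1 := mul_mem (h.inv_mem (hf.nsmul n)) (pow_mem (hs.mem hf) (n - 1))
    convert h1 using 1
    obtain ⟨k, rfl⟩ := Nat.exists_eq_succ_of_ne_zero hn.ne'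
    rw [Units.val_pow_eq_pow_val, ← mul_pow, Nat.succ_eq_add_one, Nat.add_sub_cancel, pow_succ]
    have : s * f ≠ 0 := mul_ne_zero h0 f.ne_zero
    field_simp
  · rintro ⟨f, hf, h⟩
    exact ⟨f ^ n, hf.nsmul n, by rw [Units.val_pow_eq_pow_val, ← mul_pow, h, one_pow]⟩

end CartierDivisor

end Generators

/-! ### Extending local sections by powers of a section of a line bundle. -/

section Twist

variable {X : Scheme.{0}} [IsIntegral X] {W : Type} [AddCommGroup W] [Module (RatFun X) W]
  {F : RatSheaf X W} {D E : CartierDivisor X}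

variable (F) in
/-- `w` is a global section of `F ⊗ O(D)`. -/
def RatSheaf.IsTwistedSection (D : CartierDivisor X) (w : W) : Prop :=
  ∀ x : X, ∃ (V : AffOpen X) (f : (RatFun X)ˣ), x ∈ V.toOpens ∧
    (∀ y ∈ V.toOpens, D.IsEquationAt y f) ∧ (f : RatFun X) • w ∈ F.sec V

lemma RatSheaf.IsTwistedSection.smul {w : W} {s : RatFun X} (hw : F.IsTwistedSection D w)
    (hs : E.IsSection s) : F.IsTwistedSection (D + E) (s • w) := by
  intro x
  obtain ⟨V, f, hxV, hf, hfw⟩ := hw x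
  obtain ⟨V', g, hV', hxV', hg⟩ := exists_affOpen_isEquationAt E V hxV
  refine ⟨V', f * g, hxV', fun y hy => (hf y (AffOpen.toOpens_mono hV' hy)).add (hg y hy), ?_⟩
  obtain ⟨a, ha⟩ := (mem_sheaf_iff_of_isEquationAt E hg).mp (hs.mem_sheaf V')
  have : ((f * g : (RatFun X)ˣ) : RatFun X) • s • w = V'.toRat a • (f : RatFun X) • w := by
    rw [ha, smul_smul, smul_smul, Units.val_mul]
    ring_nf
  rw [this]
  exact F.smul_mem _ _ _ (F.mono hV' hfw)

lemma RatSheaf.IsTwistedSection.isSection {s : RatFun X}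
    (h : (0 : CartierDivisor X).sheaf.IsTwistedSection D s) : D.IsSection s := by
  refine CartierDivisor.isSection_of_exists fun x => ?_
  obtain ⟨V, f, hxV, hf, hs⟩ := h x
  refine ⟨f, hf x hxV, ?_⟩
  have := hs x hxV 1 (CartierDivisor.isEquationAt_zero x)
  rwa [Units.val_one, mul_one, smul_eq_mul, mul_comm] at this

/-- Sections over `X_u` extend to `X` after multiplication by a power of `u`. -/
lemma RatSheaf.exists_isTwistedSection_pow [F.IsQuasiCoherent] [CompactSpace X] {u : RatFun X}
    (hu : D.IsSection u) (U : AffOpen X) (hU : ∀ y, D.IsGeneratorAt u y → y ∈ U.toOpens)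
    (h0 : u ≠ 0) {w : W} (hw : w ∈ F.sec U) :
    ∃ N : ℕ, ∀ n, N ≤ n → F.IsTwistedSection (n • D) (u ^ n • w) := by
  have key : ∀ x : X, ∃ (V : AffOpen X) (f : (RatFun X)ˣ) (n : ℕ), x ∈ V.toOpens ∧
      (∀ y ∈ V.toOpens, D.IsEquationAt y f) ∧ ∀ m, n ≤ m → (u * f) ^ m • w ∈ F.sec V := by
    intro x
    obtain ⟨V₀, hxV₀, -⟩ := exists_affOpen_mem ⊤ x trivial
    obtain ⟨V, f, -, hxV, hf⟩ := exists_affOpen_isEquationAt D V₀ hxV₀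
    obtain ⟨g, hg⟩ := (mem_sheaf_iff_of_isEquationAt D hf).mp (hu.mem_sheaf V)
    have hg0 : V.toRat g ≠ 0 := by rw [hg]; exact mul_ne_zero h0 f.ne_zero
    have hne : ((X.basicOpen g : X.Opens) : Set X).Nonempty := by
      rw [Set.nonempty_iff_ne_empty]
      intro h
      have h1 : X.basicOpen g = ⊥ := Opens.ext h
      rw [basicOpen_eq_bot_iff] at h1
      exact hg0 (by rw [h1, map_zero])
    let V' : AffOpen X := ⟨X.basicOpen g, V.2.1.basicOpen g, hne⟩
    -- D(g), with g = u f, is contained in the locus where u generates O(D), hence in U.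
    have hV'U : V'.toOpens ≤ U.toOpens := fun y hy => hU y <| by
      have hyV : y ∈ V.toOpens := X.basicOpen_le _ hy
      refine .of_inv_mem hu h0 (hf y hyV) ?_
      rw [← hg]
      obtain ⟨v, hv⟩ := (X.mem_basicOpen g y hyV).mp hy
      refine ⟨(v⁻¹ : _ˣ), ?_⟩
      refine eq_inv_of_mul_eq_one_left ?_
      rw [← V.stalkToRat_germ y hyV g]
      change stalkToRat X y _ * stalkToRat X y _ = 1
      rw [← map_mul, ← hv, Units.inv_mul, map_one]
    obtain ⟨n, hn⟩ := RatSheaf.IsQuasiCoherent.exists_pow (F := F) V' V g rfl w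
      (F.sec_mono hV'U hw)
    refine ⟨V, f, n, hxV, hf, fun m hm => ?_⟩
    obtain ⟨k, rfl⟩ := Nat.exists_eq_add_of_le' hm
    rw [← hg, pow_add, mul_smul, ← map_pow]
    exact F.smul_mem _ _ _ hn
  choose V f n hV hf hn using key
  obtain ⟨T, hT⟩ := isCompact_univ.elim_finite_subcover (fun x => ((V x).toOpens : Set X))
    (fun x => (V x).toOpens.isOpen) fun x _ => Set.mem_iUnion.mpr ⟨x, hV x⟩
  refine ⟨∑ x ∈ T, n x, fun m hm x => ?_⟩
  obtain ⟨z, hzT, hxz⟩ := Set.mem_iUnion₂.mp (hT (Set.mem_univ x))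
  refine ⟨V z, f z ^ m, hxz, fun y hy => (hf z y hy).nsmul m, ?_⟩
  rw [smul_smul, Units.val_pow_eq_pow_val, ← mul_pow, mul_comm]
  exact hn z m ((Finset.single_le_sum (fun _ _ => Nat.zero_le _) hzT).trans hm)

end Twist

/-! ### Properness, and constancy of global functions. -/

section Projective

variable {X : Scheme.{0}} (p : X ⟶ Spec (.of ℂ))

/-- The degree zero part of Sym is ℂ, and Sym is of finite type over it, so Proj is proper over its
spectrum. -/
lemma isProper_symProjToSpec (N : ℕ) : IsProper (symProjToSpec ℂ (Fin N → ℂ)) := by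
  have h0 : Function.Bijective (toSymZero ℂ (Fin N → ℂ)) := by
    have : Nontrivial (symPow ℂ (Fin N → ℂ) 0) :=
      (Submodule.nontrivial_iff_ne_bot).mpr fun h => one_ne_zero
        (α := SymmetricAlgebra ℂ (Fin N → ℂ)) (by
          have h1 : (1 : SymmetricAlgebra ℂ (Fin N → ℂ)) ∈ symPow ℂ (Fin N → ℂ) 0 :=
            SetLike.GradedOne.one_mem
          rwa [h, Submodule.mem_bot] at h1)
    refine ⟨(toSymZero ℂ (Fin N → ℂ)).injective, fun x => ?_⟩
    obtain ⟨x, hx⟩ := x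
    unfold symPow at hx
    rw [pow_zero, Submodule.mem_one] at hx
    obtain ⟨y, rfl⟩ := hx
    exact ⟨y, rfl⟩
  have : IsIso (Spec.map (CommRingCat.ofHom (toSymZero ℂ (Fin N → ℂ)))) := by
    have : IsIso (CommRingCat.ofHom (toSymZero ℂ (Fin N → ℂ))) :=
      (RingEquiv.ofBijective _ h0).toCommRingCatIso.isIso_hom
    infer_instance
  have : Algebra.FiniteType (symPow ℂ (Fin N → ℂ) 0) (SymmetricAlgebra ℂ (Fin N → ℂ)) := by
    have : Algebra.FiniteType ℂ (SymmetricAlgebra ℂ (Fin N → ℂ)) :=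
      Algebra.FiniteType.equiv inferInstance
        (SymmetricAlgebra.equivMvPolynomial (Pi.basisFun ℂ (Fin N))).symm
    have : IsScalarTower ℂ (symPow ℂ (Fin N → ℂ) 0) (SymmetricAlgebra ℂ (Fin N → ℂ)) :=
      ⟨fun c x y => smul_mul_assoc c x.1 y⟩
    exact Algebra.FiniteType.of_restrictScalars_finiteType ℂ _ _
  unfold symProjToSpec
  infer_instance

lemma IsProjective.isProper {p : X ⟶ Spec (.of ℂ)} (hp : IsProjective p) : IsProper p := by
  obtain ⟨N, i, hi, rfl⟩ := hp
  have := isProper_symProjToSpec (N + 1)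
  infer_instance

/-- A function regular everywhere is a global section; by properness global sections are integral
over ℂ, and a domain integral over an algebraically closed field is that field. -/
lemma mem_range_constants [IsIntegral X] [IsProper p] {t : RatFun X}
    (ht : ∀ x, t ∈ localRing X x) : t ∈ Set.range (constants p) := by
  obtain ⟨a, rfl⟩ := mem_range_germRat ⊤ trivial fun x _ => ht x
  let F : ℂ →+* Γ(X, ⊤) := p.appTop.hom.comp (Scheme.ΓSpecIso (.of ℂ)).inv.hom
  have hF : F.IsIntegral := by
    refine RingHom.IsIntegral.trans _ _ (RingHom.isIntegral_of_surjective _ ?_)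
      (isIntegral_appTop_of_universallyClosed p)
    exact (ConcreteCategory.bijective_of_isIso (Scheme.ΓSpecIso (.of ℂ)).inv).2
  algebraize [F]
  obtain ⟨c, rfl⟩ := (IsAlgClosed.algebraMap_bijective_of_isIntegral (k := ℂ)
    (K := Γ(X, ⊤))).2 a
  refine ⟨c, ?_⟩
  change stalkToRat X (genericPoint X) _ = _
  exact stalkToRat_germ ⊤ _ _ _

end Projective

/-! ### Sections of multiples of an ample divisor. -/

section Ample

variable {X : Scheme.{0}} [IsIntegral X] (p : X ⟶ Spec (.of ℂ)) [LocallyOfFiniteType p]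
  {A : CartierDivisor X}

/-- The function field is generated by the coordinate ring of an affine open set. -/
lemma exists_finset_closure_eq_top (U : AffOpen X) : ∃ S : Finset Γ(X, U.toOpens),
    Subfield.closure (Set.range (constants p) ∪ Set.range fun a : S => U.toRat a) = ⊤ := by
  have hft := p.finiteType_appLE (isAffineOpen_top _) U.2.1 le_top
  let _ := (p.appLE ⊤ U.toOpens le_top).hom.toAlgebra
  obtain ⟨S, hS⟩ : Algebra.FiniteType Γ(Spec (.of ℂ), ⊤) Γ(X, U.toOpens) := hft
  refine ⟨S, ?_⟩
  rw [eq_top_iff]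
  generalize hL : Subfield.closure (Set.range (constants p) ∪ Set.range fun a : S => U.toRat a) = L
  have key : ∀ a, U.toRat a ∈ L := by
    intro a
    have ha : a ∈ Algebra.adjoin Γ(Spec (.of ℂ), ⊤) (S : Set Γ(X, U.toOpens)) :=
      hS ▸ Algebra.mem_top
    induction ha using Algebra.adjoin_induction with
    | mem s hs => rw [← hL]; exact Subfield.subset_closure (Or.inr ⟨⟨s, hs⟩, rfl⟩)
    | algebraMap c =>
      have hc := constants_eq p U ((Scheme.ΓSpecIso (.of ℂ)).hom.hom c)
      rw [CategoryTheory.Iso.hom_inv_id_apply (Scheme.ΓSpecIso (.of ℂ)) c] at hc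
      rw [← hL]
      exact Subfield.subset_closure (Or.inl ⟨_, hc⟩)
    | add x y _ _ hx hy => rw [map_add]; exact add_mem hx hy
    | mul x y _ _ hx hy => rw [map_mul]; exact mul_mem hx hy
  rintro t -
  let _ := U.toRat.toAlgebra
  have := U.isFractionRing
  obtain ⟨a, b, -, rfl⟩ := IsFractionRing.div_surjective (A := Γ(X, U.toOpens)) t
  exact div_mem (key a) (key b)

/-- Some multiple of an ample divisor has sections whose quotients generate the function field. -/
lemma CartierDivisor.IsAmple.exists_generators [CompactSpace X] (hA : A.IsAmple) :
    ∃ (m : ℕ) (s₀ : RatFun X) (U : AffOpen X), 0 < m ∧ (m • A).IsSection s₀ ∧ s₀ ≠ 0 ∧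
      (∀ y, (m • A).IsGeneratorAt s₀ y → y ∈ U.toOpens) ∧
      ∃ (ι : Type) (_ : Finite ι) (s : ι → RatFun X), (∀ j, (m • A).IsSection (s j)) ∧
        Subfield.closure (Set.range (constants p) ∪ Set.range fun j => s j / s₀) = ⊤ := by
  obtain ⟨m, hm, u, hu, U, hU, hxU, hy⟩ := hA (genericPoint X)
  have h0 := ((hy _).mp hxU).ne_zero
  let U' : AffOpen X := ⟨U, hU, ⟨_, hxU⟩⟩
  obtain ⟨S, hS⟩ := exists_finset_closure_eq_top p U'
  -- U' is the set X_u, so generators of its coordinate ring become sections after multiplication by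
  -- a power of u.
  have key : ∀ a : S, ∃ N : ℕ, ∀ n, N ≤ n →
      (0 : CartierDivisor X).sheaf.IsTwistedSection (n • m • A) (u ^ n • U'.toRat a) := fun a =>
    RatSheaf.exists_isTwistedSection_pow hu U' (fun y => (hy y).mpr) h0 <| by
      intro x hx f hf
      have h1 := U'.toRat_mem_localRing a.1 hx
      rw [← mul_one (U'.toRat a.1)] at h1
      exact (CartierDivisor.isEquationAt_zero x).mul_mem hf h1
  choose N hN using key
  -- The summand 1 keeps the multiple positive even if all N a vanish.
  obtain ⟨n, hn⟩ : ∃ n, n = ∑ a, N a + 1 := ⟨_, rfl⟩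
  have hn0 : 0 < n := by omega
  refine ⟨n * m, u ^ n, U', Nat.mul_pos hn0 hm, ?_, pow_ne_zero _ h0, fun y h => ?_, S,
    inferInstance, fun a => u ^ n * U'.toRat a, fun a => ?_, ?_⟩
  · rw [mul_smul]; exact hu.pow n
  · rw [mul_smul, CartierDivisor.isGeneratorAt_pow_iff hu hn0] at h
    exact (hy y).mpr h
  · rw [mul_smul]
    refine (hN a n ?_).isSection
    rw [hn]
    exact (Finset.single_le_sum (fun _ _ => Nat.zero_le _) (Finset.mem_univ a)).trans
      (Nat.le_succ _)
  · simpa only [mul_div_cancel_left₀ _ (pow_ne_zero n h0)] using hS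

/-- Some multiple of an ample divisor is generated by finitely many global sections. -/
lemma CartierDivisor.IsAmple.exists_isGeneratorAt [CompactSpace X] (hA : A.IsAmple) :
    ∃ (a : ℕ) (_ : 0 < a) (T : Finset X) (u : X → RatFun X), (∀ i, (a • A).IsSection (u i)) ∧
      ∀ x, ∃ i ∈ T, (a • A).IsGeneratorAt (u i) x := by
  choose m hm s hs U hU hxU hy using hA
  obtain ⟨T, hT⟩ := isCompact_univ.elim_finite_subcover (fun x => (U x : Set X))
    (fun x => (U x).isOpen) fun x _ => Set.mem_iUnion.mpr ⟨x, hxU x⟩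
  classical
  -- The product is a common multiple of the m i for i in T. For other indices the division need not
  -- be exact, so the zero section is used.
  refine ⟨∏ i ∈ T, m i, Finset.prod_pos fun i _ => hm i, T,
    fun i => if i ∈ T then s i ^ ((∏ i ∈ T, m i) / m i) else 0, fun i => ?_, fun x => ?_⟩
  · dsimp only
    split_ifs with hi
    · have h := (hs i).pow ((∏ i ∈ T, m i) / m i)
      rwa [smul_smul, Nat.div_mul_cancel (Finset.dvd_prod_of_mem m hi)] at h
    · exact CartierDivisor.isSection_zero
  · obtain ⟨i, hi, hxi⟩ := Set.mem_iUnion₂.mp (hT (Set.mem_univ x))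
    refine ⟨i, hi, ?_⟩
    obtain ⟨f, hf, h⟩ := (hy i x).mp hxi
    refine ⟨f ^ ((∏ i ∈ T, m i) / m i), ?_, ?_⟩
    · have h' := hf.nsmul ((∏ i ∈ T, m i) / m i)
      rwa [smul_smul, Nat.div_mul_cancel (Finset.dvd_prod_of_mem m hi)] at h'
    · simp only [if_pos hi]
      rw [Units.val_pow_eq_pow_val, ← mul_pow, h, one_pow]

/-- A derivation that vanishes on generators of the function field vanishes. -/
lemma derivation_eq_zero {L : Type} [Field L] {D : Derivation ℤ L L} {G : Set L}
    (hG : Subfield.closure G = ⊤) (h : ∀ t ∈ G, D t = 0) : D = 0 := by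
  refine Derivation.ext fun t => ?_
  have ht : t ∈ Subfield.closure G := hG ▸ Subfield.mem_top t
  rw [Derivation.zero_apply]
  induction ht using Subfield.closure_induction with
  | mem x hx => exact h x hx
  | one => exact D.map_one_eq_zero
  | add x y _ _ hx hy => rw [map_add, hx, hy, add_zero]
  | neg x _ hx => rw [map_neg, hx, neg_zero]
  | inv x _ hx => rw [Derivation.leibniz_inv, hx, smul_zero]
  | mul x y _ _ hx hy => rw [Derivation.leibniz, hx, hy, smul_zero, smul_zero, add_zero]

include p in
lemma charZero_ratFun : CharZero (RatFun X) :=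
  charZero_of_injective_ringHom (constants p).injective

end Ample

/-! ### Nonvanishing of a polynomial on combinations of spanning vectors. -/

section Polynomials

open MvPolynomial in
/-- A nonzero polynomial does not vanish at all combinations with coefficients in an infinite set
of a generating family of vectors. -/
lemma exists_eval_combination_ne_zero {K ι σ : Type} [Field K] [Fintype ι] [Fintype σ]
    {P : MvPolynomial σ K} (hP : P ≠ 0) (v : ι → σ → K)
    (hv : ∀ g : σ → K, (∀ j, ∑ i, v j i * g i = 0) → g = 0) {S : Set K} (hS : S.Infinite) :
    ∃ c : ι → K, (∀ j, c j ∈ S) ∧ eval (fun i => ∑ j, c j * v j i) P ≠ 0 := by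
  classical
  let M : Matrix ι σ K := Matrix.of v
  -- The v j span exactly when pairing with all of them is injective; L is a left inverse of this
  -- pairing.
  obtain ⟨L, hL⟩ := LinearMap.exists_leftInverse_of_injective M.mulVecLin
    (LinearMap.ker_eq_bot'.mpr fun g hg => hv g fun j => congrFun hg j)
  have hLM : L.toMatrix' * M = 1 := by
    rw [← LinearMap.toMatrix'_toLin' M, ← LinearMap.toMatrix'_comp]
    exact (congrArg _ hL).trans LinearMap.toMatrix'_id
  by_contra! h
  -- Q is P composed with the linear map of coefficients c ↦ ∑ c_j v_j. If it vanishes on a product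
  -- of infinite sets it is 0, and substituting L recovers P from Q.
  let Q : MvPolynomial ι K := aeval (fun i => ∑ j, X j * C (v j i)) P
  have hQ : Q = 0 := by
    refine funext_set (fun _ => S) (fun _ => hS) fun c hc => ?_
    rw [map_zero, ← h c fun j => hc j (Set.mem_univ j)]
    change eval c (aeval _ P) = _
    rw [aeval_def, ← coe_eval₂Hom, ← RingHom.comp_apply]
    refine DFunLike.congr_fun (ringHom_ext (g := eval _) (fun a => ?_) fun i => ?_) P
    · simp
    · simp
  refine hP ?_
  have hQP : aeval (fun j => ∑ i, C (L.toMatrix' i j) * X i : ι → MvPolynomial σ K) Q = P := by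
    change aeval _ (aeval _ P) = P
    rw [← AlgHom.comp_apply]
    refine DFunLike.congr_fun (algHom_ext (f := AlgHom.comp _ _) (g := AlgHom.id K _) fun k => ?_) P
    simp only [AlgHom.comp_apply, aeval_X, map_sum, map_mul, AlgHom.id_apply, algHom_C,
      algebraMap_eq, Finset.sum_mul]
    rw [Finset.sum_comm]
    have h1 : ∀ i, ∑ j, C (L.toMatrix' i j) * X i * C (v j k) =
        C ((1 : Matrix σ σ K) i k) * (X i : MvPolynomial σ K) := fun i => by
      rw [← hLM, Matrix.mul_apply, map_sum, Finset.sum_mul]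
      exact Finset.sum_congr rfl fun j _ => by rw [C_mul]; exact mul_right_comm _ _ _
    rw [Finset.sum_congr rfl fun i _ => h1 i, Finset.sum_eq_single k]
    · rw [Matrix.one_apply_eq, C_1, one_mul]
    · intro i _ hik
      rw [Matrix.one_apply_ne hik, C_0, zero_mul]
    · simp
  rw [← hQP, hQ, map_zero]

end Polynomials

/-! ### Evaluating symmetric tensors of derivations at a rational function. -/

section Bound

variable {X : Scheme.{0}} [IsIntegral X] (p : X ⟶ Spec (.of ℂ))

lemma isSection_constants (c : ℂ) : (0 : CartierDivisor X).IsSection (constants p c) :=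
  CartierDivisor.isSection_zero_iff.mpr fun x => by
    change stalkToRat X (genericPoint X) (X.presheaf.germ ⊤ _ _ _) ∈ _
    rw [stalkToRat_germ]
    exact germRat_mem_localRing _ _ _ trivial

lemma CartierDivisor.IsSection.sum {D : CartierDivisor X} {ι : Type} (T : Finset ι)
    {s : ι → RatFun X} (h : ∀ i ∈ T, D.IsSection (s i)) : D.IsSection (∑ i ∈ T, s i) :=
  Finset.sum_induction _ D.IsSection (fun _ _ => .add) isSection_zero h

/-- The derivations evaluated at a rational function. -/
def derivationRealization (t : RatFun X) : (tangentSheaf p).Realization (RatFun X) where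
  κ := RingHom.id _
  τ D := D t
  map_add _ _ _ _ _ := rfl
  map_smul _ _ _ _ := rfl

variable [LocallyOfFiniteType p]

/-- In a basis of F(V) a symmetric tensor is a polynomial, and its value depends only on the values
of the basis. This makes nonvanishing a question about polynomials. -/
lemma RatSheaf.Realization.eval_eq_eval_map {W E : Type} [AddCommGroup W] [Module (RatFun X) W]
    [Field E] {F : RatSheaf X W} (ρ : F.Realization E) {V : AffOpen X} {σ : Type}
    (b : Module.Basis σ Γ(X, V.toOpens) (F.Sec V)) (P : SymmetricAlgebra Γ(X, V.toOpens) (F.Sec V)) :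
    ρ.eval V P = MvPolynomial.eval (fun i => ρ.τ (b i)) (MvPolynomial.map (ρ.κ.comp V.toRat)
      (SymmetricAlgebra.equivMvPolynomial b P)) := by
  obtain ⟨Q, rfl⟩ := (SymmetricAlgebra.equivMvPolynomial b).symm.surjective P
  rw [AlgEquiv.apply_symm_apply]
  refine DFunLike.congr_fun (MvPolynomial.ringHom_ext
    (f := (ρ.eval V).comp (SymmetricAlgebra.equivMvPolynomial b).symm.toRingHom)
    (g := (MvPolynomial.eval _).comp (MvPolynomial.map (ρ.κ.comp V.toRat)))
    (fun a => ?_) fun i => ?_) Q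
  · rw [RingHom.comp_apply, RingHom.comp_apply, MvPolynomial.map_C, MvPolynomial.eval_C]
    change ρ.eval V ((SymmetricAlgebra.equivMvPolynomial b).symm (MvPolynomial.C a)) = _
    rw [← MvPolynomial.algebraMap_eq, AlgEquiv.commutes, eval_algebraMap]
    rfl
  · rw [RingHom.comp_apply, RingHom.comp_apply, MvPolynomial.map_X, MvPolynomial.eval_X]
    change ρ.eval V ((SymmetricAlgebra.equivMvPolynomial b).symm (MvPolynomial.X i)) = _
    rw [SymmetricAlgebra.equivMvPolynomial_symm_X, eval_ι]

lemma exists_derivation_ne_zero [(tangentSheaf p).IsLocallyFree] :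
    ∃ D : Derivation ℤ (RatFun X) (RatFun X), D ≠ 0 ∧ ∀ c, D (constants p c) = 0 := by
  obtain ⟨V, n, hn, e, -, he⟩ := RatSheaf.IsLocallyFree.exists_free (F := tangentSheaf p)
    (genericPoint X)
  exact ⟨e ⟨0, hn⟩, he.indep.ne_zero _, (he.mem _).1⟩

/-- Evaluation of a symmetric tensor at `t = x / y` has a denominator `y ^ (2 r)`. -/
lemma pow_mul_eval_derivationRealization_mem {V : AffOpen X} {t : RatFun X} {x y : Γ(X, V.toOpens)}
    (ht : t * V.toRat y = V.toRat x) {r : ℕ}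
    {P : SymmetricAlgebra Γ(X, V.toOpens) ((tangentSheaf p).Sec V)} (hP : P ∈ symPow _ _ r) :
    V.toRat y ^ (2 * r) * (derivationRealization p t).eval V P ∈ V.toRat.range := by
  unfold symPow at hP
  induction hP using Submodule.pow_induction_on_left' with
  | algebraMap a =>
    rw [mul_zero, pow_zero, one_mul, RatSheaf.Realization.eval_algebraMap]
    exact ⟨a, rfl⟩
  | add P Q i _ _ hP hQ => rw [map_add, mul_add]; exact add_mem hP hQ
  | mem_mul D hD i P _ ih =>
    obtain ⟨D, rfl⟩ := hD
    -- The quotient rule: y² D(x/y) = y D(x) - x D(y). Each linear factor thus costs a factor y².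
    have h1 : V.toRat y ^ 2 * D.1 t ∈ V.toRat.range := by
      have h2 := congrArg D.1 ht
      rw [Derivation.leibniz, smul_eq_mul, smul_eq_mul] at h2
      have h3 : V.toRat y ^ 2 * D.1 t = V.toRat y * D.1 (V.toRat x) -
          V.toRat x * D.1 (V.toRat y) := by
        rw [← h2, ← ht]; ring
      rw [h3]
      exact sub_mem (mul_mem ⟨y, rfl⟩ (D.2.2 x)) (mul_mem ⟨x, rfl⟩ (D.2.2 y))
    have h4 := mul_mem h1 ih
    rw [map_mul, RatSheaf.Realization.eval_ι]
    convert h4 using 1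
    change _ * (D.1 t * _) = _
    rw [Nat.succ_eq_add_one, mul_add, pow_add]
    ring

/-- A nonzero symmetric tensor can be evaluated at some rational function. -/
lemma exists_eval_derivationRealization_ne_zero {V : AffOpen X} {n : ℕ}
    {e : Fin n → Derivation ℤ (RatFun X) (RatFun X)} (he : (tangentSheaf p).IsFreeOn V e)
    {P : SymmetricAlgebra Γ(X, V.toOpens) ((tangentSheaf p).Sec V)} (hP : P ≠ 0) {ι : Type}
    [Fintype ι] {t : ι → RatFun X}
    (ht : Subfield.closure (Set.range (constants p) ∪ Set.range t) = ⊤) :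
    ∃ c : ι → ℂ, (derivationRealization p (∑ j, constants p (c j) * t j)).eval V P ≠ 0 := by
  have hP' : MvPolynomial.map V.toRat (SymmetricAlgebra.equivMvPolynomial he.basis P) ≠ 0 := by
    intro h
    rw [← map_zero (MvPolynomial.map V.toRat)] at h
    have h1 := MvPolynomial.map_injective _ V.toRat_injective h
    exact hP ((map_eq_zero_iff _ (SymmetricAlgebra.equivMvPolynomial he.basis).injective).mp h1)
  -- The vectors (e_i(t_j))_i span: a combination of the e_i killing all generators t_j of the
  -- function field is the zero derivation, so its coefficients vanish.
  obtain ⟨c, hc, h⟩ := exists_eval_combination_ne_zero hP' (fun j i => e i (t j)) (fun g hg => by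
    have h1 : ∑ i, g i • e i = 0 := by
      have hs : ∀ x, (∑ i, g i • e i) x = ∑ i, g i * e i x := fun x => by
        rw [← Derivation.coeFnAddMonoidHom_apply, map_sum, Finset.sum_apply]
        rfl
      refine derivation_eq_zero ht ?_
      rintro _ (⟨c, rfl⟩ | ⟨j, rfl⟩)
      · rw [hs]
        exact Finset.sum_eq_zero fun i _ => by rw [(he.mem i).1, mul_zero]
      · rw [hs, ← hg j]
        exact Finset.sum_congr rfl fun i _ => mul_comm _ _
    exact funext fun i => Fintype.linearIndependent_iff.mp he.indep g h1 i)
    (Set.infinite_range_of_injective (constants p).injective)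
  choose c' hc' using hc
  refine ⟨c', ?_⟩
  rw [RatSheaf.Realization.eval_eq_eval_map _ he.basis]
  have hid : (derivationRealization p (∑ j, constants p (c' j) * t j)).κ.comp V.toRat = V.toRat :=
    RingHom.id_comp _
  rw [hid]
  convert h using 4 with i
  rw [he.coe_basis]
  change e i (∑ j, constants p (c' j) * t j) = _
  rw [map_sum]
  refine Finset.sum_congr rfl fun j _ => ?_
  rw [Derivation.leibniz, (he.mem i).1, smul_zero, add_zero, hc', smul_eq_mul]

end Bound

/-! ### No sections of negative multiples, and the bound d ≤ 2rm. -/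

section ProperBound

variable {X : Scheme.{0}} [IsIntegral X] (p : X ⟶ Spec (.of ℂ)) [IsProper p]
  {A : CartierDivisor X}

/-- Negative multiples of an ample divisor have no nonzero sections. -/
lemma CartierDivisor.IsAmple.eq_zero_of_isSection [(tangentSheaf p).IsLocallyFree]
    (hA : A.IsAmple) {k : ℤ} (hk : k < 0) {t : RatFun X} (ht : (k • A).IsSection t) : t = 0 := by
  have : CompactSpace X := (quasiCompact_iff_compactSpace p).mp inferInstance
  have := charZero_ratFun p
  obtain ⟨m, s₀, -, hm, hs₀, h0, -, ι, -, s, hs, htop⟩ := hA.exists_generators p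
  obtain ⟨l, rfl⟩ := Int.exists_eq_neg_ofNat hk.le
  have hl : 0 < l := by omega
  by_contra ht0
  obtain ⟨D, hD0, hD⟩ := exists_derivation_ne_zero p
  -- The function s^l t^m is a section of l(mA) + m(-lA) = 0, hence a constant.
  have key : ∀ s, (m • A).IsSection s → ∃ c, constants p c = s ^ l * t ^ m := by
    intro s hs
    refine mem_range_constants p (isSection_zero_iff.mp ?_)
    have h := (hs.pow l).mul (ht.pow m)
    have h2 : l • m • A + m • -(l : ℤ) • A = 0 := by
      rw [neg_smul, natCast_zsmul, smul_neg, smul_smul, smul_smul, mul_comm, add_neg_cancel]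
    rwa [h2] at h
  refine hD0 (derivation_eq_zero htop ?_)
  rintro _ (⟨c, rfl⟩ | ⟨j, rfl⟩)
  · exact hD c
  · obtain ⟨c₀, hc₀⟩ := key s₀ hs₀
    obtain ⟨c, hc⟩ := key (s j) (hs j)
    -- Differentiating gives l (s_j/s_0)^(l-1) D(s_j/s_0) = 0, and in characteristic zero D kills
    -- the generator.
    have h1 : (s j / s₀) ^ l = constants p (c / c₀) := by
      rw [map_div₀, hc₀, hc, mul_div_mul_right _ _ (pow_ne_zero m ht0), div_pow]
    have h2 := D.leibniz_pow (s j / s₀) l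
    rw [h1, hD] at h2
    by_cases h3 : s j / s₀ = 0
    · simp only [h3, map_zero]
    · have h4 := h2.symm
      rw [smul_eq_zero, smul_eq_zero] at h4
      rcases h4 with h4 | h4 | h4
      · omega
      · exact absurd h4 (pow_ne_zero _ h3)
      · exact h4

/-- The twists of symmetric tensors with a nonzero section are bounded. -/
lemma CartierDivisor.IsAmple.exists_bound [(tangentSheaf p).IsLocallyFree]
    (hA : A.IsAmple) : ∃ m : ℕ, ∀ (d : ℤ) (r : ℕ),
      (∃ s ∈ globalSymTwist (tangentSheaf p) r (-d • A), s ≠ 0) → d ≤ 2 * r * m := by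
  have : CompactSpace X := (quasiCompact_iff_compactSpace p).mp inferInstance
  obtain ⟨m, s₀, -, hm, hs₀, h0, -, ι, hι, s, hs, htop⟩ := hA.exists_generators p
  have := Fintype.ofFinite ι
  refine ⟨m, ?_⟩
  rintro d r ⟨z, hz, hz0⟩
  obtain ⟨ξ, τ, hτ⟩ := exists_isTautologicalFor (tangentSheaf p)
  have := hτ.isFaithful
  obtain ⟨U, hU⟩ := Function.ne_iff.mp hz0
  obtain ⟨V', n, hn, e, hV', -, he'⟩ := (tangentSheaf p).exists_free U U.genericPoint_mem
  obtain ⟨V, f, hV, -, hf⟩ := exists_affOpen_isEquationAt (-d • A) V' V'.genericPoint_mem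
  have he := he'.mono hV
  -- One P serves every realization: its nonvanishing is checked in K(P(T_X)) and then used for
  -- derivations evaluated at t.
  obtain ⟨P, hP, hPz⟩ := RatSheaf.Realization.exists_forall_eval_eq hf (z V)
  have hP0 : P ≠ 0 := by
    rintro rfl
    have h1 := hPz _ hτ.realization
    rw [map_zero, mul_eq_zero, or_iff_left ((map_ne_zero _).mpr f.ne_zero),
      hτ.realization.twistEval_eq_of_mem hz V U] at h1
    exact hU (hτ.realization.eq_zero_of_twistEval_eq_zero U h1)
  obtain ⟨c, hc⟩ := exists_eval_derivationRealization_ne_zero p he hP0 htop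
  generalize ht : ∑ j, constants p (c j) * (s j / s₀) = t at hc
  have ht' : (m • A).IsSection (t * s₀) := by
    rw [← ht, Finset.sum_mul]
    refine IsSection.sum _ fun j _ => ?_
    rw [mul_assoc, div_mul_cancel₀ _ h0, ← zero_add (m • A)]
    exact (isSection_constants p (c j)).mul (hs j)
  obtain ⟨ψ, hψ⟩ : ∃ ψ, ψ = (derivationRealization p t).twistEval r (-d • A) V (z V) := ⟨_, rfl⟩
  have hψ0 : ψ ≠ 0 := by
    intro h
    refine hc ?_
    rw [← hPz _ (derivationRealization p t), ← hψ, h, zero_mul]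
  by_contra! hd
  -- Locally t = a / b, where a and b are t s₀ and s₀ times an equation of mA, so b^(2r) clears the
  -- denominator of the tensor evaluated at t.
  have h2 : ((2 * r * m - d : ℤ) • A).IsSection (s₀ ^ (2 * r) * ψ) := by
    refine isSection_of_exists fun x => ?_
    obtain ⟨V₁, hxV₁, -⟩ := exists_affOpen_mem ⊤ x trivial
    obtain ⟨V₂, g, -, hx, hg⟩ := exists_affOpen_isEquationAt A V₁ hxV₁
    refine ⟨_, (hg x hx).zsmul _, ?_⟩
    obtain ⟨Q, hQ, hQz⟩ := RatSheaf.Realization.exists_forall_eval_eq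
      (fun y hy => (hg y hy).zsmul (-d)) (z V₂)
    have h3 := hQz _ (derivationRealization p t)
    rw [RatSheaf.Realization.twistEval_eq_of_mem _ hz V₂ V, ← hψ] at h3
    obtain ⟨b, hb⟩ := (mem_sheaf_iff_of_isEquationAt (m • A) fun y hy => (hg y hy).nsmul m).mp
      (hs₀.mem_sheaf V₂)
    obtain ⟨a, ha⟩ := (mem_sheaf_iff_of_isEquationAt (m • A) fun y hy => (hg y hy).nsmul m).mp
      (ht'.mem_sheaf V₂)
    obtain ⟨w, hw⟩ := pow_mul_eval_derivationRealization_mem p (t := t) (x := a) (y := b)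
      (by rw [hb, ha, mul_assoc]) hQ
    have h4 := V₂.toRat_mem_localRing w hx
    rw [hw, ← h3, hb] at h4
    convert h4 using 1
    change _ = (s₀ * ((g ^ m : (RatFun X)ˣ) : RatFun X)) ^ (2 * r) *
      (ψ * ((g ^ (-d) : (RatFun X)ˣ) : RatFun X))
    rw [sub_eq_add_neg, zpow_add, show (2 * r * m : ℤ) = ((m * (2 * r) : ℕ) : ℤ) by
      push_cast; ring, zpow_natCast, pow_mul g, Units.val_mul, mul_pow,
      Units.val_pow_eq_pow_val _ (2 * r)]
    ring
  exact mul_ne_zero (pow_ne_zero _ h0) hψ0 (hA.eq_zero_of_isSection p (by linarith) h2)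

end ProperBound

/-! ### From real effective combinations to integral ones. -/

section RationalApproximation

open scoped TensorProduct

/-- Finitely many real numbers can be approximated by a `ℚ`-linear map to `ℚ`. -/
lemma exists_rat_linearMap (T : Finset ℝ) {δ : ℝ} (hδ : 0 < δ) :
    ∃ l : ℝ →ₗ[ℚ] ℚ, l 1 = 1 ∧ ∀ x ∈ T, |(l x : ℝ) - x| < δ := by
  classical
  have h1 : LinearIndepOn ℚ id {(1 : ℝ)} := LinearIndepOn.singleton one_ne_zero
  let b := Module.Basis.extend h1
  -- C x bounds the displacement of x when every vector of a ℚ-basis of ℝ containing 1 is displaced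
  -- by at most 1.
  let C : ℝ → ℝ := fun x => ∑ i ∈ (b.repr x).support, |((b.repr x i : ℚ) : ℝ)|
  have hC : ∀ x, 0 ≤ C x := fun x => Finset.sum_nonneg fun _ _ => abs_nonneg _
  have hC' : 0 < 1 + ∑ x ∈ T, C x := by
    have := Finset.sum_nonneg fun x (_ : x ∈ T) => hC x
    linarith
  -- Each basis vector is sent to a rational at this distance, with 1 fixed; the summand 1 in the
  -- denominator makes it positive and the final inequality strict.
  have hq : ∀ y : ℝ, ∃ q : ℚ, |(q : ℝ) - y| ≤ δ / (1 + ∑ x ∈ T, C x) ∧ (y = 1 → q = 1) := by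
    intro y
    by_cases hy : y = 1
    · exact ⟨1, by rw [hy, Rat.cast_one, sub_self, abs_zero]; positivity, fun _ => rfl⟩
    · obtain ⟨q, hq1, hq2⟩ := exists_rat_btwn (lt_add_of_pos_right y (div_pos hδ hC'))
      exact ⟨q, by rw [abs_of_pos (by linarith)]; linarith, fun h => absurd h hy⟩
  choose q hq hq1 using hq
  refine ⟨b.constr ℚ fun i => q i, ?_, fun x hx => ?_⟩
  · have hm : (1 : ℝ) ∈ h1.extend (Set.subset_univ _) := h1.subset_extend _ rfl
    have h2 := b.constr_basis ℚ (fun i => q i) ⟨1, hm⟩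
    rwa [Module.Basis.extend_apply_self, hq1 _ rfl] at h2
  · have h2 : ((b.constr ℚ fun i => q i) x : ℝ) - x =
        ∑ i ∈ (b.repr x).support, ((b.repr x i : ℚ) : ℝ) * ((q i : ℝ) - i) := by
      have h3 : x = ∑ i ∈ (b.repr x).support, ((b.repr x i : ℚ) : ℝ) * (i : ℝ) := by
        conv_lhs => rw [← b.linearCombination_repr x, Finsupp.linearCombination_apply,
          Finsupp.sum]
        refine Finset.sum_congr rfl fun i _ => ?_
        rw [Module.Basis.extend_apply_self, Rat.smul_def]
      have h4 : ((b.constr ℚ fun i => q i) x : ℝ) =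
          ∑ i ∈ (b.repr x).support, ((b.repr x i : ℚ) : ℝ) * (q i : ℝ) := by
        rw [b.constr_apply, Finsupp.sum, Rat.cast_sum]
        refine Finset.sum_congr rfl fun i _ => ?_
        rw [smul_eq_mul, Rat.cast_mul]
      simp only [mul_sub, Finset.sum_sub_distrib]
      rw [h4, ← h3]
    rw [h2]
    refine (Finset.abs_sum_le_sum_abs _ _).trans_lt ?_
    have h5 : ∑ i ∈ (b.repr x).support, |((b.repr x i : ℚ) : ℝ) * ((q i : ℝ) - i)| ≤
        C x * (δ / (1 + ∑ x ∈ T, C x)) := by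
      rw [Finset.sum_mul]
      refine Finset.sum_le_sum fun i _ => ?_
      rw [abs_mul]
      exact mul_le_mul_of_nonneg_left (hq _) (abs_nonneg _)
    refine h5.trans_lt ?_
    have h6 : C x ≤ ∑ x ∈ T, C x := Finset.single_le_sum (fun y _ => hC y) hx
    rw [mul_div_assoc', div_lt_iff₀ hC', mul_comm]
    exact mul_lt_mul_of_pos_left (by linarith) hδ

/-- ℚ ⊗ G is the localization of G at the nonzero integers, so the kernel of G → ℚ ⊗ G is torsion.
-/
lemma exists_nsmul_eq_zero_of_rat_tmul {G : Type} [AddCommGroup G] {g : G}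
    (h : (1 : ℚ) ⊗ₜ[ℤ] g = 0) : ∃ n : ℕ, 0 < n ∧ n • g = 0 := by
  have : IsLocalizedModule (nonZeroDivisors ℤ) (TensorProduct.mk ℤ ℚ G 1) :=
    (isLocalizedModule_iff_isBaseChange _ ℚ _).mpr (TensorProduct.isBaseChange ℤ G ℚ)
  obtain ⟨⟨n, hn⟩, h⟩ := (IsLocalizedModule.eq_zero_iff (nonZeroDivisors ℤ)
    (TensorProduct.mk ℤ ℚ G 1)).mp h
  refine ⟨n.natAbs, Int.natAbs_pos.mpr (nonZeroDivisors.ne_zero hn), ?_⟩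
  have h' : n • g = 0 := h
  rcases Int.natAbs_eq n with hh | hh
  · rwa [hh, natCast_zsmul] at h'
  · rwa [hh, neg_smul, neg_eq_zero, natCast_zsmul] at h'

/-- A real effective decomposition can be approximated by an integral one. -/
lemma exists_integral_decomposition {G : Type} [AddCommGroup G] {x a : G} {ε : ℝ} {k : ℕ}
    {c : Fin k → NNReal} {e : Fin k → G}
    (h : (1 : ℝ) ⊗ₜ[ℤ] x - ε ⊗ₜ[ℤ] a = ∑ i, (c i : ℝ) ⊗ₜ[ℤ] e i) {δ : ℝ} (hδ : 0 < δ) :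
    ∃ (N : ℕ) (d : ℤ) (n : Fin k → ℕ), 0 < N ∧ ε - δ < d / N ∧
      N • x - d • a = ∑ i, n i • e i := by
  classical
  -- An error below every nonzero c i keeps l(c i) nonnegative, and an error below δ keeps l(ε)
  -- above ε - δ. Coefficients equal to 0 stay 0 by linearity.
  obtain ⟨η, hη, hηδ, hηc⟩ : ∃ η : ℝ, 0 < η ∧ η ≤ δ ∧ ∀ i, c i ≠ 0 → η ≤ c i := by
    have h1 : ∀ᶠ η : ℝ in nhdsWithin 0 (Set.Ioi 0), 0 < η := self_mem_nhdsWithin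
    have h2 : ∀ {y : ℝ}, 0 < y → ∀ᶠ η : ℝ in nhdsWithin 0 (Set.Ioi 0), η ≤ y := fun hy =>
      (Filter.Eventually.filter_mono nhdsWithin_le_nhds (eventually_le_nhds hy))
    have h3 : ∀ᶠ η : ℝ in nhdsWithin 0 (Set.Ioi 0), ∀ i, c i ≠ 0 → η ≤ c i :=
      Filter.eventually_all.mpr fun i => by
        by_cases hi : c i = 0
        · simp [hi]
        · filter_upwards [h2 (NNReal.coe_pos.mpr (pos_iff_ne_zero.mpr hi))] with η hη _ using hη
    exact (h1.and ((h2 hδ).and h3)).exists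
  obtain ⟨l, hl1, hl⟩ := exists_rat_linearMap (insert ε (Finset.univ.image fun i => (c i : ℝ))) hη
  have hε : ε - δ < l ε := by
    have := (abs_lt.mp (hl ε (Finset.mem_insert_self _ _))).1
    linarith
  have hc : ∀ i, 0 ≤ l (c i) := by
    intro i
    by_cases hi : c i = 0
    · rw [hi, NNReal.coe_zero, map_zero]
    · have := (abs_lt.mp (hl (c i) (Finset.mem_insert_of_mem
        (Finset.mem_image_of_mem _ (Finset.mem_univ i))))).1
      have h2 := hηc i hi
      have h3 : (0 : ℝ) < l (c i) := by linarith
      exact_mod_cast h3.le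
  have h1 : (1 : ℚ) ⊗ₜ[ℤ] x - l ε ⊗ₜ[ℤ] a = ∑ i, l (c i) ⊗ₜ[ℤ] e i := by
    have := congrArg (TensorProduct.map (l.restrictScalars ℤ) (LinearMap.id (M := G))) h
    simpa [hl1] using this
  obtain ⟨N, hN⟩ : ∃ N : ℕ, N = (l ε).den * ∏ i, (l (c i)).den := ⟨_, rfl⟩
  have hN0 : 0 < N := hN ▸ Nat.mul_pos (l ε).den_pos (Finset.prod_pos fun i _ => (l (c i)).den_pos)
  have hd : ∀ q : ℚ, q.den ∣ N → ∃ d : ℤ, (d : ℚ) = N * q := by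
    rintro q ⟨k, hk⟩
    refine ⟨k * q.num, ?_⟩
    rw [hk, Int.cast_mul, Nat.cast_mul, Int.cast_natCast, mul_comm (q.den : ℚ), mul_assoc,
      Rat.den_mul_eq_num]
  obtain ⟨d, hdN⟩ := hd (l ε) (hN ▸ dvd_mul_right _ _)
  choose n hn using fun i => hd (l (c i))
    (hN ▸ (Finset.dvd_prod_of_mem (fun i => (l (c i)).den) (Finset.mem_univ i)).mul_left _)
  have hn0 : ∀ i, 0 ≤ n i := fun i => by
    have : (0 : ℚ) ≤ n i := by rw [hn]; exact mul_nonneg (Nat.cast_nonneg _) (hc i)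
    exact_mod_cast this
  have hmove : ∀ (k : ℤ) (g : G), (k : ℚ) ⊗ₜ[ℤ] g = (1 : ℚ) ⊗ₜ[ℤ] (k • g) := fun k g => by
    rw [TensorProduct.tmul_smul, TensorProduct.smul_tmul', zsmul_one]
  have h2 : (1 : ℚ) ⊗ₜ[ℤ] ((N : ℤ) • x - d • a - ∑ i, n i • e i) = 0 := by
    rw [TensorProduct.tmul_sub, TensorProduct.tmul_sub, TensorProduct.tmul_sum, ← hmove, ← hmove,
      Finset.sum_congr rfl fun i _ => (hmove (n i) (e i)).symm, hdN,
      Finset.sum_congr rfl fun i _ => by rw [hn i], sub_eq_zero]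
    have h3 := congrArg ((N : ℤ) • ·) h1
    simp only [smul_sub, Finset.smul_sum, TensorProduct.smul_tmul', zsmul_eq_mul, mul_one] at h3
    exact_mod_cast h3
  -- The integral relation holds up to torsion killed by M; multiplying it by M does not change d /
  -- N.
  obtain ⟨M, hM0, hM⟩ := exists_nsmul_eq_zero_of_rat_tmul h2
  refine ⟨M * N, M * d, fun i => M * (n i).toNat, Nat.mul_pos hM0 hN0, ?_, ?_⟩
  · have h4 : ((d : ℝ)) = N * (l ε : ℝ) := by exact_mod_cast congrArg (Rat.cast (K := ℝ)) hdN
    have hM' : (M : ℝ) ≠ 0 := by exact_mod_cast hM0.ne'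
    have hN' : (N : ℝ) ≠ 0 := by exact_mod_cast hN0.ne'
    push_cast
    rw [h4, mul_div_mul_left _ _ hM', mul_div_cancel_left₀ _ hN']
    exact hε
  · rw [smul_sub, smul_sub, sub_eq_zero] at hM
    rw [mul_smul, mul_smul, natCast_zsmul, ← natCast_zsmul x N, hM, Finset.smul_sum]
    refine Finset.sum_congr rfl fun i _ => ?_
    rw [mul_smul, ← natCast_zsmul _ (n i).toNat, Int.toNat_of_nonneg (hn0 i)]

end RationalApproximation

/-! ### Sections of Sym^r F ⊗ O(D) versus sections of O(rξ + π^*D). -/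

section SymmetricSections

variable {X : Scheme.{0}} [IsIntegral X] {W : Type} [AddCommGroup W] [Module (RatFun X) W]
  {F : RatSheaf X W}

/-- A realization is linear only over regular functions; over a smaller affine set f is a quotient a
/ b of such, and multiplication by b reduces to them. -/
lemma RatSheaf.Realization.map_smul_of_mem {E : Type} [Field E] (ρ : F.Realization E)
    {U V : AffOpen X} {w : W} {f : RatFun X} (hw : w ∈ F.sec U) (hf : f • w ∈ F.sec V) :
    ρ.τ (f • w) = ρ.κ f * ρ.τ w := by
  obtain ⟨V', hU, hV, -⟩ := exists_affOpen_le_le U V (genericPoint X) U.genericPoint_mem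
    V.genericPoint_mem
  let _ := V'.toRat.toAlgebra
  have := V'.isFractionRing
  obtain ⟨a, b, hb, rfl⟩ := IsFractionRing.div_surjective (A := Γ(X, V'.toOpens)) f
  change ρ.τ ((V'.toRat a / V'.toRat b) • w) = ρ.κ (V'.toRat a / V'.toRat b) * ρ.τ w
  have hb0 : V'.toRat b ≠ 0 := by
    rw [map_ne_zero_iff _ V'.toRat_injective]
    exact nonZeroDivisors.ne_zero hb
  have h1 := ρ.map_smul V' b _ (F.mono hV hf)
  have h2 : V'.toRat b • (V'.toRat a / V'.toRat b) • w = V'.toRat a • w := by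
    rw [smul_smul, mul_div_cancel₀ _ hb0]
  have h3 : ρ.τ (V'.toRat b • (V'.toRat a / V'.toRat b) • w) = ρ.κ (V'.toRat b) *
      ρ.τ ((V'.toRat a / V'.toRat b) • w) := h1
  rw [h2, ρ.map_smul V' a w (F.mono hU hw)] at h3
  have hb1 : ρ.κ (V'.toRat b) ≠ 0 := (map_ne_zero _).mpr hb0
  apply mul_left_cancel₀ hb1
  rw [← h3, ← mul_assoc, ← map_mul, mul_div_cancel₀ _ hb0]

variable [F.IsQuasiCoherent] [F.IsLocallyFree] {ξ : CartierDivisor (projectivization F)}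
  {τ : W → RatFun (projectivization F)}

namespace IsTautologicalFor

variable (h : IsTautologicalFor ξ τ)

include h

/-- `H⁰(X, Sym^r F ⊗ O(D))` is `H⁰(P(F), O(r ξ + π^* D))`. -/
lemma exists_globalSymTwist_iff {r : ℕ} {D : CartierDivisor X} :
    (∃ s ∈ globalSymTwist F r D, s ≠ 0) ↔
      ∃ φ, φ ≠ 0 ∧ (r • ξ + D.pullback (projectivizationMap F)).IsSection φ := by
  have := h.isFaithful
  constructor
  · rintro ⟨s, hs, h0⟩
    obtain ⟨U, hU⟩ := Function.ne_iff.mp h0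
    refine ⟨h.realization.twistEval r D U (s U), fun h1 =>
      hU (h.realization.eq_zero_of_twistEval_eq_zero U h1), h.isSection_of_exists fun x => ?_⟩
    obtain ⟨U', hx, -⟩ := exists_affOpen_mem ⊤ x trivial
    obtain ⟨V, f, -, hxV, hf⟩ := exists_affOpen_isEquationAt D U' hx
    obtain ⟨P, hP, h1⟩ := RatSheaf.Realization.exists_forall_eval_eq hf (s V)
    refine ⟨V, f, hxV, hf, P, hP, ?_⟩
    rw [← h1 _ h.realization, h.realization.twistEval_eq_of_mem hs V U]
    rfl
  · rintro ⟨φ, h0, hφ⟩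
    obtain ⟨s, hs, h1⟩ := h.realization.exists_globalSymTwist φ
      (h.exists_eval_of_isSection hφ)
    refine ⟨s, hs, ?_⟩
    rintro rfl
    obtain ⟨U, -, -⟩ := exists_affOpen_mem ⊤ (genericPoint X) trivial
    exact h0 (by rw [← h1 U, Pi.zero_apply, map_zero])

/-- The case r = 1 of the dictionary, with value π^*g · τ(w). The factor g is kept apart because it
is the product g w, not w, that is globally defined. -/
lemma isSection_of_isTwistedSection {D : CartierDivisor X} {U : AffOpen X} {g : RatFun X} {w : W}
    (hw : w ∈ F.sec U) (hgw : F.IsTwistedSection D (g • w)) :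
    (ξ + D.pullback (projectivizationMap F)).IsSection
      (pullbackFunction (projectivizationMap F) g * τ w) := by
  rw [← one_smul ℕ ξ]
  refine h.isSection_of_exists fun x => ?_
  obtain ⟨V, f, hxV, hf, hfw⟩ := hgw x
  refine ⟨V, f, hxV, hf, _, ι_mem_symPow _ ⟨_, hfw⟩, ?_⟩
  rw [RatSheaf.Realization.eval_ι]
  dsimp only
  rw [smul_smul] at hfw ⊢
  rw [h.realization.map_smul_of_mem hw hfw, map_mul]
  change pullbackFunction (projectivizationMap F) g * τ w * _ =
    pullbackFunction (projectivizationMap F) f * pullbackFunction (projectivizationMap F) g * τ w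
  ring

end IsTautologicalFor

end SymmetricSections

/-! ### Classes in Pic ⊗ ℝ and approximation of effective ones. -/

section Thresholds

variable {X : Scheme.{0}} [IsIntegral X]

lemma CartierDivisor.cls_add (D E : CartierDivisor X) : (D + E).cls = D.cls + E.cls :=
  TensorProduct.tmul_add (R := ℤ) (1 : ℝ) (D : PicGroup X) (E : PicGroup X)

lemma CartierDivisor.cls_zsmul (D : CartierDivisor X) (k : ℤ) : (k • D).cls = (k : ℝ) • D.cls := by
  change TensorProduct.tmul ℤ (1 : ℝ) (k • (QuotientAddGroup.mk D : PicGroup X)) = _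
  rw [TensorProduct.tmul_smul, CartierDivisor.cls, TensorProduct.smul_tmul',
    TensorProduct.smul_tmul', zsmul_one, smul_eq_mul, mul_one]

lemma CartierDivisor.cls_nsmul (D : CartierDivisor X) (k : ℕ) : (k • D).cls = (k : ℝ) • D.cls := by
  rw [← natCast_zsmul, cls_zsmul, Int.cast_natCast]

lemma CartierDivisor.cls_principalDivisor (f : Additive (RatFun X)ˣ) :
    (principalDivisor X f).cls = 0 := by
  have : (QuotientAddGroup.mk (principalDivisor X f) : PicGroup X) = 0 :=
    (QuotientAddGroup.eq_zero_iff _).mpr ⟨f, rfl⟩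
  rw [CartierDivisor.cls, this, TensorProduct.tmul_zero]

/-- A divisor with a nonzero section has an effective class. -/
lemma CartierDivisor.IsSection.cls_mem {D : CartierDivisor X} {s : RatFun X} (hs : D.IsSection s)
    (h0 : s ≠ 0) : D.cls ∈ effectiveCone X := by
  refine Submodule.subset_span ⟨_, IsSection.isEffective (Units.mk0 s h0) hs, ?_⟩
  rw [cls_add, cls_principalDivisor, add_zero]

lemma mem_effectiveCone_iff {x : RealPic X} : x ∈ effectiveCone X ↔
    ∃ (k : ℕ) (c : Fin k → NNReal) (E : Fin k → CartierDivisor X), (∀ i, (E i).IsEffective) ∧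
      x = ∑ i, TensorProduct.tmul ℤ (c i : ℝ) (QuotientAddGroup.mk (E i) : PicGroup X) := by
  have hsm : ∀ (c : NNReal) (E : CartierDivisor X), c • E.cls =
      TensorProduct.tmul ℤ (c : ℝ) (QuotientAddGroup.mk E : PicGroup X) := fun c E => by
    rw [CartierDivisor.cls, NNReal.smul_def, TensorProduct.smul_tmul', smul_eq_mul, mul_one]
  unfold effectiveCone
  rw [Submodule.mem_span_set']
  constructor
  · rintro ⟨k, c, g, rfl⟩
    choose E hE hE' using fun i => (g i).2
    exact ⟨k, c, E, hE, Finset.sum_congr rfl fun i _ => by rw [← hE', hsm]⟩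
  · rintro ⟨k, c, E, hE, rfl⟩
    exact ⟨k, c, fun i => ⟨_, E i, hE i, rfl⟩, Finset.sum_congr rfl fun i _ => hsm _ _⟩

/-- A linear combination of divisor classes that is effective is approximated by divisors with
sections. -/
lemma exists_isSection_of_mem_effectiveCone {D E : CartierDivisor X} {ε : ℝ}
    (h : D.cls - ε • E.cls ∈ effectiveCone X) {δ : ℝ} (hδ : 0 < δ) :
    ∃ (N : ℕ) (d : ℤ), 0 < N ∧ ε - δ < d / N ∧ ∃ s, s ≠ 0 ∧ (N • D + -d • E).IsSection s := by
  obtain ⟨k, c, B, hB, h⟩ := mem_effectiveCone_iff.mp h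
  rw [CartierDivisor.cls, CartierDivisor.cls, TensorProduct.smul_tmul', smul_eq_mul, mul_one] at h
  obtain ⟨N, d, n, hN, hd, h⟩ := exists_integral_decomposition h hδ
  refine ⟨N, d, hN, hd, ?_⟩
  have h1 : (QuotientAddGroup.mk (N • D + -d • E) : PicGroup X) =
      QuotientAddGroup.mk (∑ i, n i • B i) := by
    have h2 : (QuotientAddGroup.mk' (principalDivisor X).range (∑ i, n i • B i) : PicGroup X) =
        ∑ i, n i • (QuotientAddGroup.mk (B i) : PicGroup X) := by
      rw [map_sum]
      exact Finset.sum_congr rfl fun i _ => map_nsmul _ _ _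
    refine Eq.trans ?_ (h.trans h2.symm)
    rw [neg_smul, ← sub_eq_add_neg]
    rfl
  -- Here div f is the effective sum minus ND - dE, so f is a nonzero section of ND - dE.
  obtain ⟨f, hf⟩ := QuotientAddGroup.eq.mp h1
  have hB' : (∑ i, n i • B i).IsSection 1 := by
    refine CartierDivisor.IsEffective.isSection ?_
    refine Finset.sum_induction _ CartierDivisor.IsEffective (fun _ _ => .add)
      CartierDivisor.isEffective_zero fun i _ => ?_
    induction n i with
    | zero => rw [zero_smul]; exact CartierDivisor.isEffective_zero
    | succ m ih => rw [succ_nsmul]; exact ih.add (hB i)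
  have hf' : (-principalDivisor X f).IsSection (f.toMul : RatFun X) :=
    CartierDivisor.isSection_of_exists fun x =>
      ⟨_, (CartierDivisor.isEquationAt_principalDivisor x f.toMul).neg, by simp⟩
  refine ⟨1 * (f.toMul : RatFun X), mul_ne_zero one_ne_zero (Units.ne_zero _), ?_⟩
  have := hB'.mul hf'
  rw [hf] at this
  convert this using 1
  abel

end Thresholds

/-! ### Comparison of the two sets of thresholds. -/

section TangentThresholds

variable {X : Scheme.{0}} [IsIntegral X] (p : X ⟶ Spec (.of ℂ))

/-- The quotients `d / r` such that `H⁰(X, Sym^r T_X ⊗ O(-dA)) ≠ 0`. -/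
def symmetricThresholds (A : CartierDivisor X) : Set ℝ :=
  {q : ℝ | ∃ (d : ℤ) (r : ℕ), 0 < r ∧ q = d / r ∧
    ∃ s ∈ globalSymTwist (tangentSheaf p) r (-d • A), s ≠ 0}

section

variable [LocallyOfFiniteType p] [(tangentSheaf p).IsLocallyFree] (A : CartierDivisor X)

/-- A symmetric tensor makes rξ - dπ^*A effective, and the effective cone is stable under division
by r. -/
lemma symmetricThresholds_subset : symmetricThresholds p A ⊆ effectiveThresholds p A := by
  rintro _ ⟨d, r, hr, rfl, hs⟩
  obtain ⟨ξ, τ, h⟩ := exists_isTautologicalFor (tangentSheaf p)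
  refine ⟨ξ, h.isTautological, ?_⟩
  obtain ⟨φ, h0, hφ⟩ := h.exists_globalSymTwist_iff.mp hs
  have h1 := Submodule.smul_mem _ (r : NNReal)⁻¹ (hφ.cls_mem h0)
  convert h1 using 1
  have hr' : (r : ℝ) ≠ 0 := by exact_mod_cast hr.ne'
  rw [CartierDivisor.pullback_zsmul, CartierDivisor.cls_add, CartierDivisor.cls_zsmul,
    CartierDivisor.cls_nsmul, NNReal.smul_def, smul_add, smul_smul, smul_smul]
  push_cast
  rw [inv_mul_cancel₀ hr', one_smul, sub_eq_add_neg, ← neg_smul]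
  congr 2
  ring

lemma exists_lt_of_mem_effectiveThresholds {ε : ℝ} (hε : ε ∈ effectiveThresholds p A) {δ : ℝ}
    (hδ : 0 < δ) : ∃ q ∈ symmetricThresholds p A, ε - δ < q := by
  obtain ⟨ξ, hξ, hε⟩ := hε
  obtain ⟨τ, h⟩ := hξ.exists_for
  obtain ⟨N, d, hN, hd, s, hs0, hs⟩ := exists_isSection_of_mem_effectiveCone hε hδ
  refine ⟨d / N, ⟨d, N, hN, rfl, h.exists_globalSymTwist_iff.mpr ⟨s, hs0, ?_⟩⟩, hd⟩
  rwa [CartierDivisor.pullback_zsmul]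

end

variable [IsProper p] [(tangentSheaf p).IsLocallyFree] {A : CartierDivisor X}

lemma bddAbove_symmetricThresholds (hA : A.IsAmple) : BddAbove (symmetricThresholds p A) := by
  obtain ⟨m, hm⟩ := hA.exists_bound p
  refine ⟨2 * m, ?_⟩
  rintro _ ⟨d, r, hr, rfl, hs⟩
  have hr' : (0 : ℝ) < r := by exact_mod_cast hr
  rw [div_le_iff₀ hr']
  have h : (d : ℝ) ≤ 2 * r * m := by exact_mod_cast hm d r hs
  linarith

/-- A nonzero vector field on a set containing X_{s₀}, multiplied by s₀^N, becomes a section of T_X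
⊗ O(NmA); this gives d = -Nm and r = 1. -/
lemma symmetricThresholds_nonempty (hA : A.IsAmple) : (symmetricThresholds p A).Nonempty := by
  have : CompactSpace X := (quasiCompact_iff_compactSpace p).mp inferInstance
  obtain ⟨m, s₀, U, hm, hs₀, h0, hU, -⟩ := hA.exists_generators p
  obtain ⟨D, hD⟩ := exists_sec_ne_zero (tangentSheaf p) U
  obtain ⟨N, hN⟩ := RatSheaf.exists_isTwistedSection_pow hs₀ U hU h0 D.2
  obtain ⟨ξ, τ, h⟩ := exists_isTautologicalFor (tangentSheaf p)
  have h1 := h.isSection_of_isTwistedSection D.2 (hN N le_rfl)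
  refine ⟨_, -(N * m : ℕ), 1, one_pos, rfl, h.exists_globalSymTwist_iff.mpr
    ⟨pullbackFunction (projectivizationMap (tangentSheaf p)) (s₀ ^ N) * τ D, ?_, ?_⟩⟩
  · exact mul_ne_zero ((map_ne_zero _).mpr (pow_ne_zero N h0)) (h.ne_zero U D hD)
  · rwa [one_smul, neg_neg, natCast_zsmul, mul_smul]

/-- An upper bound of the symmetric thresholds bounds every effective ε, because ε - δ lies below
some symmetric threshold for each δ > 0. -/
lemma isLUB_effectiveThresholds (hA : A.IsAmple) :
    IsLUB (effectiveThresholds p A) (tangentThreshold p A) := by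
  refine isLUB_csSup ((symmetricThresholds_nonempty p hA).mono (symmetricThresholds_subset p A)) ?_
  obtain ⟨B, hB⟩ := bddAbove_symmetricThresholds p hA
  refine ⟨B, fun ε hε => le_of_forall_pos_le_add fun δ hδ => ?_⟩
  obtain ⟨q, hq, h⟩ := exists_lt_of_mem_effectiveThresholds p A hε hδ
  linarith [hB hq]

lemma isLUB_symmetricThresholds (hA : A.IsAmple) :
    IsLUB (symmetricThresholds p A) (tangentThreshold p A) := by
  have h := isLUB_effectiveThresholds p hA
  refine ⟨fun q hq => h.1 (symmetricThresholds_subset p A hq), fun B hB => h.2 fun ε hε => ?_⟩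
  refine le_of_forall_pos_le_add fun δ hδ => ?_
  obtain ⟨q, hq, h⟩ := exists_lt_of_mem_effectiveThresholds p A hε hδ
  linarith [hB hq]

end TangentThresholds

/-! ### Generators of the function field of P(F). -/

section FunctionField

variable {X : Scheme.{0}} [IsIntegral X] {W : Type} [AddCommGroup W] [Module (RatFun X) W]
  {F : RatSheaf X W} [F.IsQuasiCoherent] [F.IsLocallyFree]
  {ξ : CartierDivisor (projectivization F)} {τ : W → RatFun (projectivization F)}

namespace IsTautologicalFor

variable (h : IsTautologicalFor ξ τ)

include h

/-- The function field of `P(F)` is generated by the quotients of sections of a basis. -/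
lemma eq_top_of_mem {V : AffOpen X} {n : ℕ} {e : Fin n → W} (he : F.IsFreeOn V e) (i₀ : Fin n)
    {S : Subfield (RatFun (projectivization F))}
    (hX : ∀ f, pullbackFunction (projectivizationMap F) f ∈ S)
    (hS : ∀ i, τ (e i) / τ (e i₀) ∈ S) : S = ⊤ := by
  have := he.isDomain
  obtain ⟨m, hm⟩ : ∃ m, m = he.basis i₀ := ⟨_, rfl⟩
  have hm0 : m ≠ 0 := by rw [hm]; exact he.basis.ne_zero i₀
  have hme : (m : W) = e i₀ := by rw [hm, he.coe_basis]
  have hτ0 : τ m ≠ 0 := h.ne_zero V m hm0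
  -- Expanding each linear factor in the basis writes the quotient as a polynomial in the τ(e i) /
  -- τ(e i₀) with coefficients from K(X).
  have hev : ∀ (k : ℕ), ∀ P ∈ symPow Γ(X, V.toOpens) (F.Sec V) k,
      h.realization.eval V P / τ m ^ k ∈ S := by
    intro k P hP
    unfold symPow at hP
    induction hP using Submodule.pow_induction_on_left' with
    | algebraMap a =>
      rw [pow_zero, div_one, RatSheaf.Realization.eval_algebraMap]
      exact hX _
    | add P Q i _ _ hP hQ => rw [map_add, add_div]; exact add_mem hP hQ
    | mem_mul w hw i P _ ih =>
      obtain ⟨w, rfl⟩ := hw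
      rw [map_mul, pow_succ', mul_div_mul_comm]
      refine mul_mem ?_ ih
      rw [← he.basis.sum_repr w, map_sum, map_sum, Finset.sum_div]
      refine sum_mem fun j _ => ?_
      rw [map_smul, RatSheaf.Realization.eval_smul, RatSheaf.Realization.eval_ι, he.coe_basis,
        mul_div_assoc, hme]
      exact mul_mem (hX _) (hS j)
  obtain ⟨z₀, hz₀⟩ := exists_mem_basicOpen_of_ne_zero hm0
  let Ω : AffOpen (projectivization F) := ⟨projectivizationChart F V ''ᵁ
    Proj.basicOpen (symPow Γ(X, V.toOpens) (F.Sec V)) (SymmetricAlgebra.ι _ _ m),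
    (Proj.isAffineOpen_basicOpen _ _ (ι_mem_symPow _ m) one_pos).image_of_isOpenImmersion _,
    ⟨_, z₀, hz₀, rfl⟩⟩
  -- A regular function on the affine set m ≠ 0 is P / m^k, which is the value of P divided by
  -- τ(m)^k. These functions have K(P(F)) as fraction field.
  have hΩ : ∀ a, Ω.toRat a ∈ S := by
    intro a
    obtain ⟨k, P, hP, h1⟩ := exists_chartVal_mul_eq hm0 (φ := Ω.toRat a) fun z hz =>
      Ω.toRat_mem_localRing a ⟨z, hz, rfl⟩
    have h2 : Ω.toRat a = h.realization.eval V P / τ m ^ k := by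
      rw [eq_div_iff (pow_ne_zero k hτ0)]
      apply chartVal_injective V
      apply ((isUnit_coneMap_ι hm0).pow k).mul_right_cancel
      rw [h.chartVal_eval V hm0 hP, map_mul, map_pow, mul_right_comm, h1]
    rw [h2]
    exact hev k P hP
  rw [eq_top_iff]
  rintro t -
  let _ := Ω.toRat.toAlgebra
  have := Ω.isFractionRing
  obtain ⟨a, b, -, rfl⟩ := IsFractionRing.div_surjective (A := Γ(projectivization F, Ω.toOpens)) t
  exact div_mem (hΩ a) (hΩ b)

end IsTautologicalFor

lemma constants_comp {Y : Scheme.{0}} [IsIntegral Y] (g : Y ⟶ X) [IsDominant g]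
    (p : X ⟶ Spec (.of ℂ)) (c : ℂ) :
    constants (g ≫ p) c = pullbackFunction g (constants p c) := by
  have h1 : constants p c = germRat ⊤ trivial (p.appTop.hom ((Scheme.ΓSpecIso (.of ℂ)).inv.hom c)) :=
    stalkToRat_germ ⊤ _ _ _
  have h2 : constants (g ≫ p) c = germRat (g ⁻¹ᵁ ⊤) trivial
      ((g.app ⊤).hom (p.appTop.hom ((Scheme.ΓSpecIso (.of ℂ)).inv.hom c))) := by
    refine (stalkToRat_germ ⊤ _ _ _).trans ?_
    rw [Scheme.Hom.comp_appTop]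
    rfl
  rw [h1, h2]
  exact (pullbackFunction_germRat g ⊤ trivial trivial _).symm

end FunctionField

/-! ### Bigness yields sections of kξ - aπ^*A. -/

section Denominators

variable {Y : Scheme.{0}} [IsIntegral Y] (q : Y ⟶ Spec (.of ℂ)) {B : CartierDivisor Y}

/-- The elements of the field generated by quotients of sections are themselves quotients of
sections of multiples. -/
lemma exists_denominator {b : RatFun Y} (hb0 : b ≠ 0) (hb : B.IsSection b) {t : RatFun Y}
    (ht : t ∈ Subfield.closure (Set.range (constants q) ∪
      {t | ∃ a b, B.IsSection a ∧ B.IsSection b ∧ b ≠ 0 ∧ t = a / b})) :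
    ∃ k : ℕ, 0 < k ∧ ∃ Q, Q ≠ 0 ∧ (k • B).IsSection Q ∧ (k • B).IsSection (Q * t) := by
  induction ht using Subfield.closure_induction with
  | mem x hx =>
    rcases hx with ⟨c, rfl⟩ | ⟨a, b, ha, hb, hb0, rfl⟩
    · refine ⟨1, one_pos, b, hb0, by rwa [one_smul], ?_⟩
      rw [one_smul, ← add_zero B]
      exact hb.mul (isSection_constants q c)
    · refine ⟨1, one_pos, b, hb0, by rwa [one_smul], ?_⟩
      rwa [one_smul, mul_div_cancel₀ _ hb0]
  | one => exact ⟨1, one_pos, b, hb0, by rwa [one_smul], by rwa [one_smul, mul_one]⟩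
  | add x y _ _ hx hy =>
    obtain ⟨k, hk, Q, hQ0, hQ, hQx⟩ := hx
    obtain ⟨l, hl, R, hR0, hR, hRy⟩ := hy
    refine ⟨k + l, by omega, Q * R, mul_ne_zero hQ0 hR0, ?_, ?_⟩
    · rw [add_smul]; exact hQ.mul hR
    · have := (hQx.mul hR).add (hQ.mul hRy)
      rw [add_smul]
      convert this using 1
      ring
  | neg x _ hx =>
    obtain ⟨k, hk, Q, hQ0, hQ, hQx⟩ := hx
    exact ⟨k, hk, Q, hQ0, hQ, by rw [mul_neg]; exact hQx.neg⟩
  | inv x _ hx =>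
    obtain ⟨k, hk, Q, hQ0, hQ, hQx⟩ := hx
    by_cases hx0 : x = 0
    · exact ⟨k, hk, Q, hQ0, hQ, by rw [hx0, inv_zero]; rwa [hx0] at hQx⟩
    -- The former numerator Q x serves as the denominator of x⁻¹.
    · exact ⟨k, hk, Q * x, mul_ne_zero hQ0 hx0, hQx, by rwa [mul_assoc, mul_inv_cancel₀ hx0, mul_one]⟩
  | mul x y _ _ hx hy =>
    obtain ⟨k, hk, Q, hQ0, hQ, hQx⟩ := hx
    obtain ⟨l, hl, R, hR0, hR, hRy⟩ := hy
    refine ⟨k + l, by omega, Q * R, mul_ne_zero hQ0 hR0, ?_, ?_⟩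
    · rw [add_smul]; exact hQ.mul hR
    · have := hQx.mul hRy
      rw [add_smul]
      convert this using 1
      ring

lemma exists_common_denominator {b : RatFun Y} (hb0 : b ≠ 0) (hb : B.IsSection b)
    (htop : Subfield.closure (Set.range (constants q) ∪
      {t | ∃ a b, B.IsSection a ∧ B.IsSection b ∧ b ≠ 0 ∧ t = a / b}) = ⊤) {ι : Type}
    (T : Finset ι) (t : ι → RatFun Y) :
    ∃ k : ℕ, 0 < k ∧ ∃ Q, Q ≠ 0 ∧ (k • B).IsSection Q ∧ ∀ i ∈ T, (k • B).IsSection (Q * t i) := by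
  classical
  induction T using Finset.induction_on with
  | empty => exact ⟨1, one_pos, b, hb0, by rwa [one_smul], by simp⟩
  | insert j T _ ih =>
    obtain ⟨k, hk, Q, hQ0, hQ, hQt⟩ := ih
    obtain ⟨l, hl, R, hR0, hR, hRt⟩ := exists_denominator q hb0 hb (t := t j)
      (htop ▸ Subfield.mem_top _)
    refine ⟨k + l, by omega, Q * R, mul_ne_zero hQ0 hR0, ?_, fun i hi => ?_⟩
    · rw [add_smul]; exact hQ.mul hR
    · rw [add_smul]
      rcases Finset.mem_insert.mp hi with rfl | hi
      · rw [mul_assoc]; exact hQ.mul hRt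
      · rw [mul_right_comm]; exact (hQt i hi).mul hR

/-- A big divisor on a variety over `X` dominates the pullback of an ample divisor. -/
lemma CartierDivisor.IsBig.exists_isSection {X : Scheme.{0}} [IsIntegral X] [CompactSpace X]
    (g : Y ⟶ X) [IsDominant g] {A : CartierDivisor X} (hA : A.IsAmple) {ξ : CartierDivisor Y}
    (hξ : ξ.IsBig q) : ∃ k a : ℕ, 0 < k ∧ 0 < a ∧
      ∃ φ, φ ≠ 0 ∧ (k • ξ + (-(a : ℤ) • A).pullback g).IsSection φ := by
  obtain ⟨m, hm, ⟨b, hb0, hb⟩, htop⟩ := hξ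
  obtain ⟨a, ha, T, u, hu, hgen⟩ := hA.exists_isGeneratorAt
  obtain ⟨i₀, -, hi₀⟩ := hgen (genericPoint X)
  obtain ⟨k, hk, Q, hQ0, hQ, hQt⟩ := exists_common_denominator q hb0 hb htop T
    fun i => pullbackFunction g (u i / u i₀)
  have h0 : pullbackFunction g (u i₀) ≠ 0 := (map_ne_zero _).mpr hi₀.ne_zero
  refine ⟨k * m, a, Nat.mul_pos hk hm, ha, Q / pullbackFunction g (u i₀), div_ne_zero hQ0 h0,
    isSection_of_exists fun y => ?_⟩
  -- Some u_i generates aA at g y, so its pullback is an equation of -aπ^*A at y, and (Q / u_{i₀})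
  -- u_i = Q (u_i / u_{i₀}) is a section of the multiple of ξ.
  obtain ⟨i, hi, hui⟩ := hgen (g y)
  obtain ⟨f, hf⟩ := (k • m • ξ).exists_isEquationAt y
  rw [mul_smul, neg_smul, natCast_zsmul]
  refine ⟨_, hf.add (hui.isEquationAt.neg.pullback g), ?_⟩
  have h1 := (hQt i hi).mem hf
  convert h1 using 1
  rw [inv_inv, Units.val_mul, map_div₀]
  change _ / _ * (f * pullbackFunction g (u i)) = _
  ring

end Denominators

/-! ### Bigness of the tangent bundle and positivity of the threshold. -/

section Bigness

variable {X : Scheme.{0}} [IsIntegral X] (p : X ⟶ Spec (.of ℂ)) [IsProper p]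
  [(tangentSheaf p).IsLocallyFree] {A : CartierDivisor X}

lemma tangentThreshold_pos_of_tangentIsBig (hA : A.IsAmple) (h : TangentIsBig p) :
    0 < tangentThreshold p A := by
  have : CompactSpace X := (quasiCompact_iff_compactSpace p).mp inferInstance
  obtain ⟨ξ, hξ, hbig⟩ := h
  obtain ⟨τ, h⟩ := hξ.exists_for
  obtain ⟨k, a, hk, ha, φ, h0, hφ⟩ := hbig.exists_isSection _ (projTangentMap p) hA
  have h1 : ((a : ℤ) : ℝ) / k ∈ symmetricThresholds p A :=
    ⟨a, k, hk, rfl, h.exists_globalSymTwist_iff.mpr ⟨φ, h0, hφ⟩⟩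
  refine lt_of_lt_of_le ?_ ((isLUB_symmetricThresholds p hA).1 h1)
  have : (0 : ℝ) < k := by exact_mod_cast hk
  have : (0 : ℝ) < (a : ℤ) := by exact_mod_cast ha
  positivity

/-- A positive twist of a symmetric power of the tangent sheaf with a section yields many sections
of a multiple of the tautological divisor. -/
lemma exists_isSection_mul_pullback [CompactSpace X] {ξ : CartierDivisor (projTangent p)}
    {τ : Derivation ℤ (RatFun X) (RatFun X) → RatFun (projTangent p)} (h : IsTautologicalFor ξ τ)
    {d r m : ℕ} (hd : 0 < d) {φ : RatFun (projTangent p)} (hφ0 : φ ≠ 0)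
    (hφ : (r • ξ + (-(d : ℤ) • A).pullback (projTangentMap p)).IsSection φ) {s₀ : RatFun X}
    (hs₀ : (m • A).IsSection s₀) (h0 : s₀ ≠ 0) {U : AffOpen X}
    (hU : ∀ y, (m • A).IsGeneratorAt s₀ y → y ∈ U.toOpens) {n : ℕ}
    {w : Fin n → Derivation ℤ (RatFun X) (RatFun X)} (hw : ∀ i, w i ∈ (tangentSheaf p).sec U) :
    ∃ M : ℕ, 0 < M ∧ ∃ ψ, ψ ≠ 0 ∧ ∀ i b, (m • A).IsSection b →
      (M • ξ).IsSection (ψ * τ (w i) * pullbackFunction (projTangentMap p) b) := by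
  choose N₀ hN₀ using fun i => RatSheaf.exists_isTwistedSection_pow hs₀ U hU h0 (hw i)
  obtain ⟨N, hN⟩ : ∃ N, N = ∑ i, N₀ i := ⟨_, rfl⟩
  have hNi : ∀ i, N₀ i ≤ N := fun i =>
    hN ▸ Finset.single_le_sum (fun _ _ => Nat.zero_le _) (Finset.mem_univ i)
  obtain ⟨d, rfl⟩ : ∃ d', d = d' + 1 := ⟨d - 1, by omega⟩
  let π := pullbackFunction (projTangentMap p)
  -- With d = d' + 1, the factor φ^(m(N+1)) contributes -m(N+1)(d'+1) to the coefficient of π^*A,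
  -- s₀^N τ(w i) contributes Nm, b contributes m, and s₀^((N+1)d') contributes the remaining
  -- m(N+1)d'; the total is 0.
  refine ⟨m * (N + 1) * r + 1, Nat.succ_pos _,
    φ ^ (m * (N + 1)) * π (s₀ ^ N) * π (s₀ ^ ((N + 1) * d)), ?_, fun i b hb => ?_⟩
  · exact mul_ne_zero (mul_ne_zero (pow_ne_zero _ hφ0) ((map_ne_zero _).mpr (pow_ne_zero _ h0)))
      ((map_ne_zero _).mpr (pow_ne_zero _ h0))
  · have h1 := h.isSection_of_isTwistedSection (hw i) (hN₀ i N (hNi i))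
    have h2 := (((hφ.pow (m * (N + 1))).mul h1).mul
      ((hs₀.pow ((N + 1) * d)).pullback (projTangentMap p))).mul (hb.pullback (projTangentMap p))
    convert h2 using 1
    · simp only [CartierDivisor.pullback_nsmul, CartierDivisor.pullback_zsmul]
      generalize A.pullback (projTangentMap p) = B
      simp only [← natCast_zsmul]
      push_cast
      module
    · ring

lemma tangentIsBig_of_tangentThreshold_pos (hA : A.IsAmple) (hpos : 0 < tangentThreshold p A) :
    TangentIsBig p := by
  have : CompactSpace X := (quasiCompact_iff_compactSpace p).mp inferInstance
  obtain ⟨_, ⟨d, r, hr, rfl, hs⟩, hdr⟩ := (lt_isLUB_iff (isLUB_symmetricThresholds p hA)).mp hpos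
  have hr' : (0 : ℝ) < r := by exact_mod_cast hr
  have hd : 0 < d := by
    have := (div_pos_iff_of_pos_right hr').mp hdr
    exact_mod_cast this
  obtain ⟨d, rfl⟩ := Int.eq_ofNat_of_zero_le hd.le
  obtain ⟨ξ, τ, h⟩ := exists_isTautologicalFor (tangentSheaf p)
  obtain ⟨φ, hφ0, hφ⟩ := h.exists_globalSymTwist_iff.mp hs
  obtain ⟨m, s₀, U, hm, hs₀, h0, hU, ι, hι, s, hs', htop⟩ := hA.exists_generators p
  obtain ⟨V, n, hn, e, hV, -, he⟩ := (tangentSheaf p).exists_free U U.genericPoint_mem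
  obtain ⟨g, hg⟩ := id hV
  -- The basis e lives on V only; powers of g make it a family of sections over U, which contains
  -- X_{s₀}, so that powers of s₀ can globalize it.
  choose k hk using fun i => RatSheaf.IsQuasiCoherent.exists_pow (F := tangentSheaf p) V U g hg
    (e i) (he.mem i)
  have hg0 : U.toRat g ≠ 0 := by
    intro hg0
    rw [← map_zero U.toRat] at hg0
    have h1 := hg
    rw [U.toRat_injective hg0, Scheme.basicOpen_zero] at h1
    have h2 := V.genericPoint_mem
    rw [← h1] at h2
    exact h2
  let π := pullbackFunction (projTangentMap p)
  have hτ : ∀ i, τ (U.toRat g ^ k i • e i) = π (U.toRat g ^ k i) * τ (e i) := fun i =>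
    h.realization.map_smul_of_mem (he.mem i) (hk i)
  have hτ0 : ∀ i, τ (e i) ≠ 0 := fun i => by
    refine h.ne_zero V ⟨e i, he.mem i⟩ fun h1 => he.indep.ne_zero i ?_
    exact congrArg Subtype.val h1
  have hπ0 : ∀ i, π (U.toRat g ^ k i) ≠ 0 := fun i => (map_ne_zero _).mpr (pow_ne_zero _ hg0)
  obtain ⟨M, hM, ψ, hψ0, hψ⟩ := exists_isSection_mul_pullback p h (by exact_mod_cast hd) hφ0 hφ hs₀
    h0 hU hk
  let i₀ : Fin n := ⟨0, hn⟩
  have hτ1 : ∀ i, τ (U.toRat g ^ k i • e i) ≠ 0 := fun i => by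
    rw [hτ]; exact mul_ne_zero (hπ0 i) (hτ0 i)
  have hb0 : ψ * τ (U.toRat g ^ k i₀ • e i₀) * π s₀ ≠ 0 :=
    mul_ne_zero (mul_ne_zero hψ0 (hτ1 _)) ((map_ne_zero _).mpr h0)
  refine ⟨ξ, h.isTautological, M, hM, ⟨_, hb0, hψ i₀ s₀ hs₀⟩, ?_⟩
  generalize hS : (Subfield.closure _ : Subfield (RatFun (projTangent p))) = S
  have hquot : ∀ a b, (M • ξ).IsSection a → (M • ξ).IsSection b → b ≠ 0 → a / b ∈ S :=
    fun a b ha hb hb0 => hS ▸ Subfield.subset_closure (Or.inr ⟨a, b, ha, hb, hb0, rfl⟩)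
  -- Varying b with w_{i₀} fixed, the quotients are the π^*(s_j / s₀), which with the constants
  -- generate π^*K(X).
  have hX : ∀ f, π f ∈ S := by
    have h1 : Subfield.closure (Set.range (constants p) ∪ Set.range fun j => s j / s₀) ≤
        S.comap π := by
      rw [Subfield.closure_le]
      rintro _ (⟨c, rfl⟩ | ⟨j, rfl⟩)
      · rw [SetLike.mem_coe, Subfield.mem_comap, ← constants_comp, ← hS]
        exact Subfield.subset_closure (Or.inl ⟨c, rfl⟩)
      · rw [SetLike.mem_coe, Subfield.mem_comap]
        have h2 := hquot _ _ (hψ i₀ (s j) (hs' j)) (hψ i₀ s₀ hs₀) hb0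
        rwa [mul_div_mul_left _ _ (mul_ne_zero hψ0 (hτ1 _)), ← map_div₀] at h2
    rw [htop] at h1
    exact fun f => h1 (Subfield.mem_top f)
  refine h.eq_top_of_mem he i₀ hX fun i => ?_
  -- Varying i with b = s₀ fixed gives τ(e i) / τ(e i₀) up to a factor g^(k i) / g^(k i₀) from K(X).
  have h2 := hquot _ _ (hψ i s₀ hs₀) (hψ i₀ s₀ hs₀) hb0
  rw [mul_div_mul_right _ _ ((map_ne_zero _).mpr h0), mul_div_mul_left _ _ hψ0, hτ, hτ,
    mul_div_mul_comm, ← map_div₀] at h2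
  have h3 := mul_mem (inv_mem (hX (U.toRat g ^ k i / U.toRat g ^ k i₀))) h2
  rwa [inv_mul_cancel_left₀] at h3
  rw [map_div₀]
  exact div_ne_zero (hπ0 _) (hπ0 _)

end Bigness

end TangentBig

end

theorem proposition3p1 (X : Scheme.{0}) [IsIntegral X] (p : X ⟶ Spec (.of ℂ))
    (n : ℕ) (hn : 0 < n) [Smooth p] [SmoothOfRelativeDimension n p] (hp : IsProjective p)
    (A : CartierDivisor X) (hA : A.IsAmple) :
    ∃ (_ : IsIntegral (projTangent p)) (_ : IsDominant (projTangentMap p)),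
      IsLUB (effectiveThresholds p A) (tangentThreshold p A) ∧
      IsLUB {q : ℝ | ∃ (d : ℤ) (r : ℕ), 0 < r ∧ q = d / r ∧
        ∃ s ∈ globalSymTwist (tangentSheaf p) r (-d • A), s ≠ 0} (tangentThreshold p A) ∧
      (TangentIsBig p ↔ 0 < tangentThreshold p A) := by
  have := hp.isProper
  have := isLocallyFree_tangentSheaf p n hn
  exact ⟨inferInstance, inferInstance, isLUB_effectiveThresholds p hA,
    isLUB_symmetricThresholds p hA, tangentThreshold_pos_of_tangentIsBig p hA,
    tangentIsBig_of_tangentThreshold_pos p hA⟩
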